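/- Let $c\in\mathbb C\setminus\{0\}$ and $\psi=\pm\frac{\pi}{3}+2\pi m$ with $m\in\mathbb Z$. Let $\Omega$ be a connected open subset of the Riemann sphere and $F$ a meromorphic function on $\Omega$. All statements about the solution and its metric hold in the coordinate $\xi$ and, near $\infty$, in the coordinate $1/\xi$. **(1) Metric.** Where $F\neq 0,\infty$, the meron-type functions $$w_1=\frac{F}{\bar F},\qquad w_2=\frac{c}{\bar c}\,\frac{F^{e^{i\psi}}}{\bar F^{\,e^{-i\psi}}}$$ are smooth, satisfy $|w_1|=|w_2|=1$, and solve the $\mathbb CP^2$ model equations $$\partial\bar\partial w_i-\frac{2\bar w_i}{A}\partial w_i\bar\partial w_i-\frac{\bar w_j}{A}\left(\partial w_i\bar\partial w_j+\bar\partial w_i\partial w_j\right)=0,\qquad \{i,j\}=\{1,2\},\quad A=1+|w_1|^2+|w_2|^2 .$$ Put $f=(1,\bar w_1,\bar w_2)^T$ and $P=I_3-\frac{f f^\dagger}{f^\dagger f}$. Locally there is a map $X$ into $su(3)$ with $dX=i\left(-[\partial P,P]\,d\xi+[\bar\partial P,P]\,d\bar\xi\right)$. For every such $X$, the metric induced from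 the scalar product $\langle A,B\rangle=-\frac12\operatorname{tr}(AB)$ is $$I=\tfrac23\,|d\ln F|^2=\tfrac23\left|\frac{F'}{F}\right|^2 d\xi\,d\bar\xi .$$ **(2) Cylinders.** Assume moreover that $F$ is nonconstant and that the differential $d\ln F=\frac{F'}{F}d\xi$ has at least one zero in $\Omega$. A closed trajectory is a simple closed curve in $\Omega$ that avoids the zeros and poles of $d\ln F$ and along which $\operatorname{Re}\int\frac{F'}{F}d\xi=\ln|F|$ is constant. Let $p\in\Omega$ be a simple pole of $d\ln F$ with residue $r$ (the case $p=\infty$ is allowed; the residue is that of the differential). Consider the connected open sets $U\subset\Omega$, free of zeros and poles of $d\ln F$, such that every point of $U$ lies on a closed trajectory contained in $U$ and homotopic in $U$ to all sufficiently small circles around $p$. Among these there is a largest one, $\mathcal D_p$. With the flat metric $|d\ln F|^2$, $\mathcal D_p$ is isometric to the semi-infinite cylinder $(\mathbb R/L\mathbb Z)\times(0,\infty)$ of perimeter $L=2\pi|r|$, its infinite end being at $p$. Equivalently, in the induced metric $I=\frac23|d\ln F|^2$ it is a semi-infinite cylinder of perimeter $\sqrt{2/3}\cdot2\pi|r|$.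 The domains $\mathcal D_p$ of distinct poles are disjoint. **(3) Decomposition.** Suppose in addition that $\Omega$ is the whole sphere (so that $F$ is rational). The closures of the cylinders $\mathcal D_p$, $p$ running over the simple poles of $d\ln F$, cover the sphere if and only if all zeros of $d\ln F$ lie on one level curve $|F|=k$. In that case the complement of that level curve is exactly the union of the sets $\mathcal D_p\cup\{p\}$. **(4) Example.** For $F=\xi(\xi-1)$ the only zero of $d\ln F$ is $\xi=\frac12$, and its poles are $0,1,\infty$, all simple, with residues $1,1,-2$. The sets $\mathcal D_0,\mathcal D_1,\mathcal D_\infty$ are pairwise disjoint semi-infinite cylinders of perimeters $2\pi,2\pi,4\pi$ (in the metric $|d\ln F|^2$), and their closures cover the sphere. -/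

import Mathlib

open Filter Topology
open scoped ComplexConjugate Matrix

noncomputable section

/-! ### The `ℂP²` model and the Weierstrass immersion -/

/-- `∂ = (∂_{ξ¹} - i ∂_{ξ²}) / 2`. -/
def wirtD (g : ℂ → ℂ) (t : ℂ) : ℂ :=
  (1 / 2 : ℂ) * (fderiv ℝ g t 1 - Complex.I * fderiv ℝ g t Complex.I)

/-- `∂̄ = (∂_{ξ¹} + i ∂_{ξ²}) / 2`. -/
def wirtDbar (g : ℂ → ℂ) (t : ℂ) : ℂ :=
  (1 / 2 : ℂ) * (fderiv ℝ g t 1 + Complex.I * fderiv ℝ g t Complex.I)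

/-- The left-hand side of the `ℂP²` model equation for `u`, the other field being `w`. -/
def cp2Expr (u w : ℂ → ℂ) (t : ℂ) : ℂ :=
  let A : ℂ := 1 + u t * conj (u t) + w t * conj (w t)
  wirtD (wirtDbar u) t - 2 * conj (u t) / A * (wirtD u t * wirtDbar u t)
    - conj (w t) / A * (wirtD u t * wirtDbar w t + wirtDbar u t * wirtD w t)

/-- `(w₁, w₂)` is a smooth solution on `U` of the `ℂP²` model equations.  (The conjugate
equations of the system are literally the complex conjugates of these two.) -/
structure IsCP2Solution (w₁ w₂ : ℂ → ℂ) (U : Set ℂ) : Prop where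
  smooth₁ : ContDiffOn ℝ ((⊤ : ℕ∞) : WithTop ℕ∞) w₁ U
  smooth₂ : ContDiffOn ℝ ((⊤ : ℕ∞) : WithTop ℕ∞) w₂ U
  eq₁ : ∀ t ∈ U, cp2Expr w₁ w₂ t = 0
  eq₂ : ∀ t ∈ U, cp2Expr w₂ w₁ t = 0

/-- First component `G / Ḡ` of the meron-type solution generated by `G`. -/
def meronW₁ (G : ℂ → ℂ) (t : ℂ) : ℂ := G t / conj (G t)

/-- Second component `(c / c̄) G^{e^{iψ}} / Ḡ^{e^{-iψ}}` of the meron-type solution, where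
`Ḡ^{e^{-iψ}}` is the conjugate of `G^{e^{iψ}}`; for `cos ψ = 1/2` the quotient does not depend
on the branch of `log G`. -/
def meronW₂ (c : ℂ) (ψ : ℝ) (G : ℂ → ℂ) (t : ℂ) : ℂ :=
  c / conj c * (G t ^ Complex.exp (Complex.I * ψ) / conj (G t ^ Complex.exp (Complex.I * ψ)))

/-- The rank-two orthogonal projector `1 - f f† / (f† f)`, with `f = (1, w̄₁, w̄₂)ᵀ`. -/
def cp2Projector (w₁ w₂ : ℂ → ℂ) (t : ℂ) : Matrix (Fin 3) (Fin 3) ℂ :=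
  let f : Fin 3 → ℂ := ![1, conj (w₁ t), conj (w₂ t)]
  1 - (star f ⬝ᵥ f)⁻¹ • Matrix.vecMulVec f (star f)

/-- Entrywise `∂` of a matrix function. -/
def matD (P : ℂ → Matrix (Fin 3) (Fin 3) ℂ) (t : ℂ) : Matrix (Fin 3) (Fin 3) ℂ :=
  Matrix.of fun i j => wirtD (fun s => P s i j) t

/-- Entrywise `∂̄` of a matrix function. -/
def matDbar (P : ℂ → Matrix (Fin 3) (Fin 3) ℂ) (t : ℂ) : Matrix (Fin 3) (Fin 3) ℂ :=
  Matrix.of fun i j => wirtDbar (fun s => P s i j) t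

/-- The matrix-valued 1-form `i (-[∂P, P] dξ + [∂̄P, P] dξ̄)` at `t`, applied to the tangent
vector `v`. -/
def weierstrassForm (P : ℂ → Matrix (Fin 3) (Fin 3) ℂ) (t v : ℂ) : Matrix (Fin 3) (Fin 3) ℂ :=
  Complex.I • (-(v • (matD P t * P t - P t * matD P t))
    + conj v • (matDbar P t * P t - P t * matDbar P t))

/-- The scalar product `-tr(AB) / 2` of `su(3)`. -/
def suInner (A B : Matrix (Fin 3) (Fin 3) ℂ) : ℂ := -(1 / 2 : ℂ) * (A * B).trace

/-- The differential of a matrix function at `t`, applied to `v`. -/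
def matDiff (X : ℂ → Matrix (Fin 3) (Fin 3) ℂ) (t v : ℂ) : Matrix (Fin 3) (Fin 3) ℂ :=
  Matrix.of fun i j => fderiv ℝ (fun s => X s i j) t v

/-- `X : V → su(3)` is the generalized Weierstrass map of the projector `P`: its differential is
the Weierstrass 1-form. -/
structure IsWeierstrassMap (P X : ℂ → Matrix (Fin 3) (Fin 3) ℂ) (V : Set ℂ) : Prop where
  skew : ∀ t ∈ V, (X t)ᴴ = -X t
  traceless : ∀ t ∈ V, (X t).trace = 0
  differentiable : ∀ t ∈ V, ∀ i j, DifferentiableAt ℝ (fun s => X s i j) t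
  diff_eq : ∀ t ∈ V, ∀ v, matDiff X t v = weierstrassForm P t v

/-! ### Meromorphic functions on domains of the Riemann sphere `OnePoint ℂ` -/

/-- The standard local parameter centred at a point of the sphere: `t ↦ a + t` at `a ∈ ℂ`, and
`t ↦ 1 / t` at `∞`. -/
def sphereParam (x : OnePoint ℂ) (t : ℂ) : OnePoint ℂ :=
  x.elim (if t = 0 then OnePoint.infty else ((t⁻¹ : ℂ) : OnePoint ℂ))
    (fun a => ((a + t : ℂ) : OnePoint ℂ))

/-- `F` is a meromorphic function on `Ω`, normalized so that its value is `0` at its poles and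
the limit value elsewhere. -/
def IsMeromorphicFunOn (F : OnePoint ℂ → ℂ) (Ω : Set (OnePoint ℂ)) : Prop :=
  ∀ x ∈ Ω, MeromorphicNFAt (fun t => F (sphereParam x t)) 0

/-- The coefficient of the differential `d ln F = (F'/F) dξ` in the local parameter at `x`. -/
def dlogCoeff (F : OnePoint ℂ → ℂ) (x : OnePoint ℂ) (t : ℂ) : ℂ :=
  logDeriv (fun s => F (sphereParam x s)) t

/-- `x` is a zero of the differential `d ln F`. -/
def IsDlogZero (F : OnePoint ℂ → ℂ) (x : OnePoint ℂ) : Prop :=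
  0 < meromorphicOrderAt (dlogCoeff F x) 0

/-- `p` is a simple pole of the differential `d ln F`, with residue `r`. -/
def HasSimplePole (F : OnePoint ℂ → ℂ) (p : OnePoint ℂ) (r : ℂ) : Prop :=
  meromorphicOrderAt (dlogCoeff F p) 0 = -1 ∧
    Tendsto (fun t => t * dlogCoeff F p t) (𝓝[≠] 0) (𝓝 r)

/-- The points of `Ω` that are neither zeros nor poles of `d ln F`. -/
def regularPart (F : OnePoint ℂ → ℂ) (Ω : Set (OnePoint ℂ)) : Set (OnePoint ℂ) :=
  {x ∈ Ω | meromorphicOrderAt (dlogCoeff F x) 0 = 0}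

/-! ### Metrics, trajectories and cylinders

A quadratic form on the tangent vectors of the sphere is given by its values `g x v` on tangent
vectors `v` at `x`, written in the local parameter centred at `x`. -/

/-- The first fundamental form of the Weierstrass surface of the meron-type solution generated
by `F`. -/
def meronMetric (c : ℂ) (ψ : ℝ) (F : OnePoint ℂ → ℂ) (x : OnePoint ℂ) (v : ℂ) : ℝ :=
  let G : ℂ → ℂ := fun t => F (sphereParam x t)
  let P := cp2Projector (meronW₁ G) (meronW₂ c ψ G)
  (suInner (weierstrassForm P 0 v) (weierstrassForm P 0 v)).re

/-- The flat metric `|d ln F|²`, that is `|dω|²` with `ω = ∫ (F'/F) dξ`. -/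
def flatMetric (F : OnePoint ℂ → ℂ) (x : OnePoint ℂ) (v : ℂ) : ℝ := ‖dlogCoeff F x 0 * v‖ ^ 2

/-- A closed (vertical) trajectory: a simple closed curve of regular points along which
`Re ω = ln |F|` is constant. -/
structure IsClosedTrajectory (F : OnePoint ℂ → ℂ) (Ω : Set (OnePoint ℂ))
    (γ : Circle → OnePoint ℂ) : Prop where
  continuous : Continuous γ
  injective : Function.Injective γ
  regular : ∀ θ, γ θ ∈ regularPart F Ω
  const : ∃ k : ℝ, ∀ θ, Real.log ‖F (γ θ)‖ = k

/-- `U` is a connected domain, free of critical points, which is foliated by closed trajectories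
homotopic (in `U`) to the small circles around `p`. -/
structure IsFoliatedAround (F : OnePoint ℂ → ℂ) (Ω : Set (OnePoint ℂ)) (p : OnePoint ℂ)
    (U : Set (OnePoint ℂ)) : Prop where
  isOpen : IsOpen U
  connected : IsConnected U
  regular : U ⊆ regularPart F Ω
  foliated : ∀ x ∈ U, ∃ γ : C(Circle, U),
    IsClosedTrajectory F Ω (fun θ => (γ θ : OnePoint ℂ)) ∧ (∃ θ, (γ θ : OnePoint ℂ) = x) ∧
    ∀ᶠ ε : ℝ in 𝓝[>] 0, ∃ κ : C(Circle, U),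
      (∀ θ : Circle, (κ θ : OnePoint ℂ) = sphereParam p ((ε : ℂ) * (θ : ℂ))) ∧
      ContinuousMap.Homotopic γ κ

/-- The union of all connected domains foliated by closed trajectories homotopic to the small
circles around `p`. -/
def ringDomain (F : OnePoint ℂ → ℂ) (Ω : Set (OnePoint ℂ)) (p : OnePoint ℂ) :
    Set (OnePoint ℂ) :=
  ⋃₀ {U | IsFoliatedAround F Ω p U}

/-- `D` with the metric `g` is isometric to the semi-infinite flat cylinder
`(ℝ / Lℤ) × (0, ∞)` of perimeter `L`, metric `ds² + dτ²`, whose infinite end `τ → ∞` is at `p`. -/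
def IsSemiInfiniteCylinder (g : OnePoint ℂ → ℂ → ℝ) (p : OnePoint ℂ) (L : ℝ)
    (D : Set (OnePoint ℂ)) : Prop :=
  0 < L ∧ ∃ Φ : (AddCircle L × Set.Ioi (0 : ℝ)) ≃ₜ D,
    Tendsto (fun y => (Φ y : OnePoint ℂ))
      (comap (fun y : AddCircle L × Set.Ioi (0 : ℝ) => (y.2 : ℝ)) atTop) (𝓝 p) ∧
    ∀ (s : ℝ) (τ : Set.Ioi (0 : ℝ)), ∃ h : ℝ × ℝ → ℂ,
      ContDiffAt ℝ ((⊤ : ℕ∞) : WithTop ℕ∞) h (s, (τ : ℝ)) ∧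
      (∀ᶠ y : ℝ × ℝ in 𝓝 (s, (τ : ℝ)), ∃ hy : 0 < y.2,
        (Φ ((y.1 : AddCircle L), ⟨y.2, hy⟩) : OnePoint ℂ) =
          sphereParam (Φ ((s : AddCircle L), τ)) (h y)) ∧
      ∀ v : ℝ × ℝ,
        g (Φ ((s : AddCircle L), τ)) (fderiv ℝ h (s, (τ : ℝ)) v) = v.1 ^ 2 + v.2 ^ 2

/-- The polynomial `ξ (ξ - 1)` as a meromorphic function on the sphere (with a pole at `∞`). -/
def exampleF (x : OnePoint ℂ) : ℂ := x.elim 0 (fun ξ => ξ * (ξ - 1))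

end

/-!
The solution and its surface. Near a point where the local expression `G` of `F` is analytic and
non-zero, `G = exp g`, and both fields are unimodular: `w = γ exp (d g - conj (d g))` with `d = 1`
for `w₁` and `d = α = exp (iψ)` for `w₂`; the choice of the logarithm does not matter because
`2 Re α = 1`. For fields of this form the model equations reduce to `2 Re (d d̄') = |d|²`
(`IsPhase.cp2Expr_eq_zero`), which holds because `0, 1, α` are the vertices of an equilateral
triangle with unit sides. With `m` its centre, the Weierstrass form has the entries
`(i/3) w̄ᵢ wⱼ 2 Re (σᵢⱼ dg)`, `σᵢⱼ = (βᵢ - m) + (βⱼ - m)`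
(`IsPhaseProjector.weierstrassForm_apply`). Since `σᵢⱼ` is perpendicular to the side `βⱼ - βᵢ`, it
is the differential of an explicit `su(3)`-valued map (`IsPhaseProjector.isWeierstrassMap`), and
the isotropy of the triangle makes the induced metric `(2/3) |dg|²`.

The cylinders. The poles of `d ln F` are simple; they are the zeros and the poles of `F`, with the
order of `F` as residue. Replacing `F` by `F⁻¹` changes neither the trajectories nor the metric, so
let `p` be a zero of order `n`. In a suitable coordinate `z` at `p` we have `F = z ^ n`. The inverse
of this coordinate is a lift of the power map through `F`, which is a local homeomorphism at the
regular points, and it is continued to the largest possible punctured disc, of radius `R`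
(`exists_maximal_lift`). The radius is finite: otherwise the image would be all of `Ω` except
zeros and poles of `F`, leaving no room for a zero of `d ln F`. The image of the disc is the ring
domain of `p` (`IsRingChart.ringDomain_eq`):
* the lift is injective, for two points with the same value differ by a root of unity `ω`, the
  lifts `φ(z)` and `φ(ωz)` then agree everywhere, and near `0` this forces `ω = 1`;
* it is foliated by the images of the circles `|z| = const`;
* a connected set of regular points that is covered by closed trajectories and meets the image is
  contained in it. Otherwise the lift would accumulate at a point of a closed trajectory `γ` over
  the boundary circle. As `γ` is compact, and open in its level curve, the points of that circle
  over which the lift accumulates at `γ` form an open and closed set, hence the whole circle, and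
  the lift would extend to a larger disc (`IsRootLift.exists_extension`).

The lift is isometric to the cylinder in logarithmic polar coordinates because `ln F = n ln z`. Two
ring domains that meet absorb each other, and a ring domain has only one zero or pole of `F` in its
closure, so ring domains of different poles are disjoint.

The decomposition. On the sphere the level curve `|F| = R ^ n` that bounds a ring domain carries a
zero of `d ln F`: otherwise the whole level curve would be compact and regular, and the lift
would extend across it. So if all zeros of `d ln F` lie on `|F| = κ`, all ring domains are
bounded by this level curve. The set that the ring domains and their centres omit is compact, and
it is a neighbourhood of each of its points where `|F| ≠ κ`; by the open mapping theorem `|F|` can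
attain its extrema on this set only at the value `κ`, so the set lies in `|F| = κ`
(`IsDecomposable.exists_mem`).
Conversely, if the closed ring domains cover the connected sphere, those bounded by different
levels would separate it, so there is only one level (`IsDecomposable.exists_level`).
-/

noncomputable section

/-! ### Local parameters of the sphere -/

/-- The inversion `ξ ↦ 1 / ξ` of the sphere. -/
def sphereInv (x : OnePoint ℂ) : OnePoint ℂ :=
  x.elim ((0 : ℂ) : OnePoint ℂ) (fun a => if a = 0 then OnePoint.infty else ((a⁻¹ : ℂ) : OnePoint ℂ))

lemma sphereInv_involutive : Function.Involutive sphereInv := by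
  intro x
  induction x using OnePoint.rec with
  | infty => simp [sphereInv]
  | coe a =>
    by_cases h : a = 0 <;> simp [sphereInv, h]

lemma continuous_sphereInv : Continuous sphereInv := by
  rw [OnePoint.continuous_iff]
  constructor
  · rw [coclosedCompact_eq_cocompact, ← Metric.cobounded_eq_cocompact]
    have h : Tendsto (fun a : ℂ => ((a⁻¹ : ℂ) : OnePoint ℂ)) (Bornology.cobounded ℂ)
        (𝓝 ((0 : ℂ) : OnePoint ℂ)) :=
      (OnePoint.continuous_coe.tendsto 0).comp tendsto_inv₀_cobounded
    refine h.congr' ?_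
    filter_upwards [Bornology.eventually_ne_cobounded (0 : ℂ)] with a ha
    simp [sphereInv, ha]
  · rw [continuous_iff_continuousAt]
    intro a
    by_cases ha : a = 0
    · subst ha
      rw [continuousAt_iff_punctured_nhds]
      have h : Tendsto (fun a : ℂ => ((a⁻¹ : ℂ) : OnePoint ℂ)) (𝓝[≠] 0)
          (𝓝 OnePoint.infty) := by
        have := OnePoint.tendsto_coe_infty (X := ℂ)
        rw [coclosedCompact_eq_cocompact, ← Metric.cobounded_eq_cocompact] at this
        exact this.comp tendsto_inv₀_nhdsNE_zero
      have h2 : sphereInv ((0 : ℂ) : OnePoint ℂ) = OnePoint.infty := by simp [sphereInv]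
      rw [h2]
      refine h.congr' ?_
      filter_upwards [self_mem_nhdsWithin] with b hb
      have hb : b ≠ 0 := hb
      simp [sphereInv, hb]
    · have h : ContinuousAt (fun a : ℂ => ((a⁻¹ : ℂ) : OnePoint ℂ)) a :=
        OnePoint.continuous_coe.continuousAt.comp (continuousAt_inv₀ ha)
      refine h.congr ?_
      filter_upwards [eventually_ne_nhds ha] with b hb
      simp [sphereInv, hb]

lemma sphereParam_infty (t : ℂ) : sphereParam OnePoint.infty t = sphereInv (t : OnePoint ℂ) := by
  simp [sphereParam, sphereInv]

lemma sphereParam_coe (a t : ℂ) : sphereParam (a : OnePoint ℂ) t = ((a + t : ℂ) : OnePoint ℂ) := by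
  simp [sphereParam]

@[simp] lemma sphereParam_zero (x : OnePoint ℂ) : sphereParam x 0 = x := by
  induction x using OnePoint.rec with
  | infty => simp [sphereParam]
  | coe a => simp [sphereParam]

lemma isOpenEmbedding_sphereParam (x : OnePoint ℂ) : IsOpenEmbedding (sphereParam x) := by
  induction x using OnePoint.rec with
  | infty =>
    let e : OnePoint ℂ ≃ₜ OnePoint ℂ :=
      { toEquiv := sphereInv_involutive.toPerm
        continuous_toFun := continuous_sphereInv
        continuous_invFun := continuous_sphereInv }
    have : sphereParam OnePoint.infty = e ∘ ((↑) : ℂ → OnePoint ℂ) :=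
      funext fun t => sphereParam_infty t
    rw [this]
    exact e.isOpenEmbedding.comp OnePoint.isOpenEmbedding_coe
  | coe a =>
    have : sphereParam (a : OnePoint ℂ) = ((↑) : ℂ → OnePoint ℂ) ∘ (Homeomorph.addLeft a) :=
      funext fun t => sphereParam_coe a t
    rw [this]
    exact OnePoint.isOpenEmbedding_coe.comp (Homeomorph.isOpenEmbedding _)

lemma continuous_sphereParam (x : OnePoint ℂ) : Continuous (sphereParam x) :=
  (isOpenEmbedding_sphereParam x).continuous

lemma map_sphereParam_nhds (x : OnePoint ℂ) : map (sphereParam x) (𝓝 0) = 𝓝 x := by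
  rw [(isOpenEmbedding_sphereParam x).map_nhds_eq, sphereParam_zero]

lemma map_sphereParam_nhdsNE (x : OnePoint ℂ) : map (sphereParam x) (𝓝[≠] 0) = 𝓝[≠] x := by
  have h := (isOpenEmbedding_sphereParam x).isEmbedding.map_nhdsWithin_eq {0}ᶜ 0
  rw [h, sphereParam_zero]
  apply le_antisymm
  · apply nhdsWithin_mono
    rintro _ ⟨t, ht, rfl⟩ h0
    exact ht ((isOpenEmbedding_sphereParam x).injective
      ((Set.mem_singleton_iff.1 h0).trans (sphereParam_zero x).symm))
  · rw [nhdsWithin, nhdsWithin, le_inf_iff]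
    refine ⟨inf_le_left, ?_⟩
    rw [le_principal_iff]
    have hr : Set.range (sphereParam x) ∈ 𝓝 x :=
      (isOpenEmbedding_sphereParam x).isOpen_range.mem_nhds ⟨0, sphereParam_zero x⟩
    filter_upwards [mem_inf_of_left hr, mem_inf_of_right (mem_principal_self ({x}ᶜ : Set _))]
      with y hy hne
    obtain ⟨t, rfl⟩ := hy
    refine ⟨t, ?_, rfl⟩
    rintro rfl
    exact hne (sphereParam_zero x)

instance nhdsNE_sphere_neBot (x : OnePoint ℂ) : (𝓝[≠] x).NeBot := by
  rw [← map_sphereParam_nhdsNE]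
  infer_instance

/-- Change of local parameter: near `t`, the parameter at `x` is the parameter at the point
`sphereParam x t` composed with a biholomorphic map. -/
lemma exists_sphereParam_transition (x : OnePoint ℂ) (t : ℂ) :
    ∃ k : ℂ → ℂ, AnalyticAt ℂ k t ∧ k t = 0 ∧ deriv k t ≠ 0 ∧
      ∀ᶠ u in 𝓝 t, sphereParam x u = sphereParam (sphereParam x t) (k u) := by
  induction x using OnePoint.rec with
  | infty =>
    by_cases ht : t = 0
    · subst ht
      exact ⟨id, analyticAt_id, rfl, by simp, by simp⟩
    · refine ⟨fun u => u⁻¹ - t⁻¹, (analyticAt_inv ht).sub analyticAt_const, by simp, ?_, ?_⟩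
      · simp [ht]
      · filter_upwards [eventually_ne_nhds ht] with u hu
        have h1 : sphereParam OnePoint.infty t = ((t⁻¹ : ℂ) : OnePoint ℂ) := by
          simp [sphereParam, ht]
        rw [h1, sphereParam_coe]
        simp [sphereParam, hu]
  | coe a =>
    refine ⟨fun u => u - t, by fun_prop, by simp, by simp, ?_⟩
    filter_upwards with u
    simp [sphereParam_coe]

/-! ### Local behaviour of a meromorphic function -/

section LocalBehaviour

/-- The expression of `F` in the local parameter at `x`. -/
def localRep (F : OnePoint ℂ → ℂ) (x : OnePoint ℂ) : ℂ → ℂ := fun t => F (sphereParam x t)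

lemma localRep_apply (F : OnePoint ℂ → ℂ) (x : OnePoint ℂ) (t : ℂ) :
    localRep F x t = F (sphereParam x t) := rfl

@[simp] lemma localRep_zero (F : OnePoint ℂ → ℂ) (x : OnePoint ℂ) : localRep F x 0 = F x := by
  simp [localRep_apply]

lemma dlogCoeff_eq (F : OnePoint ℂ → ℂ) (x : OnePoint ℂ) :
    dlogCoeff F x = logDeriv (localRep F x) := rfl

variable {F : OnePoint ℂ → ℂ} {Ω : Set (OnePoint ℂ)} {x : OnePoint ℂ}

lemma IsMeromorphicFunOn.localRep (hF : IsMeromorphicFunOn F Ω) (hx : x ∈ Ω) :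
    MeromorphicNFAt (localRep F x) 0 := hF x hx

lemma meromorphicOrderAt_localRep_eq_zero_iff (hF : IsMeromorphicFunOn F Ω) (hx : x ∈ Ω) :
    meromorphicOrderAt (localRep F x) 0 = 0 ↔ F x ≠ 0 := by
  rw [(hF.localRep hx).meromorphicOrderAt_eq_zero_iff, localRep_zero]

lemma analyticAt_localRep_zero (hF : IsMeromorphicFunOn F Ω) (hx : x ∈ Ω) (h : F x ≠ 0) :
    AnalyticAt ℂ (localRep F x) 0 :=
  ((hF.localRep hx).meromorphicOrderAt_nonneg_iff_analyticAt).1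
    ((meromorphicOrderAt_localRep_eq_zero_iff hF hx).2 h).ge

lemma analyticAt_localRep (hF : IsMeromorphicFunOn F Ω) {t : ℂ} (hx : sphereParam x t ∈ Ω)
    (h : F (sphereParam x t) ≠ 0) : AnalyticAt ℂ (localRep F x) t := by
  obtain ⟨k, hk, hk0, -, hkx⟩ := exists_sphereParam_transition x t
  have h1 : AnalyticAt ℂ (localRep F (sphereParam x t)) (k t) := by
    rw [hk0]; exact analyticAt_localRep_zero hF hx h
  refine (h1.comp hk).congr ?_
  filter_upwards [hkx] with u hu
  simp [localRep_apply, hu]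

lemma continuousAt_of_ne_zero (hF : IsMeromorphicFunOn F Ω) (hx : x ∈ Ω) (h : F x ≠ 0) :
    ContinuousAt F x := by
  have h1 := (analyticAt_localRep_zero hF hx h).continuousAt
  unfold ContinuousAt at h1 ⊢
  rw [← map_sphereParam_nhds x, tendsto_map'_iff]
  rw [localRep_zero] at h1
  exact h1

/-- The dichotomy at a point where the normalized value is `0`. -/
lemma tendsto_of_eq_zero (hF : IsMeromorphicFunOn F Ω) (hx : x ∈ Ω) (h : F x = 0) :
    Tendsto F (𝓝 x) (𝓝 0) ∨ Tendsto F (𝓝[≠] x) (Bornology.cobounded ℂ) := by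
  rcases lt_or_ge (meromorphicOrderAt (localRep F x) 0) 0 with h1 | h1
  · right
    have := tendsto_cobounded_of_meromorphicOrderAt_neg h1
    rwa [← map_sphereParam_nhdsNE x, tendsto_map'_iff]
  · left
    have := ((hF.localRep hx).meromorphicOrderAt_nonneg_iff_analyticAt.1 h1).continuousAt
    unfold ContinuousAt at this
    rw [← map_sphereParam_nhds x, tendsto_map'_iff]
    rw [localRep_zero, h] at this
    exact this

lemma meromorphicOrderAt_dlogCoeff_nonneg (hF : IsMeromorphicFunOn F Ω) (hx : x ∈ Ω)
    (h : F x ≠ 0) : 0 ≤ meromorphicOrderAt (dlogCoeff F x) 0 :=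
  meromorphicOrderAt_logDeriv_nonneg (hF.localRep hx).meromorphicAt
    ((meromorphicOrderAt_localRep_eq_zero_iff hF hx).2 h)

lemma mem_regularPart_iff (hF : IsMeromorphicFunOn F Ω) :
    x ∈ regularPart F Ω ↔ x ∈ Ω ∧ F x ≠ 0 ∧ deriv (localRep F x) 0 ≠ 0 := by
  constructor
  · rintro ⟨hx, h0⟩
    have hm := (hF.localRep hx).meromorphicAt
    have hne : F x ≠ 0 := by
      rw [← meromorphicOrderAt_localRep_eq_zero_iff hF hx]
      by_contra h1
      by_cases h2 : meromorphicOrderAt (localRep F x) 0 = ⊤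
      · have h3 : logDeriv (localRep F x) =ᶠ[𝓝[≠] 0] logDeriv (fun _ => (0 : ℂ)) :=
          logDeriv_congr_nhdsNE (meromorphicOrderAt_eq_top_iff.1 h2)
        have h4 : meromorphicOrderAt (dlogCoeff F x) 0 = ⊤ := by
          rw [meromorphicOrderAt_eq_top_iff]
          filter_upwards [h3] with z hz
          rw [dlogCoeff_eq, hz]
          simp [logDeriv_apply]
        rw [h4] at h0
        exact absurd h0 (by simp)
      · have := meromorphicOrderAt_logDeriv_eq_neg_one hm h1 h2
        rw [dlogCoeff_eq, this] at h0
        exact absurd h0 (by decide)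
    refine ⟨hx, hne, ?_⟩
    have ha := analyticAt_localRep_zero hF hx hne
    have hl : AnalyticAt ℂ (logDeriv (localRep F x)) 0 :=
      ha.deriv.div ha (by simpa using hne)
    have h5 := (hl.meromorphicNFAt.meromorphicOrderAt_eq_zero_iff).1 h0
    rw [logDeriv_apply] at h5
    intro h6
    simp [h6] at h5
  · rintro ⟨hx, hne, hd⟩
    refine ⟨hx, ?_⟩
    have ha := analyticAt_localRep_zero hF hx hne
    have hl : AnalyticAt ℂ (logDeriv (localRep F x)) 0 :=
      ha.deriv.div ha (by simpa using hne)
    rw [dlogCoeff_eq, (hl.meromorphicNFAt.meromorphicOrderAt_eq_zero_iff), logDeriv_apply]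
    exact div_ne_zero hd (by simpa using hne)

/-- A point at which `F`, in some local parameter, has a non-zero value and a non-zero derivative
is regular. -/
lemma sphereParam_mem_regularPart (hF : IsMeromorphicFunOn F Ω) {t : ℂ}
    (hx : sphereParam x t ∈ Ω) (h : F (sphereParam x t) ≠ 0)
    (hd : deriv (localRep F x) t ≠ 0) : sphereParam x t ∈ regularPart F Ω := by
  rw [mem_regularPart_iff hF]
  refine ⟨hx, h, fun h0 => hd ?_⟩
  obtain ⟨k, hk, hk0, -, hkx⟩ := exists_sphereParam_transition x t
  have h1 : localRep F x =ᶠ[𝓝 t] localRep F (sphereParam x t) ∘ k := by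
    filter_upwards [hkx] with u hu
    simp [localRep_apply, hu]
  rw [h1.deriv_eq, deriv_comp, hk0, h0, zero_mul]
  · rw [hk0]; exact (analyticAt_localRep_zero hF hx h).differentiableAt
  · exact hk.differentiableAt

lemma isOpen_regularPart (hΩ : IsOpen Ω) (hF : IsMeromorphicFunOn F Ω) :
    IsOpen (regularPart F Ω) := by
  rw [isOpen_iff_mem_nhds]
  intro x hx
  obtain ⟨hxΩ, hne, hd⟩ := (mem_regularPart_iff hF).1 hx
  rw [← map_sphereParam_nhds x, mem_map]
  have ha := analyticAt_localRep_zero hF hxΩ hne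
  have h1 : ∀ᶠ t in 𝓝 (0 : ℂ), sphereParam x t ∈ Ω :=
    (continuous_sphereParam x).continuousAt.eventually_mem
      (hΩ.mem_nhds (by simpa using hxΩ))
  have h2 : ∀ᶠ t in 𝓝 (0 : ℂ), localRep F x t ≠ 0 :=
    ha.continuousAt.eventually_ne (by simpa using hne)
  have h3 : ∀ᶠ t in 𝓝 (0 : ℂ), deriv (localRep F x) t ≠ 0 :=
    ha.deriv.continuousAt.eventually_ne hd
  filter_upwards [h1, h2, h3] with t h1 h2 h3
  exact sphereParam_mem_regularPart hF h1 h2 h3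

/-- Where the order of `d ln F` is finite, all nearby points are regular. -/
lemma eventually_mem_regularPart (hΩ : IsOpen Ω) (hF : IsMeromorphicFunOn F Ω) (hx : x ∈ Ω)
    (h : meromorphicOrderAt (dlogCoeff F x) 0 ≠ ⊤) : ∀ᶠ y in 𝓝[≠] x, y ∈ regularPart F Ω := by
  rw [← map_sphereParam_nhdsNE x, eventually_map]
  have h1 : ∀ᶠ t in 𝓝[≠] (0 : ℂ), sphereParam x t ∈ Ω :=
    ((continuous_sphereParam x).continuousAt.eventually_mem
      (hΩ.mem_nhds (by simpa using hx))).filter_mono nhdsWithin_le_nhds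
  have h2 := (meromorphicOrderAt_ne_top_iff_eventually_ne_zero
    (hF.localRep hx).meromorphicAt.logDeriv).1 h
  filter_upwards [h1, h2] with t h1 h2
  rw [logDeriv_apply, div_ne_zero_iff] at h2
  exact sphereParam_mem_regularPart hF h1 h2.2 h2.1

/-- `F` is a local homeomorphism at the regular points. -/
lemma isLocalHomeomorphOn_regularPart (hF : IsMeromorphicFunOn F Ω) :
    IsLocalHomeomorphOn F (regularPart F Ω) := by
  apply IsLocalHomeomorphOn.mk
  intro x hx
  obtain ⟨hxΩ, hne, hd⟩ := (mem_regularPart_iff hF).1 hx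
  have ha := analyticAt_localRep_zero hF hxΩ hne
  have hs : HasStrictDerivAt (localRep F x) (deriv (localRep F x) 0) 0 := ha.hasStrictDerivAt
  let e₁ := (isOpenEmbedding_sphereParam x).toOpenPartialHomeomorph
  let e₂ := (hs.hasStrictFDerivAt_equiv hd).toOpenPartialHomeomorph (localRep F x)
  have h2 : (0 : ℂ) ∈ e₂.source := HasStrictFDerivAt.mem_toOpenPartialHomeomorph_source _
  have h1 : e₁.symm x = 0 := by
    have : x = e₁ 0 := (sphereParam_zero x).symm
    rw [this]
    exact e₁.left_inv (by simp [e₁])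
  refine ⟨e₁.symm.trans e₂, ?_, ?_⟩
  · rw [OpenPartialHomeomorph.trans_source]
    refine ⟨?_, ?_⟩
    · simp only [OpenPartialHomeomorph.symm_source]
      exact ⟨0, by simp, sphereParam_zero x⟩
    · rw [Set.mem_preimage, h1]
      exact h2
  · intro y hy
    rw [OpenPartialHomeomorph.trans_source] at hy
    have h3 : sphereParam x (e₁.symm y) = y := e₁.right_inv hy.1
    rw [OpenPartialHomeomorph.coe_trans, Function.comp_apply]
    have h4 : e₂ (e₁.symm y) = F (sphereParam x (e₁.symm y)) := rfl
    rw [h4, h3]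

/-! ### Consequences of non-constancy -/

lemma eventually_eq_of_dlogCoeff_order_eq_top (hF : IsMeromorphicFunOn F Ω) (hx : x ∈ Ω)
    (h : meromorphicOrderAt (dlogCoeff F x) 0 = ⊤) : ∀ᶠ y in 𝓝 x, F y = F x := by
  have hG := hF.localRep hx
  have hpunct : ∀ᶠ t in 𝓝[≠] (0 : ℂ), localRep F x t = F x := by
    by_cases h0 : meromorphicOrderAt (localRep F x) 0 = 0
    · have hne := (meromorphicOrderAt_localRep_eq_zero_iff hF hx).1 h0
      have ha := analyticAt_localRep_zero hF hx hne
      have hne' : ∀ᶠ t in 𝓝[≠] (0 : ℂ), localRep F x t ≠ 0 :=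
        (ha.continuousAt.eventually_ne (by simpa using hne)).filter_mono nhdsWithin_le_nhds
      set H : ℂ → ℂ := fun t => localRep F x t - F x with hH
      have hHa : AnalyticAt ℂ H 0 := ha.sub analyticAt_const
      have hdH : meromorphicOrderAt (deriv H) 0 = ⊤ := by
        rw [meromorphicOrderAt_eq_top_iff]
        filter_upwards [meromorphicOrderAt_eq_top_iff.1 h, hne'] with t h1 h2
        rw [hH, deriv_sub_const]
        rw [dlogCoeff_eq, logDeriv_apply, div_eq_zero_iff] at h1
        exact h1.resolve_right h2
      have hHtop : meromorphicOrderAt H 0 = ⊤ := by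
        by_contra hne
        lift meromorphicOrderAt H 0 to ℤ using hne with n hn
        have hn0 : n ≠ 0 := by
          rintro rfl
          have h3 := hHa.meromorphicNFAt.meromorphicOrderAt_eq_zero_iff.1 hn.symm
          simp [hH] at h3
        rw [meromorphicOrderAt_deriv_eq_sub_one (by exact_mod_cast hn0) hn.symm] at hdH
        simp at hdH
      filter_upwards [meromorphicOrderAt_eq_top_iff.1 hHtop] with t ht
      exact sub_eq_zero.1 ht
    · have htop : meromorphicOrderAt (localRep F x) 0 = ⊤ := by
        by_contra h1
        have := meromorphicOrderAt_logDeriv_eq_neg_one hG.meromorphicAt h0 h1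
        rw [dlogCoeff_eq, this] at h
        exact absurd h (by decide)
      have hx0 : F x = 0 := by
        by_contra hne
        exact h0 ((meromorphicOrderAt_localRep_eq_zero_iff hF hx).2 hne)
      rw [hx0]
      exact meromorphicOrderAt_eq_top_iff.1 htop
  have h2 : ∀ᶠ y in 𝓝[≠] x, F y = F x := by
    rw [← map_sphereParam_nhdsNE x]
    exact hpunct
  rw [eventually_nhdsWithin_iff] at h2
  filter_upwards [h2] with y hy
  by_cases hyx : y = x
  · rw [hyx]
  · exact hy hyx

lemma dlogCoeff_order_eq_top_of_eventually_eq (h : ∀ᶠ y in 𝓝 x, F y = F x) :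
    meromorphicOrderAt (dlogCoeff F x) 0 = ⊤ := by
  rw [meromorphicOrderAt_eq_top_iff]
  rw [← map_sphereParam_nhds x, eventually_map] at h
  have h1 : localRep F x =ᶠ[𝓝[≠] 0] fun _ => F x := h.filter_mono nhdsWithin_le_nhds
  filter_upwards [logDeriv_congr_nhdsNE h1] with t ht
  rw [dlogCoeff_eq, ht]
  simp [logDeriv_apply]

/-- The identity theorem: on a connected domain the differential `d ln F` of a non-constant `F`
does not vanish identically near any point. -/
lemma dlogCoeff_order_ne_top (hΩ : IsOpen Ω) (hc : IsPreconnected Ω) (hF : IsMeromorphicFunOn F Ω)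
    (hnc : ∃ x ∈ Ω, ∃ y ∈ Ω, F x ≠ F y) :
    ∀ x ∈ Ω, meromorphicOrderAt (dlogCoeff F x) 0 ≠ ⊤ := by
  intro x₀ hx₀ htop
  -- the set where `F` is locally constant is open, and closed in `Ω`
  set T : Set (OnePoint ℂ) := {x | x ∈ Ω ∧ ∀ᶠ y in 𝓝 x, F y = F x} with hT
  have hTo : IsOpen T := by
    rw [isOpen_iff_mem_nhds]
    rintro x ⟨hx, hxe⟩
    filter_upwards [hΩ.mem_nhds hx, hxe.eventually_nhds] with y hy hye
    refine ⟨hy, ?_⟩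
    have := hye.self_of_nhds
    filter_upwards [hye] with z hz
    rw [hz, this]
  have hsub : Ω ⊆ T := by
    refine hc.subset_of_closure_inter_subset hTo
      ⟨x₀, hx₀, hx₀, eventually_eq_of_dlogCoeff_order_eq_top hF hx₀ htop⟩ ?_
    rintro x ⟨hxc, hx⟩
    refine ⟨hx, eventually_eq_of_dlogCoeff_order_eq_top hF hx ?_⟩
    by_contra hne
    have h1 := eventually_mem_regularPart hΩ hF hx hne
    rw [eventually_nhdsWithin_iff, eventually_nhds_iff] at h1
    obtain ⟨N, hN, hNo, hxN⟩ := h1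
    obtain ⟨y, hyN, hyT⟩ := mem_closure_iff.1 hxc N hNo hxN
    have hyt := dlogCoeff_order_eq_top_of_eventually_eq hyT.2
    by_cases hyx : y = x
    · rw [hyx] at hyt; exact hne hyt
    · have := (hN y hyN hyx).2
      rw [hyt] at this
      exact absurd this (by simp)
  obtain ⟨x, hx, y, hy, hxy⟩ := hnc
  have hsub2 : Ω ⊆ {z | z ∈ Ω ∧ F z = F x} := by
    refine hc.subset_of_closure_inter_subset ?_ ⟨x, hx, hx, rfl⟩ ?_
    · rw [isOpen_iff_mem_nhds]
      rintro z ⟨hz, hzx⟩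
      filter_upwards [hΩ.mem_nhds hz, (hsub hz).2] with w hw hw2
      exact ⟨hw, hw2.trans hzx⟩
    · rintro z ⟨hzc, hz⟩
      refine ⟨hz, ?_⟩
      obtain ⟨w, hw, hwz⟩ := (mem_closure_iff_frequently.1 hzc).and_eventually (hsub hz).2 |>.exists
      rw [← hwz, hw.2]
  exact hxy (hsub2 hy).2.symm

lemma localRep_order_ne_top (hfin : meromorphicOrderAt (dlogCoeff F x) 0 ≠ ⊤) :
    meromorphicOrderAt (localRep F x) 0 ≠ ⊤ := by
  intro h
  apply hfin
  rw [meromorphicOrderAt_eq_top_iff]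
  filter_upwards [logDeriv_congr_nhdsNE (g := fun _ => (0 : ℂ)) (meromorphicOrderAt_eq_top_iff.1 h)]
    with t ht
  rw [dlogCoeff_eq, ht]
  simp [logDeriv_apply]

lemma dlogCoeff_order_eq_neg_one_iff (hF : IsMeromorphicFunOn F Ω) (hx : x ∈ Ω)
    (hfin : meromorphicOrderAt (dlogCoeff F x) 0 ≠ ⊤) :
    meromorphicOrderAt (dlogCoeff F x) 0 = -1 ↔ F x = 0 := by
  constructor
  · intro h
    by_contra hne
    have := meromorphicOrderAt_dlogCoeff_nonneg hF hx hne
    rw [h] at this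
    exact absurd this (by decide)
  · intro h
    refine meromorphicOrderAt_logDeriv_eq_neg_one (hF.localRep hx).meromorphicAt ?_
      (localRep_order_ne_top hfin)
    exact fun h' => (meromorphicOrderAt_localRep_eq_zero_iff hF hx).1 h' h

/-- The zeros of `d ln F` are the points that are neither regular nor zeros or poles of `F`. -/
lemma isDlogZero_iff (hF : IsMeromorphicFunOn F Ω) (hx : x ∈ Ω)
    (hfin : meromorphicOrderAt (dlogCoeff F x) 0 ≠ ⊤) :
    IsDlogZero F x ↔ F x ≠ 0 ∧ x ∉ regularPart F Ω := by
  unfold IsDlogZero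
  constructor
  · intro h
    constructor
    · intro h0
      rw [(dlogCoeff_order_eq_neg_one_iff hF hx hfin).2 h0] at h
      exact absurd h (by decide)
    · intro h0
      rw [h0.2] at h
      exact lt_irrefl _ h
  · rintro ⟨h1, h2⟩
    exact lt_of_le_of_ne (meromorphicOrderAt_dlogCoeff_nonneg hF hx h1)
      (fun h => h2 ⟨hx, h.symm⟩)

/-- The residue of `d ln F` is the order of `F`. -/
lemma tendsto_mul_dlogCoeff {n : ℤ} {g : ℂ → ℂ} (hg : AnalyticAt ℂ g 0) (hg0 : g 0 ≠ 0)
    (h' : ∀ᶠ t in 𝓝 0, localRep F x t = t ^ n * g t) :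
    Tendsto (fun t => t * dlogCoeff F x t) (𝓝[≠] 0) (𝓝 n) := by
  have hl : ∀ᶠ t in 𝓝[≠] (0 : ℂ), t * dlogCoeff F x t = n + t * (deriv g t / g t) := by
    have h1 : localRep F x =ᶠ[𝓝[≠] 0] fun t => t ^ n * g t :=
      h'.filter_mono nhdsWithin_le_nhds
    filter_upwards [logDeriv_congr_nhdsNE h1, self_mem_nhdsWithin,
      hg.eventually_analyticAt.filter_mono nhdsWithin_le_nhds,
      (hg.continuousAt.eventually_ne hg0).filter_mono nhdsWithin_le_nhds] with t ht htne hga hgn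
    have htne : t ≠ 0 := htne
    rw [dlogCoeff_eq, ht, logDeriv_apply, deriv_fun_mul (by fun_prop (disch := grind))
      hga.differentiableAt, deriv_zpow, zpow_sub_one₀ htne]
    have := zpow_ne_zero n htne
    field_simp
  have hlim : Tendsto (fun t : ℂ => (n : ℂ) + t * (deriv g t / g t)) (𝓝[≠] 0)
      (𝓝 ((n : ℂ) + 0 * (deriv g 0 / g 0))) := by
    apply Tendsto.mono_left _ nhdsWithin_le_nhds
    exact tendsto_const_nhds.add (tendsto_id.mul
      (hg.deriv.continuousAt.div hg.continuousAt hg0))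
  rw [zero_mul, add_zero] at hlim
  exact hlim.congr' (hl.mono fun t ht => ht.symm)

/-- At a zero or pole of `F` the differential `d ln F` has a simple pole, whose residue is the
order of `F`. -/
lemma exists_order_of_eq_zero (hF : IsMeromorphicFunOn F Ω) (hx : x ∈ Ω)
    (hfin : meromorphicOrderAt (dlogCoeff F x) 0 ≠ ⊤) (h0 : F x = 0) :
    ∃ n : ℤ, n ≠ 0 ∧ HasSimplePole F x n ∧ ∃ g : ℂ → ℂ, AnalyticAt ℂ g 0 ∧ g 0 ≠ 0 ∧
      ∀ᶠ t in 𝓝 0, localRep F x t = t ^ n * g t := by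
  rcases hF.localRep hx with h | ⟨n, g, hg, hg0, h⟩
  · exact absurd (meromorphicOrderAt_eq_top_iff.2 (h.filter_mono nhdsWithin_le_nhds))
      (localRep_order_ne_top hfin)
  have h' : ∀ᶠ t in 𝓝 0, localRep F x t = t ^ n * g t := by
    filter_upwards [h] with t ht
    simpa using ht
  have hn : n ≠ 0 := by
    rintro rfl
    have := h'.self_of_nhds
    simp [h0, hg0.symm] at this
  refine ⟨n, hn, ⟨(dlogCoeff_order_eq_neg_one_iff hF hx hfin).2 h0,
    tendsto_mul_dlogCoeff hg hg0 h'⟩, g, hg, hg0, h'⟩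

lemma HasSimplePole.unique {r r' : ℂ} (h : HasSimplePole F x r) (h' : HasSimplePole F x r') :
    r = r' := tendsto_nhds_unique h.2 h'.2

lemma exists_hasSimplePole_iff (hF : IsMeromorphicFunOn F Ω) (hx : x ∈ Ω)
    (hfin : meromorphicOrderAt (dlogCoeff F x) 0 ≠ ⊤) :
    (∃ r, HasSimplePole F x r) ↔ F x = 0 := by
  constructor
  · rintro ⟨r, h⟩
    exact (dlogCoeff_order_eq_neg_one_iff hF hx hfin).1 h.1
  · intro h
    obtain ⟨n, -, hn, -⟩ := exists_order_of_eq_zero hF hx hfin h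
    exact ⟨n, hn⟩

/-- The open mapping theorem at a point that is not a zero or pole of `F`. -/
lemma nhds_le_map_nhds (hF : IsMeromorphicFunOn F Ω) (hx : x ∈ Ω)
    (hfin : meromorphicOrderAt (dlogCoeff F x) 0 ≠ ⊤) (h : F x ≠ 0) :
    𝓝 (F x) ≤ map F (𝓝 x) := by
  have ha := analyticAt_localRep_zero hF hx h
  rcases ha.eventually_constant_or_nhds_le_map_nhds with h1 | h1
  · exfalso
    apply hfin
    apply dlogCoeff_order_eq_top_of_eventually_eq
    rw [← map_sphereParam_nhds x, eventually_map]
    filter_upwards [h1] with t ht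
    exact ht.trans (localRep_zero F x)
  · rw [localRep_zero] at h1
    rw [← map_sphereParam_nhds x, map_map]
    exact h1

end LocalBehaviour

/-! ### Lifting the power map through a local homeomorphism -/

section Lifting

open Metric

variable {X : Type*} [TopologicalSpace X]

/-- `φ` is a continuous lift, over the set `U` of complex numbers, of the power map `z ↦ z ^ n`
through `F`, with values in `M`. -/
structure IsRootLift (F : X → ℂ) (M : Set X) (n : ℕ) (φ : ℂ → X) (U : Set ℂ) : Prop where
  continuousOn : ContinuousOn φ U
  mapsTo : Set.MapsTo φ U M
  comp_eq : ∀ z ∈ U, F (φ z) = z ^ n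

variable {F : X → ℂ} {M : Set X} {n : ℕ} {φ ψ : ℂ → X} {U V : Set ℂ}

lemma IsRootLift.mono (h : IsRootLift F M n φ U) (hV : V ⊆ U) : IsRootLift F M n φ V :=
  ⟨h.continuousOn.mono hV, h.mapsTo.mono_left hV, fun z hz => h.comp_eq z (hV hz)⟩

lemma IsRootLift.congr (h : IsRootLift F M n φ U) (he : Set.EqOn ψ φ U) :
    IsRootLift F M n ψ U :=
  ⟨h.continuousOn.congr he, fun z hz => by rw [he hz]; exact h.mapsTo hz,
    fun z hz => by rw [he hz]; exact h.comp_eq z hz⟩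

lemma IsRootLift.iUnion {ι : Sort*} {U : ι → Set ℂ} (hU : ∀ i, IsOpen (U i))
    (h : ∀ i, IsRootLift F M n φ (U i)) : IsRootLift F M n φ (⋃ i, U i) where
  continuousOn := by
    intro z hz
    obtain ⟨i, hi⟩ := Set.mem_iUnion.1 hz
    exact (((h i).continuousOn).continuousAt ((hU i).mem_nhds hi)).continuousWithinAt
  mapsTo := by
    intro z hz
    obtain ⟨i, hi⟩ := Set.mem_iUnion.1 hz
    exact (h i).mapsTo hi
  comp_eq := by
    intro z hz
    obtain ⟨i, hi⟩ := Set.mem_iUnion.1 hz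
    exact (h i).comp_eq z hi

/-- Two lifts of one map through a local homeomorphism that agree at a point of a preconnected
set agree on the whole set. -/
lemma eqOn_of_isLocalHomeomorphOn [T2Space X] (hF : IsLocalHomeomorphOn F M)
    {A : Type*} [TopologicalSpace A] {s : Set A} {g₁ g₂ : A → X} (hs : IsPreconnected s)
    (h₁ : ContinuousOn g₁ s) (h₂ : ContinuousOn g₂ s)
    (m₁ : Set.MapsTo g₁ s M) (m₂ : Set.MapsTo g₂ s M)
    (he : ∀ a ∈ s, F (g₁ a) = F (g₂ a)) {a : A} (has : a ∈ s) (ha : g₁ a = g₂ a) :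
    Set.EqOn g₁ g₂ s := by
  have hinj : IsLocallyInjective (M.domRestrict F) := by
    rw [isLocallyInjective_iff_nhds]
    rintro ⟨x, hx⟩
    obtain ⟨e, hxe, hFe⟩ := hF x hx
    refine ⟨Subtype.val ⁻¹' e.source,
      continuous_subtype_val.continuousAt.preimage_mem_nhds (e.open_source.mem_nhds hxe), ?_⟩
    rintro ⟨y, hy⟩ hye ⟨z, hz⟩ hze hyz
    simp only [Set.domRestrict_apply, hFe] at hyz
    exact Subtype.ext (e.injOn hye hze hyz)
  have : PreconnectedSpace s := isPreconnected_iff_preconnectedSpace.1 hs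
  have h := (T2Space.isSeparatedMap (M.domRestrict F)).eq_of_comp_eq hinj
    (g₁ := fun a : s => (⟨g₁ a, m₁ a.2⟩ : M)) (g₂ := fun a : s => (⟨g₂ a, m₂ a.2⟩ : M))
    ((continuousOn_iff_continuous_domRestrict.1 h₁).subtype_mk _)
    ((continuousOn_iff_continuous_domRestrict.1 h₂).subtype_mk _)
    (funext fun a => he a a.2) ⟨a, has⟩ (Subtype.ext ha)
  intro b hb
  exact congrArg Subtype.val (congrFun h ⟨b, hb⟩)

lemma IsRootLift.eqOn [T2Space X] (hF : IsLocalHomeomorphOn F M) (h₁ : IsRootLift F M n φ U)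
    (h₂ : IsRootLift F M n ψ U) (hU : IsPreconnected U) {z : ℂ} (hz : z ∈ U)
    (he : φ z = ψ z) : Set.EqOn φ ψ U :=
  eqOn_of_isLocalHomeomorphOn hF hU h₁.continuousOn h₂.continuousOn h₁.mapsTo h₂.mapsTo
    (fun a ha => by rw [h₁.comp_eq a ha, h₂.comp_eq a ha]) hz he

lemma exists_eqOn_of_agree {ι A X : Type*} [Nonempty X] (U : ι → Set A) (g : ι → A → X)
    (h : ∀ i j, ∀ a ∈ U i ∩ U j, g i a = g j a) :
    ∃ G : A → X, ∀ i, Set.EqOn G (g i) (U i) := by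
  classical
  refine ⟨fun a => if ha : ∃ i, a ∈ U i then g ha.choose a else Classical.arbitrary X, ?_⟩
  intro i a ha
  have hex : ∃ i, a ∈ U i := ⟨i, ha⟩
  simp only [dif_pos hex]
  exact h _ _ _ ⟨hex.choose_spec, ha⟩

/-- The punctured disc of radius `r` around `0`. -/
def puncturedDisc (r : ℝ) : Set ℂ := {z | z ≠ 0 ∧ ‖z‖ < r}

lemma mem_puncturedDisc {r : ℝ} {z : ℂ} : z ∈ puncturedDisc r ↔ z ≠ 0 ∧ ‖z‖ < r := Iff.rfl

lemma isOpen_puncturedDisc (r : ℝ) : IsOpen (puncturedDisc r) :=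
  isOpen_ne.inter (isOpen_lt continuous_norm continuous_const)

lemma puncturedDisc_mono {r s : ℝ} (h : r ≤ s) : puncturedDisc r ⊆ puncturedDisc s :=
  fun _ hz => ⟨hz.1, hz.2.trans_le h⟩

lemma puncturedDisc_eq_image_exp {r : ℝ} (hr : 0 < r) :
    puncturedDisc r = Complex.exp '' {w | w.re < Real.log r} := by
  ext z
  constructor
  · rintro ⟨h0, hz⟩
    refine ⟨Complex.log z, ?_, Complex.exp_log h0⟩
    simp only [Set.mem_ofPred_eq, Complex.log_re]
    exact Real.log_lt_log (norm_pos_iff.2 h0) hz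
  · rintro ⟨w, hw, rfl⟩
    refine ⟨Complex.exp_ne_zero w, ?_⟩
    rw [Complex.norm_exp, ← Real.exp_log hr]
    exact Real.exp_lt_exp.2 hw

lemma isPreconnected_puncturedDisc (r : ℝ) : IsPreconnected (puncturedDisc r) := by
  rcases le_or_gt r 0 with hr | hr
  · have : puncturedDisc r = ∅ := by
      ext z
      simp only [mem_puncturedDisc, Set.mem_empty_iff_false, iff_false, not_and, not_lt]
      exact fun _ => hr.trans (norm_nonneg z)
    rw [this]
    exact isPreconnected_empty
  · rw [puncturedDisc_eq_image_exp hr]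
    exact ((convex_halfSpace_re_lt _).isPreconnected).image _ Complex.continuous_exp.continuousOn

lemma puncturedDisc_mem_nhdsNE {r : ℝ} (hr : 0 < r) : puncturedDisc r ∈ 𝓝[≠] (0 : ℂ) := by
  filter_upwards [self_mem_nhdsWithin, mem_nhdsWithin_of_mem_nhds (ball_mem_nhds (0 : ℂ) hr)]
    with z hz hz2
  exact ⟨hz, by simpa using hz2⟩

/-- The graph of `φ` over the punctured disc of radius `r`. -/
def liftGraph (φ : ℂ → X) (r : ℝ) : Set (ℂ × X) := (fun z => (z, φ z)) '' puncturedDisc r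

lemma norm_le_of_mem_closure_liftGraph {r : ℝ} {a : ℂ × X} (h : a ∈ closure (liftGraph φ r)) :
    ‖a.1‖ ≤ r := by
  have hcl : IsClosed {a : ℂ × X | ‖a.1‖ ≤ r} :=
    isClosed_le (continuous_norm.comp continuous_fst) continuous_const
  exact hcl.closure_subset_iff.2 (by rintro _ ⟨z, hz, rfl⟩; exact hz.2.le) h

lemma comp_eq_of_mem_closure_liftGraph {r : ℝ} (h : IsRootLift F M n φ (puncturedDisc r))
    {ζ : ℂ} {q : X} (hq : ContinuousAt F q) (hc : (ζ, q) ∈ closure (liftGraph φ r)) :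
    F q = ζ ^ n := by
  by_contra hne
  have h1 : ContinuousAt (fun a : ℂ × X => F a.2 - a.1 ^ n) (ζ, q) :=
    (ContinuousAt.comp (g := F) (f := Prod.snd) hq continuousAt_snd).sub (continuousAt_fst.pow n)
  have h2 := h1.eventually_ne (sub_ne_zero.2 hne)
  obtain ⟨_, ⟨z, hz, rfl⟩, hz2⟩ :=
    ((mem_closure_iff_frequently.1 hc).and_eventually h2).exists
  exact hz2 (sub_eq_zero.2 (h.comp_eq z hz))

lemma ball_inter_puncturedDisc {ζ : ℂ} {r η : ℝ} (hη : η ≤ ‖ζ‖) :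
    ball ζ η ∩ puncturedDisc r = ball ζ η ∩ ball 0 r := by
  ext z
  simp only [Set.mem_inter_iff, mem_puncturedDisc, mem_ball_zero_iff]
  refine ⟨fun h => ⟨h.1, h.2.2⟩, fun h => ⟨h.1, ?_, h.2⟩⟩
  rintro rfl
  have := h.1
  rw [mem_ball, dist_zero_left] at this
  linarith

/-- A lift over a punctured disc extends across a boundary point at which it accumulates at a
point of `M`. -/
lemma IsRootLift.exists_local_extension [T2Space X] (hF : IsLocalHomeomorphOn F M)
    (hM : IsOpen M) {r : ℝ} (hr : 0 < r)
    (h : IsRootLift F M n φ (puncturedDisc r)) {ζ : ℂ} {q : X} (hζ : ‖ζ‖ = r) (hq : q ∈ M)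
    (hc : (ζ, q) ∈ closure (liftGraph φ r)) :
    ∃ η > 0, η ≤ r ∧ ∃ ψ, IsRootLift F M n ψ (ball ζ η) ∧
      Set.EqOn ψ φ (ball ζ η ∩ puncturedDisc r) ∧ ψ ζ = q := by
  have hFq := comp_eq_of_mem_closure_liftGraph h (hF.continuousAt hq) hc
  obtain ⟨e, hqe, hFe⟩ := hF q hq
  have heq : e q = ζ ^ n := by rw [← hFe, hFq]
  have htgt : ζ ^ n ∈ e.target := heq ▸ e.map_source hqe
  have hsymm : e.symm (ζ ^ n) = q := by rw [← heq, e.left_inv hqe]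
  have hev : ∀ᶠ z in 𝓝 ζ, z ^ n ∈ e.target ∧ e.symm (z ^ n) ∈ M := by
    have h1 : ContinuousAt (fun z : ℂ => z ^ n) ζ := (continuous_pow n).continuousAt
    have h2 : ContinuousAt (fun z : ℂ => e.symm (z ^ n)) ζ :=
      ContinuousAt.comp (g := e.symm) (e.continuousAt_symm htgt) h1
    refine (h1.eventually_mem (e.open_target.mem_nhds htgt)).and
      (h2.eventually_mem (hM.mem_nhds ?_))
    rw [hsymm]; exact hq
  obtain ⟨η₀, hη₀, hball⟩ := Metric.eventually_nhds_iff_ball.1 hev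
  set η := min η₀ r with hη
  have hηpos : 0 < η := lt_min hη₀ hr
  have hsub : ball ζ η ⊆ ball ζ η₀ := ball_subset_ball (min_le_left _ _)
  have hψ : IsRootLift F M n (fun z => e.symm (z ^ n)) (ball ζ η) := by
    refine ⟨?_, fun z hz => (hball z (hsub hz)).2, fun z hz => ?_⟩
    · exact e.continuousOn_symm.comp (continuous_pow n).continuousOn
        (fun z hz => (hball z (hsub hz)).1)
    · rw [hFe, e.right_inv (hball z (hsub hz)).1]
  refine ⟨η, hηpos, min_le_right _ _, fun z => e.symm (z ^ n), hψ, ?_, hsymm⟩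
  -- the two lifts agree at points of the graph close to `(ζ, q)`
  have hnhds : ball ζ η ×ˢ e.source ∈ 𝓝 (ζ, q) :=
    prod_mem_nhds (ball_mem_nhds _ hηpos) (e.open_source.mem_nhds hqe)
  obtain ⟨_, ⟨z, hz, rfl⟩, hz1, hz2⟩ :=
    ((mem_closure_iff_frequently.1 hc).and_eventually hnhds).exists
  have hpre : IsPreconnected (ball ζ η ∩ puncturedDisc r) := by
    rw [ball_inter_puncturedDisc (by rw [hζ]; exact min_le_right _ _)]
    exact ((convex_ball _ _).inter (convex_ball _ _)).isPreconnected
  refine (hψ.mono Set.inter_subset_left).eqOn hF (h.mono Set.inter_subset_right) hpre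
    ⟨hz1, hz⟩ ?_
  have : z ^ n = e (φ z) := by rw [← hFe, h.comp_eq z hz]
  simp only [this]
  exact e.left_inv hz2

/-- Two discs centred on a circle that meet each other meet inside the circle. -/
lemma exists_mem_ball_inter_ball {r η η' : ℝ} {ζ ζ' : ℂ} (hr : 0 < r) (hζ : ‖ζ‖ = r)
    (hζ' : ‖ζ'‖ = r) (hη : 0 < η) (hη' : 0 < η') (h : (ball ζ η ∩ ball ζ' η').Nonempty) :
    (ball ζ η ∩ ball ζ' η' ∩ ball 0 r).Nonempty := by
  have hd : dist ζ ζ' < η + η' := by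
    obtain ⟨z, hz, hz'⟩ := h
    rw [mem_ball] at hz hz'
    calc dist ζ ζ' ≤ dist z ζ + dist z ζ' := dist_triangle_left _ _ _
      _ < η + η' := add_lt_add hz hz'
  set s : ℝ := η / (η + η') with hs
  have hpos : 0 < η + η' := by positivity
  have hs0 : 0 < s := by positivity
  have hs1 : s < 1 := by rw [hs, div_lt_one hpos]; linarith
  set w : ℂ := AffineMap.lineMap ζ ζ' s with hw
  have hw1 : dist w ζ < η := by
    rw [hw, dist_lineMap_left, Real.norm_of_nonneg hs0.le]
    calc s * dist ζ ζ' < s * (η + η') := by gcongr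
      _ = η := by rw [hs]; field_simp
  have hw2 : dist w ζ' < η' := by
    rw [hw, dist_lineMap_right, Real.norm_of_nonneg (by linarith)]
    calc (1 - s) * dist ζ ζ' < (1 - s) * (η + η') := by gcongr
      _ = η' := by rw [hs]; field_simp; ring
  have hw3 : w ∈ closure (ball (0 : ℂ) r) := by
    rw [closure_ball _ hr.ne']
    have := (convex_closedBall (0 : ℂ) r).segment_subset
      (x := ζ) (y := ζ') (by simp [hζ]) (by simp [hζ'])
    apply this
    rw [segment_eq_image_lineMap]
    exact ⟨s, ⟨hs0.le, hs1.le⟩, rfl⟩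
  have := mem_closure_iff.1 hw3 (ball ζ η ∩ ball ζ' η') (isOpen_ball.inter isOpen_ball)
    ⟨hw1, hw2⟩
  exact this

/-- A lift over a punctured disc that accumulates at some boundary point at a compact set of
points of `M`, relatively open in the level sets of `|F|`, extends to a larger punctured disc. -/
lemma IsRootLift.exists_extension [T2Space X] (hF : IsLocalHomeomorphOn F M)
    (hM : IsOpen M) {r : ℝ} (hr : 0 < r)
    (h : IsRootLift F M n φ (puncturedDisc r)) {K : Set X} (hK : IsCompact K) (hKM : K ⊆ M)
    (hKo : ∀ q ∈ K, ∀ᶠ x in 𝓝 q, ‖F x‖ = ‖F q‖ → x ∈ K)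
    {ζ₀ : ℂ} {q₀ : X} (hζ₀ : ‖ζ₀‖ = r) (hq₀ : q₀ ∈ K) (hc : (ζ₀, q₀) ∈ closure (liftGraph φ r)) :
    ∃ r' > r, ∃ φ', IsRootLift F M n φ' (puncturedDisc r') ∧
      Set.EqOn φ' φ (puncturedDisc r) := by
  -- the set of boundary points at which the lift accumulates in `K` is open and closed
  set S : Set ℂ := Prod.fst '' (closure (liftGraph φ r) ∩ (sphere (0 : ℂ) r ×ˢ K)) with hS
  have hSmem : ∀ ζ, ζ ∈ S ↔ ‖ζ‖ = r ∧ ∃ q ∈ K, (ζ, q) ∈ closure (liftGraph φ r) := by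
    intro ζ
    constructor
    · rintro ⟨⟨ζ, q⟩, ⟨h1, h2, h3⟩, rfl⟩
      exact ⟨by simpa using h2, q, h3, h1⟩
    · rintro ⟨h1, q, h2, h3⟩
      exact ⟨(ζ, q), ⟨h3, by simpa using h1, h2⟩, rfl⟩
  have hSc : IsClosed S :=
    ((((isCompact_sphere (0 : ℂ) r).prod hK).inter_left isClosed_closure).image
      continuous_fst).isClosed
  have hSo : ∀ ζ ∈ S, ∀ᶠ ζ' in 𝓝 ζ, ‖ζ'‖ = r → ζ' ∈ S := by
    intro ζ hζ
    obtain ⟨hζr, q, hqK, hcl⟩ := (hSmem ζ).1 hζ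
    obtain ⟨η, hη, hηr, ψ, hψ, hψφ, hψζ⟩ :=
      h.exists_local_extension hF hM hr hζr (hKM hqK) hcl
    have hcont : ContinuousAt ψ ζ := hψ.continuousOn.continuousAt (ball_mem_nhds ζ hη)
    have h1 := hcont.eventually (by rw [hψζ]; exact hKo q hqK)
    filter_upwards [h1, ball_mem_nhds ζ hη] with ζ' h1 h2 h3
    rw [hSmem]
    refine ⟨h3, ψ ζ', h1 ?_, ?_⟩
    · rw [hψ.comp_eq ζ' h2, ← hψζ, hψ.comp_eq ζ (mem_ball_self hη), norm_pow, norm_pow, h3, hζr]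
    · have hcont' : ContinuousAt (fun z => (z, ψ z)) ζ' :=
        continuousAt_id.prodMk (hψ.continuousOn.continuousAt (isOpen_ball.mem_nhds h2))
      have hcl' : ζ' ∈ closure (ball ζ η ∩ ball 0 r) := by
        have : ζ' ∈ ball ζ η ∩ closure (ball 0 r) := by
          refine ⟨h2, ?_⟩
          rw [closure_ball _ hr.ne']
          simp [h3]
        exact isOpen_ball.inter_closure this
      have h4 := hcont'.continuousWithinAt.mem_closure_image hcl'
      refine closure_mono ?_ h4
      rintro _ ⟨z, hz, rfl⟩
      have hz' : z ∈ ball ζ η ∩ puncturedDisc r := by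
        rw [ball_inter_puncturedDisc (by rw [hζr]; exact hηr)]; exact hz
      exact ⟨z, hz'.2, by simp only [hψφ hz']⟩
  have hSall : sphere (0 : ℂ) r ⊆ S := by
    have hpre : IsPreconnected (sphere (0 : ℂ) r) :=
      isPreconnected_sphere (by rw [Complex.rank_real_complex]; norm_num) 0 r
    have hSopen : ∃ O, IsOpen O ∧ O ∩ sphere (0 : ℂ) r = S := by
      refine ⟨{ζ | ∀ᶠ ζ' in 𝓝 ζ, ‖ζ'‖ = r → ζ' ∈ S}, isOpen_setOfPred_eventually_nhds, ?_⟩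
      ext ζ
      constructor
      · rintro ⟨h1, h2⟩
        exact h1.self_of_nhds (by simpa using h2)
      · intro h1
        exact ⟨hSo ζ h1, by simpa using ((hSmem ζ).1 h1).1⟩
    obtain ⟨O, hO, hOS⟩ := hSopen
    intro ζ hζ
    by_contra hn
    have hζO : ζ ∈ Oᶜ := fun hO' => hn (hOS ▸ ⟨hO', hζ⟩)
    obtain ⟨ζ', h1, h2, h3⟩ := isPreconnected_closed_iff.1 hpre S Oᶜ hSc hO.isClosed_compl
      (by
        intro ζ' h1
        by_cases h2 : ζ' ∈ O
        · exact Or.inl (hOS ▸ ⟨h2, h1⟩)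
        · exact Or.inr h2)
      ⟨ζ₀, by simp [hζ₀], (hSmem ζ₀).2 ⟨hζ₀, q₀, hq₀, hc⟩⟩ ⟨ζ, hζ, hζO⟩
    rw [← hOS] at h2
    exact h3 h2.1
  have hloc : ∀ ζ : sphere (0 : ℂ) r, ∃ η > 0, η ≤ r ∧ ∃ ψ, IsRootLift F M n ψ (ball (ζ : ℂ) η) ∧
      Set.EqOn ψ φ (ball (ζ : ℂ) η ∩ puncturedDisc r) := by
    intro ζ
    obtain ⟨hζr, q, hqK, hcl⟩ := (hSmem ζ).1 (hSall ζ.2)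
    obtain ⟨η, hη, hηr, ψ, hψ, hψφ, -⟩ :=
      h.exists_local_extension hF hM hr hζr (hKM hqK) hcl
    exact ⟨η, hη, hηr, ψ, hψ, hψφ⟩
  choose η hη hηr ψ hψ hψφ using hloc
  -- glue the lift and its local extensions
  let U : Option (sphere (0 : ℂ) r) → Set ℂ := fun o =>
    o.elim (puncturedDisc r) fun ζ => ball ζ (η ζ)
  let g : Option (sphere (0 : ℂ) r) → ℂ → X := fun o => o.elim φ ψ
  have hsph : ∀ ζ : sphere (0 : ℂ) r, ‖(ζ : ℂ)‖ = r := fun ζ => by simp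
  have hUo : ∀ o, IsOpen (U o) := by
    rintro (_ | ζ)
    · exact isOpen_puncturedDisc r
    · exact isOpen_ball
  have hgl : ∀ o, IsRootLift F M n (g o) (U o) := by
    rintro (_ | ζ)
    · exact h
    · exact hψ ζ
  have hagree : ∀ o o', ∀ a ∈ U o ∩ U o', g o a = g o' a := by
    rintro (_ | ζ) (_ | ζ') a ⟨ha, ha'⟩
    · rfl
    · exact (hψφ ζ' ⟨ha', ha⟩).symm
    · exact hψφ ζ ⟨ha, ha'⟩
    · obtain ⟨w, ⟨hw, hw'⟩, hwr⟩ := exists_mem_ball_inter_ball hr (hsph ζ) (hsph ζ') (hη ζ) (hη ζ')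
        ⟨a, ha, ha'⟩
      have hwp : w ∈ puncturedDisc r := by
        have : w ∈ ball (ζ : ℂ) (η ζ) ∩ puncturedDisc r := by
          rw [ball_inter_puncturedDisc (by rw [hsph]; exact hηr ζ)]
          exact ⟨hw, hwr⟩
        exact this.2
      refine ((hψ ζ).mono Set.inter_subset_left).eqOn hF ((hψ ζ').mono Set.inter_subset_right)
        ((convex_ball _ _).inter (convex_ball _ _)).isPreconnected ⟨hw, hw'⟩ ?_ ⟨ha, ha'⟩
      rw [hψφ ζ ⟨hw, hwp⟩, hψφ ζ' ⟨hw', hwp⟩]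
  have : Nonempty X := ⟨q₀⟩
  obtain ⟨G, hG⟩ := exists_eqOn_of_agree U g hagree
  have hGl : IsRootLift F M n G (⋃ o, U o) :=
    IsRootLift.iUnion hUo fun o => (hgl o).congr (hG o)
  -- the domain of the glued lift contains a larger punctured disc
  have hcover : closedBall (0 : ℂ) r ⊆ insert 0 (⋃ o, U o) := by
    intro z hz
    rw [mem_closedBall_zero_iff] at hz
    by_cases h0 : z = 0
    · exact Or.inl h0
    · right
      rcases hz.lt_or_eq with hz | hz
      · exact Set.mem_iUnion.2 ⟨none, h0, hz⟩
      · exact Set.mem_iUnion.2 ⟨some ⟨z, by simpa using hz⟩, mem_ball_self (hη _)⟩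
  have hopen : IsOpen (insert 0 (⋃ o, U o)) := by
    have : insert 0 (⋃ o, U o) = ball 0 r ∪ ⋃ o, U o := by
      ext z
      constructor
      · rintro (rfl | hz)
        · exact Or.inl (mem_ball_self hr)
        · exact Or.inr hz
      · rintro (hz | hz)
        · exact hcover (ball_subset_closedBall hz)
        · exact Or.inr hz
    rw [this]
    exact isOpen_ball.union (isOpen_iUnion hUo)
  obtain ⟨δ, hδ, hδsub⟩ :=
    (isCompact_closedBall (0 : ℂ) r).exists_thickening_subset_open hopen hcover
  rw [thickening_closedBall hδ hr.le] at hδsub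
  refine ⟨r + δ, by linarith, G, hGl.mono ?_, hG none⟩
  intro z hz
  exact (hδsub (by rw [mem_ball_zero_iff]; linarith [hz.2] : z ∈ ball 0 (δ + r))).resolve_left hz.1

end Lifting

/-! ### The canonical coordinate at a zero of `F` -/

section Chart

open Metric

variable {F : OnePoint ℂ → ℂ} {Ω : Set (OnePoint ℂ)} {p : OnePoint ℂ} {n : ℕ}

/-- The inverse `e` of a coordinate at `p` in which `F` is the power map `z ↦ z ^ n`, with regular
values off the centre. In the local parameter `t` the coordinate is `t u(t)`, with `u` analytic
and non-zero. -/
structure IsRootChart (F : OnePoint ℂ → ℂ) (M : Set (OnePoint ℂ)) (p : OnePoint ℂ) (n : ℕ)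
    (e : OpenPartialHomeomorph ℂ (OnePoint ℂ)) : Prop where
  zero_mem : 0 ∈ e.source
  map_zero : e 0 = p
  mapsTo : ∀ z ∈ e.source, z ≠ 0 → e z ∈ M
  comp_eq : ∀ z ∈ e.source, F (e z) = z ^ n
  param : ∃ u : ℂ → ℂ, AnalyticAt ℂ u 0 ∧ u 0 ≠ 0 ∧ ∀ᶠ t in 𝓝 0, sphereParam p t = e (t * u t)

lemma exists_analyticAt_pow_eq {g : ℂ → ℂ} (hg : AnalyticAt ℂ g 0) (hg0 : g 0 ≠ 0) (hn : n ≠ 0) :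
    ∃ v : ℂ → ℂ, AnalyticAt ℂ v 0 ∧ v 0 ≠ 0 ∧ ∀ t, v t ^ n = g t := by
  obtain ⟨c, hc⟩ := IsAlgClosed.exists_pow_nat_eq (g 0) (Nat.pos_of_ne_zero hn)
  have hc0 : c ≠ 0 := by
    rintro rfl
    rw [zero_pow hn] at hc
    exact hg0 hc.symm
  refine ⟨fun t => c * (g t / g 0) ^ ((n : ℂ)⁻¹), ?_, ?_, ?_⟩
  · refine analyticAt_const.mul (AnalyticAt.cpow (hg.div analyticAt_const hg0) analyticAt_const ?_)
    simp [hg0]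
  · simp [hg0, hc0]
  · intro t
    rw [mul_pow, hc, Complex.cpow_nat_inv_pow _ hn]
    field_simp

lemma exists_isRootChart (hΩ : IsOpen Ω) (hF : IsMeromorphicFunOn F Ω) (hp : p ∈ Ω)
    (hfin : meromorphicOrderAt (dlogCoeff F p) 0 ≠ ⊤) (hn : n ≠ 0) {g : ℂ → ℂ}
    (hg : AnalyticAt ℂ g 0) (hg0 : g 0 ≠ 0) (hG : ∀ᶠ t in 𝓝 0, localRep F p t = t ^ n * g t) :
    ∃ e, IsRootChart F (regularPart F Ω) p n e := by
  obtain ⟨v, hv, hv0, hvn⟩ := exists_analyticAt_pow_eq hg hg0 hn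
  have hs : HasStrictDerivAt (fun t : ℂ => t * v t) (v 0) 0 := by
    have h1 := (hasStrictDerivAt_id (0 : ℂ)).mul hv.hasStrictDerivAt
    simp only [id, one_mul, zero_mul, add_zero] at h1
    exact h1
  let E := (hs.hasStrictFDerivAt_equiv hv0).toOpenPartialHomeomorph (fun t : ℂ => t * v t)
  let S := (isOpenEmbedding_sphereParam p).toOpenPartialHomeomorph
  have hEcoe : ∀ t, E t = t * v t := fun t => rfl
  have hScoe : ∀ t, S t = sphereParam p t := fun t => rfl
  have hE0 : (0 : ℂ) ∈ E.source := HasStrictFDerivAt.mem_toOpenPartialHomeomorph_source _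
  have hE00 : E 0 = 0 := by simp [hEcoe]
  have hE0t : (0 : ℂ) ∈ E.target := by
    have := E.map_source hE0
    rwa [hE00] at this
  have hEs0 : E.symm 0 = 0 := by
    have := E.left_inv hE0
    rwa [hE00] at this
  let e₀ := E.symm.trans S
  have he₀ : ∀ z, e₀ z = sphereParam p (E.symm z) := fun z => rfl
  have hsrc : e₀.source = E.target := by
    simp [e₀, S]
  have htend : Tendsto E.symm (𝓝 0) (𝓝 0) := by
    have := E.continuousAt_symm hE0t
    unfold ContinuousAt at this
    rwa [hEs0] at this
  have hev : ∀ᶠ z in 𝓝 (0 : ℂ), (z ≠ 0 → e₀ z ∈ regularPart F Ω) ∧ F (e₀ z) = z ^ n := by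
    have h1 := eventually_mem_regularPart hΩ hF hp hfin
    rw [← map_sphereParam_nhdsNE p, eventually_map, eventually_nhdsWithin_iff] at h1
    filter_upwards [htend.eventually h1, htend.eventually hG, E.open_target.mem_nhds hE0t]
      with z h1 h2 h3
    refine ⟨fun hz => h1 ?_, ?_⟩
    · intro h4
      apply hz
      have h4 : E.symm z = 0 := h4
      rw [← E.right_inv h3, h4, hE00]
    · have h5 : F (sphereParam p (E.symm z)) = E.symm z ^ n * g (E.symm z) := h2
      rw [he₀, h5, ← hvn, ← mul_pow, ← hEcoe, E.right_inv h3]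
  obtain ⟨s, hs', hso, h0s⟩ := _root_.eventually_nhds_iff.1 hev
  have hsi : interior s = s := hso.interior_eq
  refine ⟨e₀.restr s, ⟨?_, ?_, ?_, ?_, v, hv, hv0, ?_⟩⟩
  · rw [OpenPartialHomeomorph.restr_source, hsrc, hsi]
    exact ⟨hE0t, h0s⟩
  · simp [he₀, hEs0]
  · intro z hz hz0
    rw [OpenPartialHomeomorph.restr_source, hsi] at hz
    exact (hs' z hz.2).1 hz0
  · intro z hz
    rw [OpenPartialHomeomorph.restr_source, hsi] at hz
    exact (hs' z hz.2).2
  · filter_upwards [E.open_source.mem_nhds hE0] with t ht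
    have : e₀.restr s (t * v t) = sphereParam p (E.symm (E t)) := rfl
    rw [this, E.left_inv ht]

end Chart

/-! ### Open maps and accumulation points of lifts -/

section LiftTopology

open Metric

lemma isLocalHomeomorphOn_pow {n : ℕ} (hn : n ≠ 0) :
    IsLocalHomeomorphOn (fun z : ℂ => z ^ n) {0}ᶜ := by
  apply IsLocalHomeomorphOn.mk
  intro z hz
  have hz : z ≠ 0 := hz
  have hs : HasStrictDerivAt (fun z : ℂ => z ^ n) (n * z ^ (n - 1)) z := hasStrictDerivAt_pow n z
  have hd : (n : ℂ) * z ^ (n - 1) ≠ 0 := mul_ne_zero (by exact_mod_cast hn) (pow_ne_zero _ hz)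
  exact ⟨(hs.hasStrictFDerivAt_equiv hd).toOpenPartialHomeomorph _,
    HasStrictFDerivAt.mem_toOpenPartialHomeomorph_source _, fun _ _ => rfl⟩

variable {X : Type*} [TopologicalSpace X] {F : X → ℂ} {M : Set X} {n : ℕ} {φ : ℂ → X} {U : Set ℂ}

lemma IsRootLift.isLocalHomeomorphOn (hF : IsLocalHomeomorphOn F M) (hn : n ≠ 0)
    (h : IsRootLift F M n φ U) (hU : IsOpen U) (h0 : (0 : ℂ) ∉ U) : IsLocalHomeomorphOn φ U := by
  have hcont : ∀ x ∈ U, ContinuousAt φ x := fun x hx => h.continuousOn.continuousAt (hU.mem_nhds hx)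
  refine IsLocalHomeomorphOn.of_comp_left (g := F) ?_ (hF.mono h.mapsTo.image_subset) hcont
  apply IsLocalHomeomorphOn.mk
  intro z hz
  have hz0 : z ∈ ({0}ᶜ : Set ℂ) := fun h' => h0 (h' ▸ hz)
  obtain ⟨e, hze, he⟩ := isLocalHomeomorphOn_pow hn z hz0
  refine ⟨e.restr U, ?_, ?_⟩
  · rw [OpenPartialHomeomorph.restr_source, hU.interior_eq]
    exact ⟨hze, hz⟩
  · intro y hy
    rw [OpenPartialHomeomorph.restr_source, hU.interior_eq] at hy
    have : e y = y ^ n := (congrFun he y).symm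
    rw [Function.comp_apply, h.comp_eq y hy.2, ← this]
    rfl

lemma IsRootLift.isOpen_image (hF : IsLocalHomeomorphOn F M) (hn : n ≠ 0)
    (h : IsRootLift F M n φ U) (hU : IsOpen U) (h0 : (0 : ℂ) ∉ U) : IsOpen (φ '' U) := by
  rw [isOpen_iff_mem_nhds]
  rintro _ ⟨z, hz, rfl⟩
  rw [← (h.isLocalHomeomorphOn hF hn hU h0).map_nhds_eq hz]
  exact image_mem_map (hU.mem_nhds hz)

lemma zero_notMem_puncturedDisc (r : ℝ) : (0 : ℂ) ∉ puncturedDisc r := fun h => h.1 rfl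

/-- By compactness of the closed disc, an accumulation point of the values of a lift comes with an
accumulation point of the arguments. -/
lemma exists_mem_closure_liftGraph {r : ℝ} {q : X} (hq : q ∈ closure (φ '' puncturedDisc r)) :
    ∃ ζ, (ζ, q) ∈ closure (liftGraph φ r) := by
  have hne : (comap φ (𝓝 q) ⊓ 𝓟 (puncturedDisc r)).NeBot := by
    rw [Filter.neBot_iff, Ne, ← Filter.empty_mem_iff_bot, mem_inf_principal]
    rintro ⟨V, hV, hsub⟩
    obtain ⟨_, hxV, z, hz, rfl⟩ := mem_closure_iff_nhds.1 hq V hV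
    exact hsub hxV hz
  obtain ⟨ζ, -, hζ⟩ := (isCompact_closedBall (0 : ℂ) r).exists_clusterPt
    (f := comap φ (𝓝 q) ⊓ 𝓟 (puncturedDisc r)) (inf_le_right.trans (principal_mono.2
      fun z hz => by simpa using hz.2.le))
  refine ⟨ζ, mem_closure_iff_nhds.2 fun T hT => ?_⟩
  rw [nhds_prod_eq] at hT
  obtain ⟨A, hA, B, hB, hAB⟩ := mem_prod_iff.1 hT
  obtain ⟨z, hzA, hzB, hz⟩ := clusterPt_iff_nonempty.1 hζ hA
    (inter_mem_inf (preimage_mem_comap hB) (mem_principal_self _))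
  exact ⟨(z, φ z), hAB ⟨hzA, hzB⟩, z, hz, rfl⟩

lemma eq_of_mem_closure_liftGraph [T2Space X] {r : ℝ} {ζ : ℂ} {q : X} (hφ : ContinuousAt φ ζ)
    (hc : (ζ, q) ∈ closure (liftGraph φ r)) : q = φ ζ := by
  by_contra hne
  obtain ⟨A, B, hA, hB, hqA, hB', hd⟩ := t2_separation hne
  have h1 : (φ ⁻¹' B) ×ˢ A ∈ 𝓝 (ζ, q) :=
    prod_mem_nhds (hφ.preimage_mem_nhds (hB.mem_nhds hB')) (hA.mem_nhds hqA)
  obtain ⟨_, ⟨h2, h3⟩, z, hz, rfl⟩ := mem_closure_iff_nhds.1 hc _ h1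
  exact Set.disjoint_left.1 hd h3 h2

end LiftTopology

/-! ### The maximal lift -/

section MaxLift

open Metric

variable {F : OnePoint ℂ → ℂ} {Ω : Set (OnePoint ℂ)} {p : OnePoint ℂ} {n : ℕ}
  {φ : ℂ → OnePoint ℂ}

/-- The accumulation points in `Ω` of a lift over a punctured disc: apart from the centre, they are
values of the lift or lie on the level curve that corresponds to the boundary circle. -/
lemma IsRootLift.mem_closure_image (hF : IsMeromorphicFunOn F Ω) (hn : n ≠ 0) {r : ℝ}
    (h : IsRootLift F (regularPart F Ω) n φ (puncturedDisc r)) (hφ : ContinuousAt φ 0)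
    (hφ0 : φ 0 = p) {q : OnePoint ℂ} (hq : q ∈ closure (φ '' puncturedDisc r)) (hqΩ : q ∈ Ω)
    (hqp : q ≠ p) : F q ≠ 0 ∧ ∃ ζ, (ζ, q) ∈ closure (liftGraph φ r) ∧ ‖ζ‖ ≤ r ∧ F q = ζ ^ n ∧
      (‖ζ‖ < r → q ∈ φ '' puncturedDisc r) := by
  obtain ⟨ζ, hζ⟩ := exists_mem_closure_liftGraph hq
  have hζr : ‖ζ‖ ≤ r := norm_le_of_mem_closure_liftGraph hζ
  have hζ0 : ζ ≠ 0 := by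
    rintro rfl
    exact hqp ((eq_of_mem_closure_liftGraph hφ hζ).trans hφ0)
  have hFq : F q ≠ 0 := by
    intro h0
    rcases tendsto_of_eq_zero hF hqΩ h0 with h1 | h1
    · have hc : ContinuousAt F q := by
        unfold ContinuousAt
        rwa [h0]
      have := comp_eq_of_mem_closure_liftGraph h hc hζ
      rw [h0] at this
      exact hζ0 (pow_eq_zero_iff hn |>.1 this.symm)
    · rw [← tendsto_norm_atTop_iff_cobounded] at h1
      have h2 := h1.eventually (eventually_gt_atTop (r ^ n))
      rw [eventually_nhdsWithin_iff] at h2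
      obtain ⟨x, ⟨z, hz, rfl⟩, hx2⟩ :=
        ((mem_closure_iff_frequently.1 hq).and_eventually h2).exists
      have h3 : φ z ≠ q := by
        intro h4
        have := h.comp_eq z hz
        rw [h4, h0] at this
        exact hz.1 (pow_eq_zero_iff hn |>.1 this.symm)
      have h4 := hx2 h3
      rw [h.comp_eq z hz, norm_pow] at h4
      exact absurd h4 (not_lt.2 (pow_le_pow_left₀ (norm_nonneg z) hz.2.le n))
  refine ⟨hFq, ζ, hζ, hζr, comp_eq_of_mem_closure_liftGraph h
    (continuousAt_of_ne_zero hF hqΩ hFq) hζ, fun hlt => ?_⟩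
  have hmem : ζ ∈ puncturedDisc r := ⟨hζ0, hlt⟩
  exact ⟨ζ, hmem, (eq_of_mem_closure_liftGraph (h.continuousOn.continuousAt
    ((isOpen_puncturedDisc r).mem_nhds hmem)) hζ).symm⟩

/-- The lift of the power map cannot be continued over the whole plane if `d ln F` has a zero:
otherwise the closure in `Ω` of its image would be open, hence everything. -/
lemma not_isRootLift_compl_zero (hΩ : IsOpen Ω) (hΩc : IsPreconnected Ω)
    (hF : IsMeromorphicFunOn F Ω) (hfin : ∀ x ∈ Ω, meromorphicOrderAt (dlogCoeff F x) 0 ≠ ⊤)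
    (hz : ∃ x ∈ Ω, IsDlogZero F x) (hn : n ≠ 0) (hφ : ContinuousAt φ 0) (hφ0 : F (φ 0) = 0)
    (h : IsRootLift F (regularPart F Ω) n φ {0}ᶜ) : False := by
  set W := φ '' {0}ᶜ with hW
  have hWM : W ⊆ regularPart F Ω := h.mapsTo.image_subset
  have hWo : IsOpen W :=
    h.isOpen_image (isLocalHomeomorphOn_regularPart hF) hn isOpen_compl_singleton
    (by simp)
  have hcl : ∀ q ∈ closure W, q ∈ Ω → F q ≠ 0 → q ∈ W := by
    intro q hq hqΩ hq0
    set r := ‖F q‖ + 1 with hr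
    have hr1 : 1 ≤ r := by rw [hr]; linarith [norm_nonneg (F q)]
    have hFr : ‖F q‖ < r ^ n := by
      calc ‖F q‖ < r := by rw [hr]; linarith
        _ ≤ r ^ n := le_self_pow₀ hr1 hn
    have hsub : puncturedDisc r ⊆ ({0}ᶜ : Set ℂ) := fun z hz => hz.1
    have hnear : ∀ᶠ x in 𝓝 q, ‖F x‖ < r ^ n :=
      (continuousAt_of_ne_zero hF hqΩ hq0).norm.eventually_lt continuousAt_const hFr
    have hq' : q ∈ closure (φ '' puncturedDisc r) := by
      rw [mem_closure_iff_frequently] at hq ⊢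
      refine (hq.and_eventually hnear).mono ?_
      rintro _ ⟨⟨z, hz, rfl⟩, hlt⟩
      refine ⟨z, ⟨hz, ?_⟩, rfl⟩
      rw [h.comp_eq z hz, norm_pow] at hlt
      exact lt_of_pow_lt_pow_left₀ n (by linarith) hlt
    have hqp : q ≠ φ 0 := by
      rintro rfl
      exact hq0 hφ0
    obtain ⟨-, ζ, -, -, hFζ, hmem⟩ :=
      (h.mono hsub).mem_closure_image hF hn hφ rfl hq' hqΩ hqp
    refine Set.image_mono hsub (hmem ?_)
    rw [hFζ, norm_pow] at hFr
    exact lt_of_pow_lt_pow_left₀ n (by linarith) hFr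
  have hint : ∀ q ∈ closure W, q ∈ Ω → q ∈ interior (closure W) := by
    intro q hq hqΩ
    by_cases hq0 : F q = 0
    -- a punctured neighbourhood of `q` is connected and regular, so it lies in `W`
    · have h1 := eventually_mem_regularPart hΩ hF hqΩ (hfin q hqΩ)
      rw [← map_sphereParam_nhdsNE q, eventually_map, eventually_nhdsWithin_iff,
        Metric.eventually_nhds_iff_ball] at h1
      obtain ⟨s, hs, hball⟩ := h1
      have hN : ∀ t ∈ puncturedDisc s, sphereParam q t ∈ regularPart F Ω := fun t ht =>
        hball t (by simpa using ht.2) ht.1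
      have hNW : sphereParam q '' puncturedDisc s ⊆ W := by
        refine ((isPreconnected_puncturedDisc s).image _
          (continuous_sphereParam q).continuousOn).subset_of_closure_inter_subset hWo ?_ ?_
        · have hmem : sphereParam q '' ball 0 s ∈ 𝓝 q := by
            rw [← map_sphereParam_nhds q]
            exact image_mem_map (ball_mem_nhds _ hs)
          obtain ⟨_, ⟨t, ht, rfl⟩, htW⟩ := mem_closure_iff_nhds.1 hq _ hmem
          refine ⟨sphereParam q t, ⟨t, ⟨?_, by simpa using ht⟩, rfl⟩, htW⟩
          rintro rfl
          rw [sphereParam_zero] at htW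
          exact ((mem_regularPart_iff hF).1 (hWM htW)).2.1 hq0
        · rintro _ ⟨hc, t, ht, rfl⟩
          have := (mem_regularPart_iff hF).1 (hN t ht)
          exact hcl _ hc this.1 this.2.1
      rw [mem_interior_iff_mem_nhds]
      have hmem : sphereParam q '' ball 0 s ∈ 𝓝 q := by
        rw [← map_sphereParam_nhds q]
        exact image_mem_map (ball_mem_nhds _ hs)
      filter_upwards [hmem] with y hy
      obtain ⟨t, ht, rfl⟩ := hy
      by_cases h0 : t = 0
      · rw [h0, sphereParam_zero]; exact hq
      · exact subset_closure (hNW ⟨t, ⟨h0, by simpa using ht⟩, rfl⟩)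
    · exact interior_maximal subset_closure hWo (hcl q hq hqΩ hq0)
  have hsub : Ω ⊆ interior (closure W) := by
    have h1 : φ 1 ∈ W := ⟨1, by simp, rfl⟩
    refine hΩc.subset_of_closure_inter_subset isOpen_interior
      ⟨φ 1, (hWM h1).1, interior_maximal subset_closure hWo h1⟩ ?_
    rintro q ⟨hq, hqΩ⟩
    exact hint q (closure_minimal interior_subset isClosed_closure hq) hqΩ
  obtain ⟨x, hxΩ, hx⟩ := hz
  obtain ⟨hx1, hx2⟩ := (isDlogZero_iff hF hxΩ (hfin x hxΩ)).1 hx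
  exact hx2 (hWM (hcl x (interior_subset (hsub hxΩ)) hxΩ hx1))

/-- The lift of the power map that starts with the canonical coordinate at a zero of `F`, over the
largest possible disc. -/
lemma exists_maximal_lift (hΩ : IsOpen Ω) (hΩc : IsPreconnected Ω)
    (hF : IsMeromorphicFunOn F Ω) (hfin : ∀ x ∈ Ω, meromorphicOrderAt (dlogCoeff F x) 0 ≠ ⊤)
    (hz : ∃ x ∈ Ω, IsDlogZero F x) (hn : n ≠ 0)
    {e : OpenPartialHomeomorph ℂ (OnePoint ℂ)} (he : IsRootChart F (regularPart F Ω) p n e) :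
    ∃ R > 0, ∃ φ : ℂ → OnePoint ℂ, φ =ᶠ[𝓝 0] e ∧
      IsRootLift F (regularPart F Ω) n φ (puncturedDisc R) ∧
      ∀ R' > R, ¬ ∃ φ', IsRootLift F (regularPart F Ω) n φ' (puncturedDisc R') ∧
        Set.EqOn φ' φ (puncturedDisc R) := by
  have hLH := isLocalHomeomorphOn_regularPart hF
  set A : Set ℝ := {r | 0 < r ∧ ∃ φ : ℂ → OnePoint ℂ, φ =ᶠ[𝓝 0] e ∧
    IsRootLift F (regularPart F Ω) n φ (puncturedDisc r)} with hA
  choose! hApos Φ hΦe hΦ using fun r (hr : r ∈ A) => hr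
  have hAne : A.Nonempty := by
    obtain ⟨r, hr, hball⟩ := Metric.isOpen_iff.1 e.open_source 0 he.zero_mem
    have hsub : puncturedDisc r ⊆ e.source := fun z hz => hball (by simpa using hz.2)
    exact ⟨r, hr, e, EventuallyEq.rfl, e.continuousOn.mono hsub,
      fun z hz => he.mapsTo z (hsub hz) hz.1, fun z hz => he.comp_eq z (hsub hz)⟩
  have hagree0 : ∀ r ∈ A, ∀ r' ∈ A, r ≤ r' → Set.EqOn (Φ r) (Φ r') (puncturedDisc r) := by
    intro r hr r' hr' hle
    have h1 : ∀ᶠ z in 𝓝[≠] (0 : ℂ), Φ r z = Φ r' z :=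
      ((hΦe r hr).trans (hΦe r' hr').symm).filter_mono nhdsWithin_le_nhds
    obtain ⟨z, hz1, hz2⟩ := (h1.and (puncturedDisc_mem_nhdsNE (hApos r hr))).exists
    exact (hΦ r hr).eqOn hLH ((hΦ r' hr').mono (puncturedDisc_mono hle))
      (isPreconnected_puncturedDisc r) hz2 hz1
  have hagree : ∀ r ∈ A, ∀ r' ∈ A, r ≤ r' → Set.EqOn (Φ r) (Φ r') (ball 0 r) := by
    intro r hr r' hr' hle z hz
    by_cases h0 : z = 0
    · rw [h0, (hΦe r hr).eq_of_nhds, (hΦe r' hr').eq_of_nhds]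
    · exact hagree0 r hr r' hr' hle ⟨h0, by simpa using hz⟩
  obtain ⟨φ, hφ⟩ := exists_eqOn_of_agree (fun r : A => ball (0 : ℂ) r) (fun r => Φ r) (by
    rintro ⟨r, hr⟩ ⟨r', hr'⟩ z ⟨hz, hz'⟩
    rcases le_total r r' with hle | hle
    · exact hagree r hr r' hr' hle hz
    · exact (hagree r' hr' r hr hle hz').symm)
  have hφe : φ =ᶠ[𝓝 0] e := by
    obtain ⟨r, hr⟩ := hAne
    filter_upwards [ball_mem_nhds (0 : ℂ) (hApos r hr), hΦe r hr] with z hz1 hz2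
    rw [hφ ⟨r, hr⟩ hz1, hz2]
  have hφl : IsRootLift F (regularPart F Ω) n φ (⋃ r : A, puncturedDisc r) :=
    IsRootLift.iUnion (fun r => isOpen_puncturedDisc r) fun r =>
      (hΦ r r.2).congr fun z hz => hφ r (by simpa using hz.2)
  have hφcont : ContinuousAt φ 0 :=
    (e.continuousAt he.zero_mem).congr hφe.symm
  have hφ0 : φ 0 = p := hφe.eq_of_nhds.trans he.map_zero
  have hFp : F p = 0 := by
    have := he.comp_eq 0 he.zero_mem
    rwa [he.map_zero, zero_pow hn] at this
  have hbdd : BddAbove A := by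
    by_contra hb
    refine not_isRootLift_compl_zero hΩ hΩc hF hfin hz hn hφcont (by rw [hφ0, hFp]) (hφl.mono ?_)
    intro z hz
    rw [not_bddAbove_iff] at hb
    obtain ⟨r, hr, hlt⟩ := hb ‖z‖
    exact Set.mem_iUnion.2 ⟨⟨r, hr⟩, hz, hlt⟩
  have hRpos : 0 < sSup A := by
    obtain ⟨r, hr⟩ := hAne
    exact (hApos r hr).trans_le (le_csSup hbdd hr)
  refine ⟨sSup A, hRpos, φ, hφe, hφl.mono ?_, ?_⟩
  · intro z hz
    obtain ⟨r, hr, hlt⟩ := exists_lt_of_lt_csSup hAne hz.2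
    exact Set.mem_iUnion.2 ⟨⟨r, hr⟩, hz.1, hlt⟩
  · rintro R' hR' ⟨φ', hφ', heq⟩
    have hmem : R' ∈ A := by
      refine ⟨hRpos.trans hR', Function.update φ' 0 p, ?_, hφ'.congr fun z hz => ?_⟩
      · filter_upwards [hφe, ball_mem_nhds (0 : ℂ) hRpos] with z hz1 hz2
        by_cases h0 : z = 0
        · rw [h0, Function.update_self, he.map_zero]
        · rw [Function.update_of_ne h0, heq ⟨h0, by simpa using hz2⟩, hz1]
      · exact Function.update_of_ne hz.1 _ _
    exact absurd (le_csSup hbdd hmem) (not_le.2 hR')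

end MaxLift

/-! ### Closed trajectories -/

section Trajectory

variable {F : OnePoint ℂ → ℂ} {Ω : Set (OnePoint ℂ)}

lemma IsClosedTrajectory.norm_eq {γ : Circle → OnePoint ℂ} (hF : IsMeromorphicFunOn F Ω)
    (h : IsClosedTrajectory F Ω γ) (θ θ' : Circle) : ‖F (γ θ)‖ = ‖F (γ θ')‖ := by
  obtain ⟨k, hk⟩ := h.const
  have hpos : ∀ θ, 0 < ‖F (γ θ)‖ := fun θ =>
    norm_pos_iff.2 ((mem_regularPart_iff hF).1 (h.regular θ)).2.1
  exact Real.log_injOn_pos (hpos θ) (hpos θ') ((hk θ).trans (hk θ').symm)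

/-- A closed trajectory is relatively open in the level curve that carries it, because an injective
continuous curve in a one-dimensional manifold is open. -/
lemma IsClosedTrajectory.eventually_mem_range {γ : Circle → OnePoint ℂ}
    (hF : IsMeromorphicFunOn F Ω) (h : IsClosedTrajectory F Ω γ) :
    ∀ q ∈ Set.range γ, ∀ᶠ x in 𝓝 q, ‖F x‖ = ‖F q‖ → x ∈ Set.range γ := by
  rintro _ ⟨θ₀, rfl⟩
  have hreg := h.regular θ₀
  obtain ⟨e, hqe, hFe⟩ := isLocalHomeomorphOn_regularPart hF _ hreg
  set w := F (γ θ₀) with hw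
  have hw0 : w ≠ 0 := ((mem_regularPart_iff hF).1 hreg).2.1
  have hFcont : ContinuousAt F (γ θ₀) := continuousAt_of_ne_zero hF hreg.1 hw0
  set c : ℝ → OnePoint ℂ := fun u => γ (θ₀ * Circle.exp u) with hc
  have hcc : Continuous c := h.continuous.comp (by fun_prop)
  have hc0 : c 0 = γ θ₀ := by simp [hc]
  -- the angular coordinate along the level curve
  set A : OnePoint ℂ → ℝ := fun x => Complex.arg (F x / w) with hA
  set N : Set (OnePoint ℂ) := {x | x ∈ e.source ∧ F x / w ∈ Complex.slitPlane} with hN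
  have hNmem : ∀ᶠ x in 𝓝 (γ θ₀), x ∈ N := by
    have h1 : ∀ᶠ x in 𝓝 (γ θ₀), x ∈ e.source := e.open_source.mem_nhds hqe
    refine h1.and ((hFcont.div_const w).eventually_mem (Complex.isOpen_slitPlane.mem_nhds ?_))
    simp [← hw, hw0]
  have hNA : ∀ x ∈ N, ContinuousAt A x := by
    rintro x ⟨hx1, hx2⟩
    have hFx : ContinuousAt F x := by
      rw [hFe]
      exact e.continuousAt hx1
    exact ContinuousAt.comp (g := Complex.arg) (Complex.continuousAt_arg hx2) (hFx.div_const w)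
  have hval : ∀ x, ‖F x‖ = ‖w‖ → F x = w * Complex.exp (A x * Complex.I) := by
    intro x hx
    have h1 : ‖F x / w‖ = 1 := by
      rw [norm_div, hx, div_self (norm_ne_zero_iff.2 hw0)]
    have h2 := Complex.norm_mul_exp_arg_mul_I (F x / w)
    rw [h1, Complex.ofReal_one, one_mul] at h2
    rw [hA, h2]
    field_simp
  have hinjN : ∀ x ∈ N, ∀ y ∈ N, ‖F x‖ = ‖w‖ → ‖F y‖ = ‖w‖ → A x = A y → x = y := by
    intro x hx y hy hx1 hy1 hxy
    refine e.injOn hx.1 hy.1 ?_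
    rw [← hFe, hval x hx1, hval y hy1, hxy]
  have hcN : ∀ᶠ u in 𝓝 (0 : ℝ), c u ∈ N := by
    have h1 := hcc.continuousAt (x := 0)
    unfold ContinuousAt at h1
    rw [hc0] at h1
    exact h1.eventually hNmem
  obtain ⟨η₀, hη₀, hball⟩ := Metric.eventually_nhds_iff_ball.1 hcN
  set η := min (η₀ / 2) 1 with hη
  have hηpos : 0 < η := lt_min (by linarith) one_pos
  have hη1 : η ≤ 1 := min_le_right _ _
  have hηN : ∀ u ∈ Set.Icc (-η) η, c u ∈ N := by
    intro u hu
    refine hball u ?_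
    have : η ≤ η₀ / 2 := min_le_left _ _
    rw [mem_ball_zero_iff, Real.norm_eq_abs, abs_lt]
    constructor <;> linarith [hu.1, hu.2]
  have hcnorm : ∀ u, ‖F (c u)‖ = ‖w‖ := fun u => h.norm_eq hF _ _
  set f : ℝ → ℝ := fun u => A (c u) with hf
  have hfc : ContinuousOn f (Set.Icc (-η) η) := fun u hu =>
    (ContinuousAt.comp (g := A) (hNA _ (hηN u hu)) hcc.continuousAt).continuousWithinAt
  -- `f` is continuous and injective, so its image contains a neighbourhood of `f 0 = 0`
  have hfi : Set.InjOn f (Set.Icc (-η) η) := by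
    intro u hu u' hu' huu
    have h1 := hinjN _ (hηN u hu) _ (hηN u' hu') (hcnorm u) (hcnorm u') huu
    have h2 := mul_left_cancel (h.injective h1)
    have hpi := Real.pi_gt_three
    have h3 := Circle.arg_exp (x := u) (by linarith [hu.1]) (by linarith [hu.2])
    have h4 := Circle.arg_exp (x := u') (by linarith [hu'.1]) (by linarith [hu'.2])
    rw [← h3, ← h4, h2]
  have hf0 : f 0 = 0 := by simp [hf, hA, hc0, ← hw, hw0]
  have hm1 : -η ∈ Set.Icc (-η) η := ⟨le_rfl, by linarith⟩
  have hm2 : η ∈ Set.Icc (-η) η := ⟨by linarith, le_rfl⟩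
  have hm0 : (0 : ℝ) ∈ Set.Icc (-η) η := ⟨by linarith, by linarith⟩
  have himg : ∃ a < 0, ∃ b > 0, Set.Ioo a b ⊆ f '' Set.Icc (-η) η := by
    rcases ContinuousOn.strictMonoOn_of_injOn_Icc' (by linarith) hfc hfi with hmono | hanti
    · refine ⟨f (-η), hf0 ▸ hmono hm1 hm0 (by linarith), f η,
        by rw [gt_iff_lt, ← hf0]; exact hmono hm0 hm2 hηpos, ?_⟩
      exact Set.Ioo_subset_Icc_self.trans (intermediate_value_Icc (by linarith) hfc)
    · refine ⟨f η, hf0 ▸ hanti hm0 hm2 hηpos, f (-η),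
        by rw [gt_iff_lt, ← hf0]; exact hanti hm1 hm0 (by linarith), ?_⟩
      exact Set.Ioo_subset_Icc_self.trans (intermediate_value_Icc' (by linarith) hfc)
  obtain ⟨a, ha, b, hb, hab⟩ := himg
  have hA0 : A (γ θ₀) = 0 := by rw [← hc0]; exact hf0
  have hAev : ∀ᶠ x in 𝓝 (γ θ₀), A x ∈ Set.Ioo a b :=
    (hNA _ hNmem.self_of_nhds).eventually_mem (by rw [hA0]; exact Ioo_mem_nhds ha hb)
  filter_upwards [hNmem, hAev] with x hx1 hx2 hx3
  obtain ⟨u, hu, hux⟩ := hab hx2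
  rw [← hinjN _ (hηN u hu) x hx1 (hcnorm u) hx3 hux]
  exact ⟨_, rfl⟩

end Trajectory

/-! ### The ring domain of a zero of `F` -/

section RingChart

open Metric

/-- `φ` is the inverse of the canonical coordinate at the zero `p`, of order `n`, of `F`, continued
over the largest possible disc, of radius `R`. -/
structure IsRingChart (F : OnePoint ℂ → ℂ) (Ω : Set (OnePoint ℂ)) (p : OnePoint ℂ) (n : ℕ) (R : ℝ)
    (φ : ℂ → OnePoint ℂ) : Prop where
  pos : 0 < R
  order_ne : n ≠ 0
  germ : ∃ e, IsRootChart F (regularPart F Ω) p n e ∧ φ =ᶠ[𝓝 0] e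
  lift : IsRootLift F (regularPart F Ω) n φ (puncturedDisc R)
  maximal : ∀ R' > R, ¬ ∃ φ', IsRootLift F (regularPart F Ω) n φ' (puncturedDisc R') ∧
    Set.EqOn φ' φ (puncturedDisc R)

variable {F : OnePoint ℂ → ℂ} {Ω : Set (OnePoint ℂ)} {p : OnePoint ℂ} {n : ℕ} {R : ℝ}
  {φ : ℂ → OnePoint ℂ}

lemma IsRingChart.continuousAt_zero (h : IsRingChart F Ω p n R φ) : ContinuousAt φ 0 := by
  obtain ⟨e, he, hφ⟩ := h.germ
  exact (e.continuousAt he.zero_mem).congr hφ.symm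

lemma IsRingChart.map_zero (h : IsRingChart F Ω p n R φ) : φ 0 = p := by
  obtain ⟨e, he, hφ⟩ := h.germ
  exact hφ.eq_of_nhds.trans he.map_zero

lemma IsRingChart.map_center (h : IsRingChart F Ω p n R φ) : F p = 0 := by
  obtain ⟨e, he, hφ⟩ := h.germ
  have := he.comp_eq 0 he.zero_mem
  rwa [he.map_zero, zero_pow h.order_ne] at this

lemma IsRingChart.continuousAt_center (h : IsRingChart F Ω p n R φ) : ContinuousAt F p := by
  obtain ⟨e, he, -⟩ := h.germ
  have h1 : Tendsto (fun z : ℂ => z ^ n) (𝓝 0) (𝓝 (0 ^ n)) := (continuous_pow n).tendsto 0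
  unfold ContinuousAt
  rw [h.map_center, ← he.map_zero, ← e.map_nhds_eq he.zero_mem, tendsto_map'_iff]
  rw [zero_pow h.order_ne] at h1
  refine h1.congr' ?_
  filter_upwards [e.open_source.mem_nhds he.zero_mem] with z hz
  exact (he.comp_eq z hz).symm

lemma IsRingChart.image_subset (h : IsRingChart F Ω p n R φ) :
    φ '' puncturedDisc R ⊆ regularPart F Ω := h.lift.mapsTo.image_subset

lemma IsRingChart.isOpen_image (hF : IsMeromorphicFunOn F Ω) (h : IsRingChart F Ω p n R φ) :
    IsOpen (φ '' puncturedDisc R) :=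
  h.lift.isOpen_image (isLocalHomeomorphOn_regularPart hF) h.order_ne (isOpen_puncturedDisc R)
    (zero_notMem_puncturedDisc R)

/-- The rotations by the roots of unity act freely on the lifts, so the maximal lift is
injective. -/
lemma IsRingChart.injOn (hF : IsMeromorphicFunOn F Ω) (h : IsRingChart F Ω p n R φ) :
    Set.InjOn φ (puncturedDisc R) := by
  intro z₁ hz₁ z₂ hz₂ heq
  have hpow : z₁ ^ n = z₂ ^ n := by
    rw [← h.lift.comp_eq z₁ hz₁, heq, h.lift.comp_eq z₂ hz₂]
  -- `φ (ω z)` is the lift `φ z`, and near `0` both are values of the injective germ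
  set ω := z₂ / z₁ with hω
  have hz₂ω : z₂ = ω * z₁ := by rw [hω]; field_simp [hz₁.1]
  have hωn : ω ^ n = 1 := by
    rw [hω, div_pow, hpow, div_self (pow_ne_zero n hz₂.1)]
  have hωnorm : ‖ω‖ = 1 := Complex.norm_eq_one_of_pow_eq_one hωn h.order_ne
  have hω0 : ω ≠ 0 := norm_ne_zero_iff.1 (by rw [hωnorm]; exact one_ne_zero)
  have hmaps : ∀ z ∈ puncturedDisc R, ω * z ∈ puncturedDisc R := fun z hz =>
    ⟨mul_ne_zero hω0 hz.1, by rw [norm_mul, hωnorm, one_mul]; exact hz.2⟩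
  have hψ : IsRootLift F (regularPart F Ω) n (fun z => φ (ω * z)) (puncturedDisc R) := by
    refine ⟨h.lift.continuousOn.comp (by fun_prop) hmaps, fun z hz => h.lift.mapsTo (hmaps z hz),
      fun z hz => ?_⟩
    rw [h.lift.comp_eq _ (hmaps z hz), mul_pow, hωn, one_mul]
  have hEq := h.lift.eqOn (isLocalHomeomorphOn_regularPart hF) hψ (isPreconnected_puncturedDisc R)
    hz₁ (by rw [heq, hz₂ω])
  obtain ⟨e, he, hφ⟩ := h.germ
  have ht : Tendsto (fun z : ℂ => ω * z) (𝓝 0) (𝓝 0) := by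
    have : Continuous fun z : ℂ => ω * z := by fun_prop
    simpa using this.tendsto 0
  have hsrc : ∀ᶠ z in 𝓝 (0 : ℂ), z ∈ e.source := e.open_source.mem_nhds he.zero_mem
  have hev : ∀ᶠ z in 𝓝[≠] (0 : ℂ), (φ z = e z ∧ φ (ω * z) = e (ω * z)) ∧
      z ∈ e.source ∧ ω * z ∈ e.source :=
    (((hφ : ∀ᶠ z in 𝓝 0, φ z = e z).and (ht.eventually hφ)).and
      (hsrc.and (ht.eventually hsrc))).filter_mono nhdsWithin_le_nhds
  obtain ⟨z, ⟨⟨h1, h2⟩, h3, h4⟩, hz⟩ := (hev.and (puncturedDisc_mem_nhdsNE h.pos)).exists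
  have h5 : z = ω * z := e.injOn h3 h4 (by rw [← h1, ← h2]; exact hEq hz)
  have h6 : ω = 1 := mul_right_cancel₀ hz.1 (by rw [one_mul]; exact h5.symm)
  rw [hz₂ω, h6, one_mul]

lemma IsRingChart.center_notMem (hF : IsMeromorphicFunOn F Ω) (h : IsRingChart F Ω p n R φ) :
    p ∉ regularPart F Ω := fun hp => ((mem_regularPart_iff hF).1 hp).2.1 h.map_center

lemma IsRingChart.isOpen_insert (hF : IsMeromorphicFunOn F Ω) (h : IsRingChart F Ω p n R φ) :
    IsOpen (insert p (φ '' puncturedDisc R)) := by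
  rw [isOpen_iff_mem_nhds]
  rintro x (rfl | hx)
  · obtain ⟨e, he, hφ⟩ := h.germ
    rw [← he.map_zero, ← e.map_nhds_eq he.zero_mem, mem_map]
    filter_upwards [hφ, ball_mem_nhds (0 : ℂ) h.pos] with z hz1 hz2
    by_cases h0 : z = 0
    · left; rw [h0]
    · exact Or.inr ⟨z, ⟨h0, by simpa using hz2⟩, hz1⟩
  · exact mem_of_superset ((h.isOpen_image hF).mem_nhds hx) (Set.subset_insert _ _)

lemma IsRingChart.norm_lt (h : IsRingChart F Ω p n R φ) {x : OnePoint ℂ}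
    (hx : x ∈ φ '' puncturedDisc R) : ‖F x‖ < R ^ n := by
  obtain ⟨z, hz, rfl⟩ := hx
  rw [h.lift.comp_eq z hz, norm_pow]
  exact pow_lt_pow_left₀ hz.2 (norm_nonneg z) h.order_ne

lemma IsRingChart.mem_or_of_mem_closure (hF : IsMeromorphicFunOn F Ω)
    (h : IsRingChart F Ω p n R φ) {q : OnePoint ℂ} (hq : q ∈ closure (φ '' puncturedDisc R))
    (hqΩ : q ∈ Ω) : q ∈ φ '' puncturedDisc R ∨ q = p ∨ ‖F q‖ = R ^ n := by
  by_cases hqp : q = p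
  · exact Or.inr (Or.inl hqp)
  obtain ⟨-, ζ, -, hζ, hFζ, hmem⟩ := h.lift.mem_closure_image hF h.order_ne h.continuousAt_zero
    h.map_zero hq hqΩ hqp
  rcases hζ.lt_or_eq with h1 | h1
  · exact Or.inl (hmem h1)
  · right; right
    rw [hFζ, norm_pow, h1]

/-- The maximality of the ring domain: it absorbs every connected set of regular points that meets
it and is covered by closed trajectories. -/
lemma IsRingChart.subset_of_trajectories (hΩ : IsOpen Ω) (hF : IsMeromorphicFunOn F Ω)
    (h : IsRingChart F Ω p n R φ) {U : Set (OnePoint ℂ)} (hU : IsPreconnected U)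
    (hUM : U ⊆ regularPart F Ω)
    (htraj : ∀ x ∈ U, ∃ γ : Circle → OnePoint ℂ, IsClosedTrajectory F Ω γ ∧ x ∈ Set.range γ)
    (hne : (U ∩ φ '' puncturedDisc R).Nonempty) : U ⊆ φ '' puncturedDisc R := by
  refine hU.subset_of_closure_inter_subset (h.isOpen_image hF) hne ?_
  rintro q ⟨hq, hqU⟩
  by_contra hnot
  have hqp : q ≠ p := fun h' => h.center_notMem hF (h' ▸ hUM hqU)
  obtain ⟨-, ζ, hc, hζ, -, hmem⟩ := h.lift.mem_closure_image hF h.order_ne h.continuousAt_zero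
    h.map_zero hq (hUM hqU).1 hqp
  have hζR : ‖ζ‖ = R := hζ.eq_of_not_lt fun h' => hnot (hmem h')
  obtain ⟨γ, hγ, hqγ⟩ := htraj q hqU
  obtain ⟨R', hR', φ', hφ', heq⟩ := h.lift.exists_extension (isLocalHomeomorphOn_regularPart hF)
    (isOpen_regularPart hΩ hF) h.pos (isCompact_range hγ.continuous)
    (by rintro _ ⟨θ, rfl⟩; exact hγ.regular θ) (hγ.eventually_mem_range hF) hζR hqγ hc
  exact h.maximal R' hR' ⟨φ', hφ', heq⟩

/-- On the whole sphere the boundary level of a ring domain carries a zero of `d ln F`. -/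
lemma IsRingChart.exists_isDlogZero {F : OnePoint ℂ → ℂ}
    (hF : IsMeromorphicFunOn F Set.univ)
    (hfin : ∀ x, meromorphicOrderAt (dlogCoeff F x) 0 ≠ ⊤)
    (h : IsRingChart F Set.univ p n R φ) : ∃ x, IsDlogZero F x ∧ ‖F x‖ = R ^ n := by
  by_contra! hno
  have hRn : 0 < R ^ n := pow_pos h.pos n
  set K : Set (OnePoint ℂ) := {x | ‖F x‖ = R ^ n} with hK
  have hKM : K ⊆ regularPart F Set.univ := by
    intro x hx
    by_contra hxn
    have hx0 : F x ≠ 0 := norm_ne_zero_iff.1 (by rw [show ‖F x‖ = R ^ n from hx]; exact hRn.ne')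
    exact hno x ((isDlogZero_iff hF (Set.mem_univ x) (hfin x)).2 ⟨hx0, hxn⟩) hx
  have hKc : IsCompact K := by
    refine IsClosed.isCompact (isOpen_compl_iff.1 (isOpen_iff_mem_nhds.2 fun x hx => ?_))
    have hx : ‖F x‖ ≠ R ^ n := hx
    by_cases h0 : F x = 0
    · rcases tendsto_of_eq_zero hF (Set.mem_univ x) h0 with h1 | h1
      · have h2 := h1.norm
        rw [norm_zero] at h2
        filter_upwards [h2.eventually_lt_const hRn] with y hy
        exact hy.ne
      · rw [← tendsto_norm_atTop_iff_cobounded] at h1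
        have h2 := h1.eventually (eventually_gt_atTop (R ^ n))
        rw [eventually_nhdsWithin_iff] at h2
        filter_upwards [h2] with y hy
        by_cases hyx : y = x
        · rw [hyx]; exact hx
        · exact (hy hyx).ne'
    · exact (continuousAt_of_ne_zero hF (Set.mem_univ x) h0).norm.eventually_ne hx
  -- the lift accumulates at some point over `R`
  have hclosed : IsClosed (Prod.fst '' closure (liftGraph φ R)) :=
    isClosedMap_fst_of_compactSpace _ isClosed_closure
  have hsub : closure (puncturedDisc R) ⊆ Prod.fst '' closure (liftGraph φ R) :=
    closure_minimal (fun z hz => ⟨(z, φ z), subset_closure ⟨z, hz, rfl⟩, rfl⟩) hclosed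
  have hRmem : (R : ℂ) ∈ closure (puncturedDisc R) := by
    have h1 : (R : ℂ) ∈ {0}ᶜ ∩ closure (ball (0 : ℂ) R) := by
      refine ⟨by simpa using h.pos.ne', ?_⟩
      rw [closure_ball _ h.pos.ne']
      simp [abs_of_pos h.pos]
    refine closure_mono ?_ (isOpen_compl_singleton.inter_closure h1)
    rintro z ⟨hz1, hz2⟩
    exact ⟨hz1, by simpa using hz2⟩
  obtain ⟨⟨ζ, q⟩, hc, hζ⟩ := hsub hRmem
  have hζ : ζ = R := hζ
  have hζR : ‖ζ‖ = R := by rw [hζ]; simp [abs_of_pos h.pos]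
  have hqcl : q ∈ closure (φ '' puncturedDisc R) := by
    have := image_closure_subset_closure_image (continuous_snd (X := ℂ) (Y := OnePoint ℂ))
      ⟨(ζ, q), hc, rfl⟩
    refine closure_mono ?_ this
    rintro _ ⟨_, ⟨z, hz, rfl⟩, rfl⟩
    exact ⟨z, hz, rfl⟩
  have hqp : q ≠ p := by
    rintro rfl
    have := comp_eq_of_mem_closure_liftGraph h.lift h.continuousAt_center hc
    rw [h.map_center] at this
    have h0 := pow_eq_zero_iff h.order_ne |>.1 this.symm
    rw [h0, norm_zero] at hζR
    exact h.pos.ne hζR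
  have hFq := (h.lift.mem_closure_image hF h.order_ne h.continuousAt_zero
    h.map_zero hqcl (Set.mem_univ q) hqp).1
  have hqK : q ∈ K := by
    have := comp_eq_of_mem_closure_liftGraph h.lift
      (continuousAt_of_ne_zero hF (Set.mem_univ q) hFq) hc
    change ‖F q‖ = R ^ n
    rw [this, norm_pow, hζR]
  obtain ⟨R', hR', φ', hφ', heq⟩ := h.lift.exists_extension (isLocalHomeomorphOn_regularPart hF)
    (isOpen_regularPart isOpen_univ hF) h.pos hKc hKM
    (fun q hq => Eventually.of_forall fun x hx => by
      change ‖F x‖ = R ^ n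
      rw [hx]; exact hq) hζR hqK hc
  exact h.maximal R' hR' ⟨φ', hφ', heq⟩

end RingChart

/-! ### The ring domain is foliated by closed trajectories -/

section Foliation

open Metric unitInterval

variable {F : OnePoint ℂ → ℂ} {Ω : Set (OnePoint ℂ)} {p : OnePoint ℂ} {n : ℕ} {R : ℝ}
  {φ : ℂ → OnePoint ℂ}

lemma mul_circle_mem_puncturedDisc {z : ℂ} {r : ℝ} (hz : z ∈ puncturedDisc r) (θ : Circle) :
    z * θ ∈ puncturedDisc r :=
  ⟨mul_ne_zero hz.1 θ.coe_ne_zero, by rw [norm_mul, Circle.norm_coe, mul_one]; exact hz.2⟩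

lemma IsRingChart.isClosedTrajectory (hF : IsMeromorphicFunOn F Ω) (h : IsRingChart F Ω p n R φ)
    {z : ℂ} (hz : z ∈ puncturedDisc R) : IsClosedTrajectory F Ω (fun θ : Circle => φ (z * θ)) where
  continuous := h.lift.continuousOn.comp_continuous (by fun_prop)
    (fun θ => mul_circle_mem_puncturedDisc hz θ)
  injective := by
    intro θ θ' hθ
    have := h.injOn hF (mul_circle_mem_puncturedDisc hz θ) (mul_circle_mem_puncturedDisc hz θ') hθ
    exact Subtype.ext (mul_left_cancel₀ hz.1 this)
  regular := fun θ => h.lift.mapsTo (mul_circle_mem_puncturedDisc hz θ)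
  const := by
    refine ⟨Real.log (‖z‖ ^ n), fun θ => ?_⟩
    rw [h.lift.comp_eq _ (mul_circle_mem_puncturedDisc hz θ), norm_pow, norm_mul, Circle.norm_coe,
      mul_one]

/-- Loops in the ring domain are homotopic as soon as their coordinates are homotopic in the
punctured disc. -/
lemma IsRingChart.homotopic (h : IsRingChart F Ω p n R φ) {f₀ f₁ : C(Circle, φ '' puncturedDisc R)}
    {H : I × Circle → ℂ} (hH : Continuous H) (hm : ∀ a, H a ∈ puncturedDisc R)
    (h0 : ∀ θ, (f₀ θ : OnePoint ℂ) = φ (H (0, θ))) (h1 : ∀ θ, (f₁ θ : OnePoint ℂ) = φ (H (1, θ))) :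
    ContinuousMap.Homotopic f₀ f₁ :=
  ⟨{ toFun := fun a => ⟨φ (H a), H a, hm a, rfl⟩
     continuous_toFun := (h.lift.continuousOn.comp_continuous hH hm).subtype_mk _
     map_zero_left := fun θ => Subtype.ext (h0 θ).symm
     map_one_left := fun θ => Subtype.ext (h1 θ).symm }⟩

/-- The image of the circle through `z` around the origin. -/
def IsRingChart.circleMap (h : IsRingChart F Ω p n R φ) {z : ℂ} (hz : z ∈ puncturedDisc R) :
    C(Circle, φ '' puncturedDisc R) where
  toFun θ := ⟨φ (z * θ), z * θ, mul_circle_mem_puncturedDisc hz θ, rfl⟩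
  continuous_toFun := (h.lift.continuousOn.comp_continuous (by fun_prop)
    (fun θ => mul_circle_mem_puncturedDisc hz θ)).subtype_mk _

lemma IsRingChart.circleMap_homotopic (h : IsRingChart F Ω p n R φ) {z w : ℂ}
    (hz : z ∈ puncturedDisc R) (hw : w ∈ puncturedDisc R) :
    ContinuousMap.Homotopic (h.circleMap hz) (h.circleMap hw) := by
  have hz' := hz
  have hw' := hw
  rw [puncturedDisc_eq_image_exp h.pos] at hz' hw'
  obtain ⟨a, ha, rfl⟩ := hz'
  obtain ⟨b, hb, rfl⟩ := hw'
  refine h.homotopic (H := fun x => Complex.exp ((1 - (x.1 : ℝ) : ℝ) * a + ((x.1 : ℝ) : ℝ) * b) * x.2)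
    (by fun_prop) (fun x => mul_circle_mem_puncturedDisc ?_ x.2) (fun θ => ?_) (fun θ => ?_)
  · rw [puncturedDisc_eq_image_exp h.pos]
    refine ⟨_, ?_, rfl⟩
    have := (convex_halfSpace_re_lt (Real.log R)) ha hb (a := 1 - (x.1 : ℝ)) (b := x.1)
      (by linarith [x.1.2.2]) x.1.2.1 (by ring)
    simpa using this
  · simp [IsRingChart.circleMap]
  · simp [IsRingChart.circleMap]

/-- The small circles around `p` lie in the ring domain and are homotopic to the closed
trajectories. -/
lemma IsRingChart.eventually_homotopic (h : IsRingChart F Ω p n R φ) {z : ℂ}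
    (hz : z ∈ puncturedDisc R) :
    ∀ᶠ ε : ℝ in 𝓝[>] 0, ∃ κ : C(Circle, φ '' puncturedDisc R),
      (∀ θ : Circle, (κ θ : OnePoint ℂ) = sphereParam p ((ε : ℂ) * (θ : ℂ))) ∧
      ContinuousMap.Homotopic (h.circleMap hz) κ := by
  obtain ⟨e, he, hφ⟩ := h.germ
  obtain ⟨u, hu, hu0, hue⟩ := he.param
  set C := ‖u 0‖ + 1 with hC
  have hCpos : 0 < C := by positivity
  have ht : Tendsto (fun t => t * u t) (𝓝 0) (𝓝 0) := by
    have h1 : Tendsto (fun t : ℂ => t * u t) (𝓝 0) (𝓝 (0 * u 0)) :=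
      (tendsto_id (α := ℂ)).mul hu.continuousAt
    rwa [zero_mul] at h1
  have hev : ∀ᶠ t in 𝓝 (0 : ℂ), (ContinuousAt u t ∧ u t ≠ 0) ∧ ‖u t‖ < C ∧
      sphereParam p t = φ (t * u t) := by
    filter_upwards [hu.eventually_continuousAt, hu.continuousAt.eventually_ne hu0, hue,
      ht.eventually hφ, hu.continuousAt.norm.eventually_lt_const
        (by rw [hC]; linarith : ‖u 0‖ < C)] with t h1 h2 h3 h4 h5
    exact ⟨⟨h1, h2⟩, h5, h3.trans h4.symm⟩
  obtain ⟨δ, hδ, hball⟩ := Metric.eventually_nhds_iff_ball.1 hev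
  have hpos : 0 < min δ (R / C) := lt_min hδ (div_pos h.pos hCpos)
  filter_upwards [Ioo_mem_nhdsGT hpos] with ε hε
  have hε0 : (ε : ℂ) ≠ 0 := by exact_mod_cast hε.1.ne'
  have hnorm : ∀ (s : I) (θ : Circle), (s : ℝ) * (ε * (θ : ℂ)) ∈ ball (0 : ℂ) δ := by
    intro s θ
    rw [mem_ball_zero_iff, norm_mul, norm_mul, Circle.norm_coe, mul_one, Complex.norm_real,
      Complex.norm_real, Real.norm_of_nonneg s.2.1, Real.norm_of_nonneg hε.1.le]
    calc (s : ℝ) * ε ≤ 1 * ε := by gcongr; exacts [hε.1.le, s.2.2]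
      _ < δ := by rw [one_mul]; exact hε.2.trans_le (min_le_left _ _)
  -- `ε θ u(s ε θ)` joins the coordinates of the small circle to a round circle
  set H' : I × Circle → ℂ := fun x => ε * u ((x.1 : ℝ) * (ε * (x.2 : ℂ))) * x.2 with hH'
  have hcont : Continuous H' := by
    have h1 : Continuous fun x : I × Circle => u ((x.1 : ℝ) * (ε * (x.2 : ℂ))) := by
      rw [continuous_iff_continuousAt]
      intro x
      exact ContinuousAt.comp (g := u) (f := fun x : I × Circle => ((x.1 : ℝ) * (ε * (x.2 : ℂ)) : ℂ))
        (hball _ (hnorm x.1 x.2)).1.1 (by fun_prop)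
    exact (continuous_const.mul h1).mul (by fun_prop)
  have hmem : ∀ x, H' x ∈ puncturedDisc R := by
    rintro ⟨s, θ⟩
    obtain ⟨⟨-, h2⟩, h3, -⟩ := hball _ (hnorm s θ)
    refine mul_circle_mem_puncturedDisc ⟨mul_ne_zero hε0 h2, ?_⟩ θ
    rw [norm_mul, Complex.norm_real, Real.norm_of_nonneg hε.1.le]
    calc ε * ‖u ((s : ℝ) * (ε * (θ : ℂ)))‖ ≤ ε * C := by gcongr; exact hε.1.le
      _ < R / C * C := by gcongr; exact hε.2.trans_le (min_le_right _ _)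
      _ = R := by field_simp
  have hw : ε * u 0 ∈ puncturedDisc R := by
    have := hmem (0, 1)
    simpa [hH'] using this
  have hval : ∀ θ : Circle, sphereParam p (ε * θ) = φ (H' (1, θ)) := by
    intro θ
    have := (hball _ (hnorm 1 θ)).2.2
    simp only [Set.Icc.coe_one, Complex.ofReal_one, one_mul] at this
    rw [this]
    simp only [hH', Set.Icc.coe_one, Complex.ofReal_one, one_mul]
    congr 1
    ring
  refine ⟨⟨fun θ => ⟨sphereParam p (ε * θ), H' (1, θ), hmem _, (hval θ).symm⟩,
    ((continuous_sphereParam p).comp (by fun_prop)).subtype_mk _⟩, fun θ => rfl,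
    (h.circleMap_homotopic hz hw).trans (h.homotopic hcont hmem (fun θ => ?_) (fun θ => hval θ))⟩
  simp [IsRingChart.circleMap, hH']

lemma IsRingChart.isFoliatedAround (hF : IsMeromorphicFunOn F Ω) (h : IsRingChart F Ω p n R φ) :
    IsFoliatedAround F Ω p (φ '' puncturedDisc R) where
  isOpen := h.isOpen_image hF
  connected := by
    refine ⟨⟨φ ((R / 2 : ℝ) : ℂ), _, ⟨?_, ?_⟩, rfl⟩,
      (isPreconnected_puncturedDisc R).image _ h.lift.continuousOn⟩
    · have := h.pos
      exact_mod_cast (by positivity : R / 2 ≠ 0)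
    · have := h.pos
      rw [Complex.norm_real, Real.norm_of_nonneg (by positivity)]
      linarith
  regular := h.image_subset
  foliated := by
    rintro _ ⟨z, hz, rfl⟩
    exact ⟨h.circleMap hz, h.isClosedTrajectory hF hz, ⟨1, by simp [IsRingChart.circleMap]⟩,
      h.eventually_homotopic hz⟩

/-- The image of the maximal lift is the ring domain. -/
lemma IsRingChart.ringDomain_eq (hΩ : IsOpen Ω) (hF : IsMeromorphicFunOn F Ω)
    (h : IsRingChart F Ω p n R φ) : ringDomain F Ω p = φ '' puncturedDisc R := by
  apply le_antisymm
  · refine Set.sUnion_subset fun U hU => ?_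
    have hU : IsFoliatedAround F Ω p U := hU
    refine h.subset_of_trajectories hΩ hF hU.connected.isPreconnected hU.regular ?_ ?_
    · intro x hx
      obtain ⟨γ, hγ, hγx, -⟩ := hU.foliated x hx
      exact ⟨_, hγ, hγx⟩
    -- `U` contains small circles around `p`, and so does the image of the lift
    · obtain ⟨x, hx⟩ := hU.connected.nonempty
      obtain ⟨_, _, _, hev⟩ := hU.foliated x hx
      have hz : ((R / 2 : ℝ) : ℂ) ∈ puncturedDisc R := by
        have := h.pos
        refine ⟨by exact_mod_cast (by positivity : R / 2 ≠ 0), ?_⟩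
        rw [Complex.norm_real, Real.norm_of_nonneg (by positivity)]
        linarith
      obtain ⟨ε, ⟨κ, hκ, -⟩, κ', hκ', -⟩ := (hev.and (h.eventually_homotopic hz)).exists
      exact ⟨κ 1, (κ 1).2, by rw [hκ 1, ← hκ' 1]; exact (κ' 1).2⟩
  · exact Set.subset_sUnion_of_mem (h.isFoliatedAround hF)

end Foliation

/-! ### The ring domain is a semi-infinite cylinder -/

section Cylinder

open Metric

/-- The direction of a non-zero complex number. -/
def circleDir (z : ℂ) (hz : z ≠ 0) : Circle :=
  ⟨z / ‖z‖, mem_sphere_zero_iff_norm.2 (by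
    rw [norm_div, Complex.norm_real, norm_norm, div_self (norm_ne_zero_iff.2 hz)])⟩

lemma coe_circleDir (z : ℂ) (hz : z ≠ 0) : (circleDir z hz : ℂ) = z / ‖z‖ := rfl

/-- Polar coordinates: the cylinder of perimeter `L` is mapped onto the punctured disc of radius `R`
by `(s, τ) ↦ R exp (2π (-τ + i s) / L)`. -/
def polarHomeomorph {R L : ℝ} (hR : 0 < R) (hL : 0 < L) :
    AddCircle L × Set.Ioi (0 : ℝ) ≃ₜ puncturedDisc R where
  toFun y := ⟨(R * Real.exp (-(2 * Real.pi / L * y.2)) : ℝ) * AddCircle.toCircle y.1, by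
    refine mul_circle_mem_puncturedDisc ⟨?_, ?_⟩ _
    · exact_mod_cast (mul_pos hR (Real.exp_pos _)).ne'
    · rw [Complex.norm_real, Real.norm_of_nonneg (by positivity)]
      have h1 : Real.exp (-(2 * Real.pi / L * y.2)) < 1 := by
        rw [Real.exp_lt_one_iff, neg_lt_zero]
        exact mul_pos (by positivity) y.2.2
      nlinarith⟩
  invFun z := ((AddCircle.homeomorphCircle hL.ne').symm
      (circleDir z (mem_puncturedDisc.1 z.2).1),
    ⟨L / (2 * Real.pi) * Real.log (R / ‖(z : ℂ)‖), by
      have h1 : 0 < ‖(z : ℂ)‖ := norm_pos_iff.2 (mem_puncturedDisc.1 z.2).1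
      refine mul_pos (by positivity) (Real.log_pos ?_)
      rw [one_lt_div h1]
      exact (mem_puncturedDisc.1 z.2).2⟩)
  left_inv := by
    rintro ⟨s, τ, hτ⟩
    have hpos : 0 < R * Real.exp (-(2 * Real.pi / L * τ)) := mul_pos hR (Real.exp_pos _)
    have hnorm : ‖((R * Real.exp (-(2 * Real.pi / L * τ)) : ℝ) : ℂ) * AddCircle.toCircle s‖ =
        R * Real.exp (-(2 * Real.pi / L * τ)) := by
      rw [norm_mul, Circle.norm_coe, mul_one, Complex.norm_real, Real.norm_of_nonneg hpos.le]
    refine Prod.ext ?_ (Subtype.ext ?_)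
    · refine (Homeomorph.symm_apply_eq _).2 ?_
      rw [AddCircle.homeomorphCircle_apply]
      refine Subtype.ext ?_
      simp only [coe_circleDir, hnorm]
      have : ((R * Real.exp (-(2 * Real.pi / L * τ)) : ℝ) : ℂ) ≠ 0 := by exact_mod_cast hpos.ne'
      exact mul_div_cancel_left₀ _ this
    · simp only [hnorm]
      rw [div_mul_cancel_left₀ hR.ne', ← Real.exp_neg, Real.log_exp]
      have := Real.pi_pos
      field_simp
  right_inv := by
    rintro ⟨z, hz⟩
    have h1 : 0 < ‖z‖ := norm_pos_iff.2 hz.1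
    have h2 : (‖z‖ : ℂ) ≠ 0 := by exact_mod_cast h1.ne'
    refine Subtype.ext ?_
    simp only
    rw [← AddCircle.homeomorphCircle_apply hL.ne', Homeomorph.apply_symm_apply, coe_circleDir]
    have h3 : 2 * Real.pi / L * (L / (2 * Real.pi) * Real.log (R / ‖z‖)) = Real.log (R / ‖z‖) := by
      have := Real.pi_pos
      field_simp
    rw [h3, ← Real.log_inv, Real.exp_log (by positivity)]
    have h4 : R * (R / ‖z‖)⁻¹ = ‖z‖ := by field_simp
    rw [h4]
    field_simp
  continuous_toFun := by
    refine Continuous.subtype_mk ?_ _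
    have := AddCircle.continuous_toCircle (T := L)
    fun_prop
  continuous_invFun := by
    have hne : ∀ z : puncturedDisc R, ‖(z : ℂ)‖ ≠ 0 := fun z => norm_ne_zero_iff.2 z.2.1
    refine Continuous.prodMk ?_ ?_
    · refine (Homeomorph.continuous _).comp (Continuous.subtype_mk ?_ _)
      refine continuous_subtype_val.div (by fun_prop) fun z => ?_
      exact_mod_cast hne z
    · refine Continuous.subtype_mk ?_ _
      refine continuous_const.mul (Continuous.log ?_ fun z => ?_)
      · exact continuous_const.div (by fun_prop) hne
      · exact div_ne_zero hR.ne' (hne z)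

lemma norm_polarHomeomorph {R L : ℝ} (hR : 0 < R) (hL : 0 < L)
    (y : AddCircle L × Set.Ioi (0 : ℝ)) :
    ‖(polarHomeomorph hR hL y : ℂ)‖ = R * Real.exp (-(2 * Real.pi / L * y.2)) := by
  have hpos : 0 < R * Real.exp (-(2 * Real.pi / L * (y.2 : ℝ))) := mul_pos hR (Real.exp_pos _)
  change ‖((R * Real.exp (-(2 * Real.pi / L * y.2)) : ℝ) : ℂ) * AddCircle.toCircle y.1‖ = _
  rw [norm_mul, Circle.norm_coe, mul_one, Complex.norm_real, Real.norm_of_nonneg hpos.le]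

lemma polarHomeomorph_mk {R L : ℝ} (hR : 0 < R) (hL : 0 < L) (s : ℝ) (τ : Set.Ioi (0 : ℝ)) :
    (polarHomeomorph hR hL ((s : AddCircle L), τ) : ℂ) =
      R * Complex.exp (2 * Real.pi / L * (-(τ : ℝ) + s * Complex.I)) := by
  change ((R * Real.exp (-(2 * Real.pi / L * τ)) : ℝ) : ℂ) * AddCircle.toCircle (s : AddCircle L) = _
  rw [AddCircle.toCircle_apply_mk, Circle.coe_exp]
  push_cast
  rw [mul_assoc, ← Complex.exp_add]
  congr 2
  ring

variable {F : OnePoint ℂ → ℂ} {Ω : Set (OnePoint ℂ)} {p : OnePoint ℂ} {n : ℕ} {R : ℝ}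
  {φ : ℂ → OnePoint ℂ}

/-- A ring domain, with a metric that is a constant multiple `l ^ 2` of `|d ln F| ^ 2`, is a
semi-infinite cylinder: `ln F = n ln z` is linear in the polar coordinates of the disc. -/
lemma IsRingChart.isSemiInfiniteCylinder (hF : IsMeromorphicFunOn F Ω)
    (h : IsRingChart F Ω p n R φ) {g : OnePoint ℂ → ℂ → ℝ} {l L : ℝ} (hl : 0 < l)
    (hL : L = l * (2 * Real.pi * n))
    (hg : ∀ x ∈ regularPart F Ω, ∀ v, g x v = l ^ 2 * flatMetric F x v) :
    IsSemiInfiniteCylinder g p L (φ '' puncturedDisc R) := by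
  have hn : (0 : ℝ) < n := by exact_mod_cast Nat.pos_of_ne_zero h.order_ne
  have hLpos : 0 < L := by rw [hL]; positivity
  refine ⟨hLpos, ?_⟩
  have hemb : IsOpenEmbedding fun z : puncturedDisc R => φ z := by
    refine IsOpenEmbedding.of_continuous_injective_isOpenMap
      (continuousOn_iff_continuous_domRestrict.1 h.lift.continuousOn)
      (fun z w hzw => Subtype.ext (h.injOn hF z.2 w.2 hzw)) ?_
    intro V hV
    obtain ⟨O, hO, rfl⟩ := isOpen_induced_iff.1 hV
    have h1 := (h.lift.mono (Set.inter_subset_right (s := O))).isOpen_image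
      (isLocalHomeomorphOn_regularPart hF) h.order_ne (hO.inter (isOpen_puncturedDisc R))
      (fun h0 => zero_notMem_puncturedDisc R h0.2)
    convert h1 using 1
    ext x
    constructor
    · rintro ⟨z, hz, rfl⟩
      exact ⟨z, ⟨hz, z.2⟩, rfl⟩
    · rintro ⟨z, hz, rfl⟩
      exact ⟨⟨z, hz.2⟩, hz.1, rfl⟩
  have hrange : Set.range (fun z : puncturedDisc R => φ z) = φ '' puncturedDisc R := by
    ext x
    constructor
    · rintro ⟨z, rfl⟩
      exact ⟨z, z.2, rfl⟩
    · rintro ⟨z, hz, rfl⟩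
      exact ⟨⟨z, hz⟩, rfl⟩
  let P := polarHomeomorph (L := L) h.pos hLpos
  let Φ : AddCircle L × Set.Ioi (0 : ℝ) ≃ₜ φ '' puncturedDisc R :=
    P.trans (hemb.isEmbedding.toHomeomorph.trans (Homeomorph.setCongr hrange))
  have hΦ : ∀ y, (Φ y : OnePoint ℂ) = φ (P y) := fun y => rfl
  refine ⟨Φ, ?_, ?_⟩
  · have h1 : Tendsto (fun y : AddCircle L × Set.Ioi (0 : ℝ) => (P y : ℂ))
        (comap (fun y : AddCircle L × Set.Ioi (0 : ℝ) => (y.2 : ℝ)) atTop) (𝓝 0) := by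
      rw [tendsto_zero_iff_norm_tendsto_zero]
      simp only [P, norm_polarHomeomorph]
      have h2 : Tendsto (fun τ : ℝ => R * Real.exp (-(2 * Real.pi / L * τ))) atTop (𝓝 (R * 0)) := by
        refine Tendsto.const_mul R (Real.tendsto_exp_neg_atTop_nhds_zero.comp ?_)
        exact tendsto_id.const_mul_atTop (by positivity)
      rw [mul_zero] at h2
      exact h2.comp tendsto_comap
    have h2 := h.continuousAt_zero
    unfold ContinuousAt at h2
    rw [h.map_zero] at h2
    exact h2.comp h1
  · intro s τ
    set q : OnePoint ℂ := (Φ ((s : AddCircle L), τ)).1 with hq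
    have hqM : q ∈ regularPart F Ω := h.image_subset (Φ ((s : AddCircle L), τ)).2
    obtain ⟨hqΩ, hq0, hqd⟩ := (mem_regularPart_iff hF).1 hqM
    have ha := analyticAt_localRep_zero hF hqΩ hq0
    have hs : HasStrictDerivAt (localRep F q) (deriv (localRep F q) 0) 0 := ha.hasStrictDerivAt
    let E := (hs.hasStrictFDerivAt_equiv hqd).toOpenPartialHomeomorph (localRep F q)
    have hE0 : (0 : ℂ) ∈ E.source := HasStrictFDerivAt.mem_toOpenPartialHomeomorph_source _
    have hEcoe : ∀ t, E t = localRep F q t := fun t => rfl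
    have hE00 : E 0 = F q := localRep_zero F q
    have hsymm0 : E.symm (F q) = 0 := by rw [← hE00]; exact E.left_inv hE0
    have htgt : F q ∈ E.target := hE00 ▸ E.map_source hE0
    -- `F` along the cylinder, in the coordinates `(s, τ)`
    set val : ℝ × ℝ → ℂ := fun y =>
      (R : ℂ) ^ n * Complex.exp ((1 / l : ℝ) * (-(y.2 : ℂ) + y.1 * Complex.I)) with hval
    have hPval : ∀ (y : ℝ × ℝ) (hy : 0 < y.2),
        F (Φ ((y.1 : AddCircle L), ⟨y.2, hy⟩)) = val y := by
      intro y hy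
      have hlC : (l : ℂ) ≠ 0 := by exact_mod_cast hl.ne'
      have hnC : (n : ℂ) ≠ 0 := by exact_mod_cast h.order_ne
      have hpiC : (Real.pi : ℂ) ≠ 0 := by exact_mod_cast Real.pi_ne_zero
      rw [hΦ, h.lift.comp_eq _ (P _).2]
      simp only [P, polarHomeomorph_mk]
      rw [hval, mul_pow, ← Complex.exp_nat_mul]
      congr 2
      rw [hL]
      push_cast
      field_simp
    have hvalq : val (s, (τ : ℝ)) = F q := (hPval (s, (τ : ℝ)) τ.2).symm
    have hvald : HasFDerivAt val ((F q * (1 / l : ℝ)) • (-(Complex.ofRealCLM.comp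
        (ContinuousLinearMap.snd ℝ ℝ ℝ)) + (Complex.ofRealCLM.comp
        (ContinuousLinearMap.fst ℝ ℝ ℝ)).smulRight Complex.I)) (s, (τ : ℝ)) := by
      have h2 : HasFDerivAt (fun y : ℝ × ℝ => (y.2 : ℂ))
          (Complex.ofRealCLM.comp (ContinuousLinearMap.snd ℝ ℝ ℝ)) (s, (τ : ℝ)) :=
        (Complex.ofRealCLM.comp (ContinuousLinearMap.snd ℝ ℝ ℝ)).hasFDerivAt
      have h1 : HasFDerivAt (fun y : ℝ × ℝ => (y.1 : ℂ) * Complex.I)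
          ((Complex.ofRealCLM.comp (ContinuousLinearMap.fst ℝ ℝ ℝ)).smulRight Complex.I)
          (s, (τ : ℝ)) :=
        ((Complex.ofRealCLM.comp (ContinuousLinearMap.fst ℝ ℝ ℝ)).smulRight
          Complex.I).hasFDerivAt
      have h3 := (((h2.neg.add h1).const_mul ((1 / l : ℝ) : ℂ)).cexp).const_mul ((R : ℂ) ^ n)
      have h4 := hvalq
      rw [hval] at h4
      simp only at h4
      refine h3.congr_fderiv ?_
      rw [smul_smul, smul_smul, ← h4]
      rfl
    have hvalc : ContDiff ℝ ((⊤ : ℕ∞) : WithTop ℕ∞) val := by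
      have h1 : ContDiff ℝ ((⊤ : ℕ∞) : WithTop ℕ∞) fun y : ℝ × ℝ => (y.1 : ℂ) :=
        Complex.ofRealCLM.contDiff.comp contDiff_fst
      have h2 : ContDiff ℝ ((⊤ : ℕ∞) : WithTop ℕ∞) fun y : ℝ × ℝ => (y.2 : ℂ) :=
        Complex.ofRealCLM.contDiff.comp contDiff_snd
      exact contDiff_const.mul (contDiff_const.mul (h2.neg.add (h1.mul contDiff_const))).cexp
    have hsymmd : HasDerivAt E.symm (deriv (localRep F q) 0)⁻¹ (F q) := by
      refine E.hasDerivAt_symm htgt hqd ?_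
      rw [hsymm0]
      exact hs.hasDerivAt
    have hsymmc : ContDiffAt ℂ ((⊤ : ℕ∞) : WithTop ℕ∞) E.symm (F q) := by
      refine E.contDiffAt_symm_deriv hqd htgt ?_ ?_
      · rw [hsymm0]
        exact hs.hasDerivAt
      · rw [hsymm0]
        exact ha.contDiffAt
    refine ⟨fun y => E.symm (val y), ?_, ?_, ?_⟩
    · exact ContDiffAt.comp (g := E.symm) _ (by rw [hvalq]; exact hsymmc.restrict_scalars ℝ)
        hvalc.contDiffAt
    · have hpos : ∀ᶠ y : ℝ × ℝ in 𝓝 (s, (τ : ℝ)), 0 < y.2 :=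
        continuousAt_snd.eventually (lt_mem_nhds (show (0 : ℝ) < (s, (τ : ℝ)).2 from τ.2))
      -- points of the sphere close to `q` are recovered from the value of `F`
      have hnear : ∀ᶠ x in 𝓝 q, x = sphereParam q (E.symm (F x)) := by
        rw [← map_sphereParam_nhds q, eventually_map]
        filter_upwards [E.open_source.mem_nhds hE0] with t ht
        have : F (sphereParam q t) = E t := rfl
        rw [this, E.left_inv ht]
      have hcont : Tendsto (fun y : ℝ × ℝ => φ (R * Complex.exp (2 * Real.pi / L *
          (-(y.2 : ℂ) + y.1 * Complex.I)))) (𝓝 (s, (τ : ℝ))) (𝓝 q) := by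
        have h1 : φ (R * Complex.exp (2 * Real.pi / L * (-((τ : ℝ) : ℂ) + s * Complex.I))) = q := by
          rw [hq, hΦ]
          simp only [P, polarHomeomorph_mk]
        rw [← h1]
        refine ContinuousAt.comp (g := φ) (f := fun y : ℝ × ℝ => R * Complex.exp (2 * Real.pi / L *
          (-(y.2 : ℂ) + y.1 * Complex.I))) (x := (s, (τ : ℝ))) ?_ (by fun_prop)
        refine h.lift.continuousOn.continuousAt ((isOpen_puncturedDisc R).mem_nhds ?_)
        simp only
        rw [← polarHomeomorph_mk h.pos hLpos]
        exact (P _).2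
      filter_upwards [hpos, hcont.eventually hnear] with y hy hy2
      refine ⟨hy, ?_⟩
      have h3 : (Φ ((y.1 : AddCircle L), ⟨y.2, hy⟩) : OnePoint ℂ) =
          φ (R * Complex.exp (2 * Real.pi / L * (-(y.2 : ℂ) + y.1 * Complex.I))) := by
        rw [hΦ]
        simp only [P, polarHomeomorph_mk]
      rw [← hPval y hy, h3]
      exact hy2
    · intro v
      have hd : HasFDerivAt (fun y => E.symm (val y)) _ (s, (τ : ℝ)) :=
        HasDerivAt.comp_hasFDerivAt (h₂ := E.symm) (s, (τ : ℝ)) (by rw [hvalq]; exact hsymmd) hvald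
      rw [hd.fderiv, hg q hqM]
      unfold flatMetric
      rw [dlogCoeff_eq, logDeriv_apply, localRep_zero]
      have hl' : (l : ℂ) ≠ 0 := by exact_mod_cast hl.ne'
      have h4 : deriv (localRep F q) 0 / F q * (((deriv (localRep F q) 0)⁻¹ •
          ((F q * (1 / l : ℝ)) • (-(Complex.ofRealCLM.comp
          (ContinuousLinearMap.snd ℝ ℝ ℝ)) + (Complex.ofRealCLM.comp
          (ContinuousLinearMap.fst ℝ ℝ ℝ)).smulRight Complex.I))) v) =
          ((1 / l : ℝ) : ℂ) * (-(v.2 : ℂ) + v.1 * Complex.I) := by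
        simp
        field_simp
      rw [h4, norm_mul, mul_pow, Complex.norm_real, Real.norm_of_nonneg (by positivity),
        ← Complex.normSq_eq_norm_sq]
      simp [Complex.normSq_apply]
      field_simp
      ring

end Cylinder

/-! ### The symmetry between the zeros and the poles of `F` -/

section Inversion

variable {F : OnePoint ℂ → ℂ} {Ω : Set (OnePoint ℂ)} {p x : OnePoint ℂ}

lemma logDeriv_inv_apply (f : ℂ → ℂ) (t : ℂ) : logDeriv f⁻¹ t = -logDeriv f t := by
  by_cases h0 : f t = 0
  · simp [logDeriv_apply, h0]
  by_cases hd : DifferentiableAt ℂ f t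
  · rw [logDeriv_apply, logDeriv_apply, deriv_inv'' hd h0, Pi.inv_apply]
    field_simp
  · have hd' : ¬ DifferentiableAt ℂ f⁻¹ t := by
      intro h
      have := h.inv (by simpa using h0)
      rw [inv_inv] at this
      exact hd this
    rw [logDeriv_eq_zero_of_not_differentiableAt _ _ hd,
      logDeriv_eq_zero_of_not_differentiableAt _ _ hd', neg_zero]

lemma dlogCoeff_inv (F : OnePoint ℂ → ℂ) (x : OnePoint ℂ) : dlogCoeff F⁻¹ x = -dlogCoeff F x :=
  funext fun t => logDeriv_inv_apply (localRep F x) t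

lemma IsMeromorphicFunOn.inv (hF : IsMeromorphicFunOn F Ω) : IsMeromorphicFunOn F⁻¹ Ω :=
  fun x hx => (hF x hx).inv

lemma meromorphicOrderAt_dlogCoeff_inv (F : OnePoint ℂ → ℂ) (x : OnePoint ℂ) :
    meromorphicOrderAt (dlogCoeff F⁻¹ x) 0 = meromorphicOrderAt (dlogCoeff F x) 0 := by
  rw [dlogCoeff_inv]
  exact meromorphicOrderAt_neg.symm

lemma regularPart_inv (F : OnePoint ℂ → ℂ) (Ω : Set (OnePoint ℂ)) :
    regularPart F⁻¹ Ω = regularPart F Ω := by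
  simp only [regularPart, meromorphicOrderAt_dlogCoeff_inv]

lemma isDlogZero_inv : IsDlogZero F⁻¹ x ↔ IsDlogZero F x := by
  simp only [IsDlogZero, meromorphicOrderAt_dlogCoeff_inv]

lemma flatMetric_inv (F : OnePoint ℂ → ℂ) : flatMetric F⁻¹ = flatMetric F := by
  funext x v
  simp [flatMetric, dlogCoeff_inv]

lemma IsClosedTrajectory.inv {γ : Circle → OnePoint ℂ} (h : IsClosedTrajectory F Ω γ) :
    IsClosedTrajectory F⁻¹ Ω γ where
  continuous := h.continuous
  injective := h.injective
  regular := fun θ => by rw [regularPart_inv]; exact h.regular θ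
  const := by
    obtain ⟨k, hk⟩ := h.const
    refine ⟨-k, fun θ => ?_⟩
    rw [Pi.inv_apply, norm_inv, Real.log_inv, hk]

lemma IsFoliatedAround.inv {U : Set (OnePoint ℂ)} (h : IsFoliatedAround F Ω p U) :
    IsFoliatedAround F⁻¹ Ω p U where
  isOpen := h.isOpen
  connected := h.connected
  regular := by rw [regularPart_inv]; exact h.regular
  foliated := fun x hx => by
    obtain ⟨γ, hγ, hrest⟩ := h.foliated x hx
    exact ⟨γ, hγ.inv, hrest⟩

lemma ringDomain_inv (F : OnePoint ℂ → ℂ) (Ω : Set (OnePoint ℂ)) (p : OnePoint ℂ) :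
    ringDomain F⁻¹ Ω p = ringDomain F Ω p := by
  unfold ringDomain
  congr 1
  ext U
  refine ⟨fun h => ?_, fun h => IsFoliatedAround.inv h⟩
  have h2 : IsFoliatedAround F⁻¹⁻¹ Ω p U := IsFoliatedAround.inv h
  rwa [inv_inv] at h2

end Inversion

/-! ### The ring domains of the simple poles -/

section RingDomain

/-- The geometry of the ring domain of a simple pole `p`, with residue `r`, of `d ln F`: it is a
cylinder in every constant multiple of the flat metric, a punctured neighbourhood of `p`, it
absorbs the connected sets covered by closed trajectories that it meets, and `k` is the level of
`|F|` on its boundary. The conditions are symmetric under `F ↦ F⁻¹`. -/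
structure IsCylindricalEnd (F : OnePoint ℂ → ℂ) (Ω : Set (OnePoint ℂ)) (p : OnePoint ℂ) (r : ℂ) :
    Prop where
  isFoliatedAround : IsFoliatedAround F Ω p (ringDomain F Ω p)
  isSemiInfiniteCylinder : ∀ (g : OnePoint ℂ → ℂ → ℝ) (l : ℝ), 0 < l →
    (∀ x ∈ regularPart F Ω, ∀ v, g x v = l ^ 2 * flatMetric F x v) →
    IsSemiInfiniteCylinder g p (l * (2 * Real.pi * ‖r‖)) (ringDomain F Ω p)
  isOpen_insert : IsOpen (insert p (ringDomain F Ω p))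
  absorbs : ∀ U, IsPreconnected U → U ⊆ regularPart F Ω →
    (∀ x ∈ U, ∃ γ : Circle → OnePoint ℂ, IsClosedTrajectory F Ω γ ∧ x ∈ Set.range γ) →
    (U ∩ ringDomain F Ω p).Nonempty → U ⊆ ringDomain F Ω p
  boundary : ∃ k : ℝ, 0 < k ∧ (∀ x ∈ ringDomain F Ω p, ‖F x‖ ≠ k) ∧
    (∀ q ∈ closure (ringDomain F Ω p), q ∈ Ω → q ∈ ringDomain F Ω p ∨ q = p ∨ ‖F q‖ = k) ∧
    (Ω = Set.univ → ∃ x, IsDlogZero F x ∧ ‖F x‖ = k)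

variable {F : OnePoint ℂ → ℂ} {Ω : Set (OnePoint ℂ)} {p : OnePoint ℂ}

lemma IsRingChart.isCylindricalEnd {n : ℕ} {R : ℝ} {φ : ℂ → OnePoint ℂ} (hΩ : IsOpen Ω)
    (hF : IsMeromorphicFunOn F Ω) (hfin : ∀ x ∈ Ω, meromorphicOrderAt (dlogCoeff F x) 0 ≠ ⊤)
    (h : IsRingChart F Ω p n R φ) : IsCylindricalEnd F Ω p n := by
  have hD := h.ringDomain_eq hΩ hF
  refine ⟨hD ▸ h.isFoliatedAround hF, fun g l hl hg => hD ▸ h.isSemiInfiniteCylinder hF hl ?_ hg,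
    hD ▸ h.isOpen_insert hF, fun U hU hUM ht hne => ?_, R ^ n, pow_pos h.pos n, ?_, ?_, ?_⟩
  · rw [Complex.norm_natCast]
  · rw [hD] at hne ⊢
    exact h.subset_of_trajectories hΩ hF hU hUM ht hne
  · rw [hD]
    exact fun x hx => (h.norm_lt hx).ne
  · rw [hD]
    exact fun q hq hqΩ => h.mem_or_of_mem_closure hF hq hqΩ
  · rintro rfl
    exact h.exists_isDlogZero hF (fun x => hfin x (Set.mem_univ x))

lemma IsCylindricalEnd.of_inv {r : ℂ} (h : IsCylindricalEnd F⁻¹ Ω p (-r)) :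
    IsCylindricalEnd F Ω p r := by
  obtain ⟨h1, h2, h3, h4, k, hk, h5, h6, h7⟩ := h
  simp only [ringDomain_inv, regularPart_inv, flatMetric_inv, norm_neg] at h1 h2 h3 h4 h5 h6
  refine ⟨?_, h2, h3, fun U hU hUM ht hne => h4 U hU hUM (fun x hx => ?_) hne, k⁻¹,
    inv_pos.2 hk, ?_, ?_, ?_⟩
  · have := h1.inv
    rwa [inv_inv] at this
  · obtain ⟨γ, hγ, hx⟩ := ht x hx
    exact ⟨γ, hγ.inv, hx⟩
  · intro x hx hxk
    apply h5 x hx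
    rw [Pi.inv_apply, norm_inv, hxk, inv_inv]
  · intro q hq hqΩ
    rcases h6 q hq hqΩ with h8 | h8 | h8
    · exact Or.inl h8
    · exact Or.inr (Or.inl h8)
    · right; right
      rw [Pi.inv_apply, norm_inv] at h8
      rw [← h8, inv_inv]
  · intro hΩ
    obtain ⟨x, hx, hxk⟩ := h7 hΩ
    refine ⟨x, isDlogZero_inv.1 hx, ?_⟩
    rw [Pi.inv_apply, norm_inv] at hxk
    rw [← hxk, inv_inv]

lemma isCylindricalEnd_of_order_pos (hΩ : IsOpen Ω) (hΩc : IsPreconnected Ω)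
    (hF : IsMeromorphicFunOn F Ω) (hfin : ∀ x ∈ Ω, meromorphicOrderAt (dlogCoeff F x) 0 ≠ ⊤)
    (hz : ∃ x ∈ Ω, IsDlogZero F x) (hp : p ∈ Ω) {n : ℕ} (hn : n ≠ 0) {g : ℂ → ℂ}
    (hg : AnalyticAt ℂ g 0) (hg0 : g 0 ≠ 0) (hG : ∀ᶠ t in 𝓝 0, localRep F p t = t ^ n * g t) :
    IsCylindricalEnd F Ω p n := by
  obtain ⟨e, he⟩ := exists_isRootChart hΩ hF hp (hfin p hp) hn hg hg0 hG
  obtain ⟨R, hR, φ, hφe, hφ, hmax⟩ := exists_maximal_lift hΩ hΩc hF hfin hz hn he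
  exact IsRingChart.isCylindricalEnd hΩ hF hfin ⟨hR, hn, ⟨e, he, hφe⟩, hφ, hmax⟩

/-- The ring domain of every simple pole of `d ln F` is a cylindrical end. -/
theorem HasSimplePole.isCylindricalEnd (hΩ : IsOpen Ω) (hΩc : IsPreconnected Ω)
    (hF : IsMeromorphicFunOn F Ω) (hfin : ∀ x ∈ Ω, meromorphicOrderAt (dlogCoeff F x) 0 ≠ ⊤)
    (hz : ∃ x ∈ Ω, IsDlogZero F x) (hp : p ∈ Ω) {r : ℂ} (h : HasSimplePole F p r) :
    IsCylindricalEnd F Ω p r := by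
  have h0 : F p = 0 := (dlogCoeff_order_eq_neg_one_iff hF hp (hfin p hp)).1 h.1
  obtain ⟨n, hn, hnp, g, hg, hg0, hG⟩ := exists_order_of_eq_zero hF hp (hfin p hp) h0
  rw [h.unique hnp]
  rcases lt_or_gt_of_ne hn with hneg | hpos
  · apply IsCylindricalEnd.of_inv
    obtain ⟨m, hm⟩ := Int.eq_ofNat_of_zero_le (neg_nonneg.2 hneg.le)
    have hnm : n = -(m : ℤ) := by omega
    have hcast : -(n : ℂ) = (m : ℂ) := by rw [hnm]; push_cast; ring
    rw [hcast]
    obtain ⟨x, hx, hxz⟩ := hz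
    refine isCylindricalEnd_of_order_pos hΩ hΩc hF.inv
      (fun x hx => by rw [meromorphicOrderAt_dlogCoeff_inv]; exact hfin x hx)
      ⟨x, hx, isDlogZero_inv.2 hxz⟩ hp (n := m) (by omega) (hg.inv hg0) (inv_ne_zero hg0) ?_
    filter_upwards [hG] with t ht
    have h1 : localRep F⁻¹ p t = (localRep F p t)⁻¹ := rfl
    rw [h1, ht, hnm, zpow_neg, zpow_natCast, mul_inv, inv_inv, Pi.inv_apply]
  · obtain ⟨m, rfl⟩ := Int.eq_ofNat_of_zero_le hpos.le
    exact_mod_cast isCylindricalEnd_of_order_pos hΩ hΩc hF hfin hz hp (n := m) (by omega) hg hg0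
      (by simpa using hG)

lemma IsCylindricalEnd.subset_regularPart {r : ℂ} (h : IsCylindricalEnd F Ω p r) :
    ringDomain F Ω p ⊆ regularPart F Ω := h.isFoliatedAround.regular

lemma IsCylindricalEnd.mem_closure {r : ℂ} (h : IsCylindricalEnd F Ω p r) :
    p ∈ closure (ringDomain F Ω p) := by
  have h1 : ringDomain F Ω p ∈ 𝓝[≠] p := by
    filter_upwards [self_mem_nhdsWithin,
      mem_nhdsWithin_of_mem_nhds (h.isOpen_insert.mem_nhds (Set.mem_insert _ _))] with x hx1 hx2
    exact hx2.resolve_left hx1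
  exact mem_closure_iff_frequently.2
    ((Eventually.frequently h1).filter_mono nhdsWithin_le_nhds)

/-- Two ring domains that meet are equal, by maximality, and a ring domain has a single zero or
pole of `F` in its closure. -/
theorem IsCylindricalEnd.disjoint (hF : IsMeromorphicFunOn F Ω) {p' : OnePoint ℂ} {r r' : ℂ}
    (h : IsCylindricalEnd F Ω p r) (h' : IsCylindricalEnd F Ω p' r') (hp : p ∈ Ω)
    (hp0 : F p = 0) (hne : p ≠ p') : Disjoint (ringDomain F Ω p) (ringDomain F Ω p') := by
  rw [Set.disjoint_iff_inter_eq_empty]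
  by_contra hinter
  have hnon : (ringDomain F Ω p ∩ ringDomain F Ω p').Nonempty := Set.nonempty_iff_ne_empty.2 hinter
  have hsub : ringDomain F Ω p ⊆ ringDomain F Ω p' := by
    refine h'.absorbs _ h.isFoliatedAround.connected.isPreconnected h.subset_regularPart ?_ hnon
    intro x hx
    obtain ⟨γ, hγ, hx, -⟩ := h.isFoliatedAround.foliated x hx
    exact ⟨_, hγ, hx⟩
  obtain ⟨k, hk, -, hcl, -⟩ := h'.boundary
  rcases hcl p (closure_mono hsub h.mem_closure) hp with h1 | h1 | h1
  · exact ((mem_regularPart_iff hF).1 (h'.subset_regularPart h1)).2.1 hp0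
  · exact hne h1
  · rw [hp0, norm_zero] at h1
    exact hk.ne h1

end RingDomain

/-! ### The decomposition of the sphere -/

section Decomposition

open Metric

lemma exists_preconnected_mem_nhds {P : OnePoint ℂ → Prop} {x : OnePoint ℂ} (h : ∀ᶠ y in 𝓝 x, P y) :
    ∃ N ∈ 𝓝 x, IsPreconnected N ∧ ∀ y ∈ N, P y := by
  rw [← map_sphereParam_nhds x, eventually_map, Metric.eventually_nhds_iff_ball] at h
  obtain ⟨s, hs, hball⟩ := h
  refine ⟨sphereParam x '' ball 0 s, ?_, (convex_ball _ _).isPreconnected.image _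
    (continuous_sphereParam x).continuousOn, ?_⟩
  · rw [← map_sphereParam_nhds x]
    exact image_mem_map (ball_mem_nhds _ hs)
  · rintro _ ⟨t, ht, rfl⟩
    exact hball t ht

lemma tendsto_smul_nhds_one (w : ℂ) : Tendsto (fun t : ℝ => (t : ℂ) * w) (𝓝 1) (𝓝 w) := by
  have : Continuous fun t : ℝ => (t : ℂ) * w := by fun_prop
  simpa using this.tendsto 1

lemma frequently_norm_lt {w : ℂ} (hw : w ≠ 0) : ∃ᶠ z in 𝓝 w, ‖z‖ < ‖w‖ := by
  have h1 : Tendsto (fun t : ℝ => (t : ℂ) * w) (𝓝[<] 1) (𝓝 w) :=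
    (tendsto_smul_nhds_one w).mono_left nhdsWithin_le_nhds
  refine h1.frequently (Eventually.frequently ?_)
  filter_upwards [Ioo_mem_nhdsLT (zero_lt_one (α := ℝ))] with t ht
  rw [norm_mul, Complex.norm_real, Real.norm_of_nonneg ht.1.le]
  exact mul_lt_of_lt_one_left (norm_pos_iff.2 hw) ht.2

lemma frequently_norm_gt {w : ℂ} (hw : w ≠ 0) : ∃ᶠ z in 𝓝 w, ‖w‖ < ‖z‖ := by
  have h1 : Tendsto (fun t : ℝ => (t : ℂ) * w) (𝓝[>] 1) (𝓝 w) :=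
    (tendsto_smul_nhds_one w).mono_left nhdsWithin_le_nhds
  refine h1.frequently (Eventually.frequently ?_)
  filter_upwards [self_mem_nhdsWithin] with t ht
  have ht : 1 < t := ht
  rw [norm_mul, Complex.norm_real, Real.norm_of_nonneg (by linarith)]
  exact lt_mul_of_one_lt_left (norm_pos_iff.2 hw) ht

variable {F : OnePoint ℂ → ℂ}

/-- At every zero or pole `p` of `F` (where the normalized value is `0`) there is a cylindrical
end, whose boundary lies on the level curve `|F| = k p`, which carries a zero of `d ln F`. -/
structure IsDecomposable (F : OnePoint ℂ → ℂ) (k : OnePoint ℂ → ℝ) : Prop where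
  meromorphic : IsMeromorphicFunOn F Set.univ
  order_ne_top : ∀ x, meromorphicOrderAt (dlogCoeff F x) 0 ≠ ⊤
  cylindricalEnd : ∀ p, F p = 0 → ∃ r, HasSimplePole F p r ∧ IsCylindricalEnd F Set.univ p r
  norm_ne : ∀ p, F p = 0 → ∀ x ∈ ringDomain F Set.univ p, ‖F x‖ ≠ k p
  mem_or : ∀ p, F p = 0 → ∀ q ∈ closure (ringDomain F Set.univ p),
    q ∈ ringDomain F Set.univ p ∨ q = p ∨ ‖F q‖ = k p
  exists_zero : ∀ p, F p = 0 → ∃ x, IsDlogZero F x ∧ ‖F x‖ = k p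

variable {k : OnePoint ℂ → ℝ}

lemma exists_isDecomposable (hF : IsMeromorphicFunOn F Set.univ)
    (hfin : ∀ x, meromorphicOrderAt (dlogCoeff F x) 0 ≠ ⊤) (hz : ∃ x, IsDlogZero F x) :
    ∃ k, IsDecomposable F k := by
  have hend : ∀ p, F p = 0 → ∃ r, HasSimplePole F p r ∧ IsCylindricalEnd F Set.univ p r := by
    intro p hp
    obtain ⟨r, hr⟩ := (exists_hasSimplePole_iff hF (Set.mem_univ p) (hfin p)).2 hp
    obtain ⟨x, hx⟩ := hz
    exact ⟨r, hr, hr.isCylindricalEnd isOpen_univ isPreconnected_univ hF (fun x _ => hfin x)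
      ⟨x, Set.mem_univ x, hx⟩ (Set.mem_univ p)⟩
  have hk : ∀ p, F p = 0 → ∃ k : ℝ, 0 < k ∧ (∀ x ∈ ringDomain F Set.univ p, ‖F x‖ ≠ k) ∧
      (∀ q ∈ closure (ringDomain F Set.univ p), q ∈ Set.univ →
        q ∈ ringDomain F Set.univ p ∨ q = p ∨ ‖F q‖ = k) ∧
      (Set.univ = (Set.univ : Set (OnePoint ℂ)) → ∃ x, IsDlogZero F x ∧ ‖F x‖ = k) := by
    intro p hp
    obtain ⟨r, -, hr⟩ := hend p hp
    exact hr.boundary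
  choose! k _ h2 h3 h4 using hk
  exact ⟨k, hF, hfin, hend, h2, fun p hp q hq => h3 p hp q hq (Set.mem_univ q),
    fun p hp => h4 p hp rfl⟩

lemma IsDecomposable.ne_zero (h : IsDecomposable F k) {p x : OnePoint ℂ} (hp : F p = 0)
    (hx : x ∈ ringDomain F Set.univ p) : F x ≠ 0 := by
  obtain ⟨r, -, hr⟩ := h.cylindricalEnd p hp
  exact ((mem_regularPart_iff h.meromorphic).1 (hr.subset_regularPart hx)).2.1

lemma IsDecomposable.continuousAt (h : IsDecomposable F k) {x : OnePoint ℂ} (hx : F x ≠ 0) :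
    ContinuousAt F x := continuousAt_of_ne_zero h.meromorphic (Set.mem_univ x) hx

lemma IsDecomposable.isOpen_insert (h : IsDecomposable F k) {p : OnePoint ℂ} (hp : F p = 0) :
    IsOpen (insert p (ringDomain F Set.univ p)) := by
  obtain ⟨r, -, hr⟩ := h.cylindricalEnd p hp
  exact hr.isOpen_insert

lemma IsDecomposable.isOpen (h : IsDecomposable F k) {p : OnePoint ℂ} (hp : F p = 0) :
    IsOpen (ringDomain F Set.univ p) := by
  obtain ⟨r, -, hr⟩ := h.cylindricalEnd p hp
  exact hr.isFoliatedAround.isOpen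

/-- On the sphere there are finitely many zeros and poles. -/
lemma IsDecomposable.finite (h : IsDecomposable F k) : {p | F p = 0}.Finite := by
  have hcl : IsClosed {p | F p = 0} := by
    rw [← isOpen_compl_iff, isOpen_iff_mem_nhds]
    intro x hx
    exact (h.continuousAt hx).eventually_ne hx
  obtain ⟨t, ht, hsub⟩ := hcl.isCompact.elim_nhds_subcover
    (fun p => insert p (ringDomain F Set.univ p))
    (fun p hp => (h.isOpen_insert hp).mem_nhds (Set.mem_insert _ _))
  refine t.finite_toSet.subset fun p hp => ?_
  obtain ⟨q, hq, hpq⟩ := Set.mem_iUnion₂.1 (hsub hp)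
  rcases hpq with rfl | hpq
  · exact hq
  · exact absurd hp (h.ne_zero (ht q hq) hpq)

lemma IsDecomposable.frequently (h : IsDecomposable F k) {x : OnePoint ℂ} (hx : F x ≠ 0)
    {P : ℂ → Prop} (hP : ∃ᶠ w in 𝓝 (F x), P w) : ∃ᶠ y in 𝓝 x, P (F y) :=
  frequently_map.1 (hP.filter_mono
    (nhds_le_map_nhds h.meromorphic (Set.mem_univ x) (h.order_ne_top x) hx))

/-- If all zeros of `d ln F` lie on one level curve, the sets `𝒟_p ∪ {p}` fill its complement:
otherwise `|F|` would have an extremum at an interior point of the set that they omit. -/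
lemma IsDecomposable.exists_mem (h : IsDecomposable F k) {κ : ℝ}
    (hκ : ∀ x, IsDlogZero F x → ‖F x‖ = κ) {x : OnePoint ℂ} (hx : ‖F x‖ ≠ κ) :
    ∃ p, F p = 0 ∧ x ∈ insert p (ringDomain F Set.univ p) := by
  by_contra! hno
  have hk : ∀ p, F p = 0 → k p = κ := by
    intro p hp
    obtain ⟨y, hy, hyk⟩ := h.exists_zero p hp
    rw [← hyk, hκ y hy]
  set C : Set (OnePoint ℂ) := {y | ∀ p, F p = 0 → y ∉ insert p (ringDomain F Set.univ p)} with hC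
  have hC0 : ∀ y ∈ C, F y ≠ 0 := fun y hy h0 => hy y h0 (Set.mem_insert _ _)
  have hCcl : IsClosed C := by
    have : C = ⋂ p, ⋂ (_ : F p = 0), (insert p (ringDomain F Set.univ p))ᶜ := by
      ext y
      simp [hC]
    rw [this]
    exact isClosed_iInter fun p => isClosed_iInter fun hp => (h.isOpen_insert hp).isClosed_compl
  have hCcont : ContinuousOn (fun y => ‖F y‖) C := fun y hy =>
    (h.continuousAt (hC0 y hy)).norm.continuousWithinAt
  -- near a point off the level curve, a connected set that meets a ring domain lies in it
  have hCnhds : ∀ y ∈ C, ‖F y‖ ≠ κ → C ∈ 𝓝 y := by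
    intro y hy hyκ
    obtain ⟨N, hN, hNc, hNP⟩ := exists_preconnected_mem_nhds
      (((h.continuousAt (hC0 y hy)).norm.eventually_ne hyκ).and
        ((h.continuousAt (hC0 y hy)).eventually_ne (hC0 y hy)))
    refine mem_of_superset hN fun z hz p hp hzp => ?_
    have hzD : z ∈ ringDomain F Set.univ p := hzp.resolve_left fun h' => (hNP z hz).2 (h' ▸ hp)
    have hsub : N ⊆ ringDomain F Set.univ p := by
      refine hNc.subset_of_closure_inter_subset (h.isOpen hp) ⟨z, hz, hzD⟩ ?_
      rintro q ⟨hq, hqN⟩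
      rcases h.mem_or p hp q hq with h1 | h1 | h1
      · exact h1
      · exact absurd (h1 ▸ hp) (hNP q hqN).2
      · exact absurd (h1.trans (hk p hp)) (hNP q hqN).1
    exact hy p hp (Or.inr (hsub (mem_of_mem_nhds hN)))
  have hxC : x ∈ C := hno
  rcases lt_or_gt_of_ne hx with hlt | hgt
  · obtain ⟨y, hy, hmin⟩ := hCcl.isCompact.exists_isMinOn ⟨x, hxC⟩ hCcont
    have hyx : ‖F y‖ ≤ ‖F x‖ := hmin hxC
    obtain ⟨z, hz1, hz2⟩ := ((h.frequently (hC0 y hy) (frequently_norm_lt (hC0 y hy))).and_eventually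
      (hCnhds y hy (hyx.trans_lt hlt).ne)).exists
    exact absurd (hmin hz2) (not_le.2 hz1)
  · obtain ⟨y, hy, hmax⟩ := hCcl.isCompact.exists_isMaxOn ⟨x, hxC⟩ hCcont
    have hyx : ‖F x‖ ≤ ‖F y‖ := hmax hxC
    obtain ⟨z, hz1, hz2⟩ := ((h.frequently (hC0 y hy) (frequently_norm_gt (hC0 y hy))).and_eventually
      (hCnhds y hy (hgt.trans_le hyx).ne')).exists
    exact absurd (hmax hz2) (not_le.2 hz1)

lemma IsDecomposable.exists_mem_closure (h : IsDecomposable F k) {κ : ℝ}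
    (hκ : ∀ x, IsDlogZero F x → ‖F x‖ = κ) (x : OnePoint ℂ) :
    ∃ p, F p = 0 ∧ x ∈ closure (ringDomain F Set.univ p) := by
  by_cases hx0 : F x = 0
  · obtain ⟨r, -, hr⟩ := h.cylindricalEnd x hx0
    exact ⟨x, hx0, hr.mem_closure⟩
  -- the points off the level curve are dense, because `F` is open
  have hfr : ∃ᶠ y in 𝓝 x, ‖F y‖ ≠ κ := by
    rcases le_or_gt ‖F x‖ κ with hle | hgt
    · exact (h.frequently hx0 (frequently_norm_lt hx0)).mono fun y hy => (hy.trans_le hle).ne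
    · exact (h.frequently hx0 (frequently_norm_gt hx0)).mono fun y hy => (hgt.trans hy).ne'
  have hcl : x ∈ closure (⋃ p ∈ {p | F p = 0}, ringDomain F Set.univ p) := by
    rw [mem_closure_iff_frequently]
    refine (hfr.and_eventually ((h.continuousAt hx0).eventually_ne hx0)).mono ?_
    rintro y ⟨hy1, hy2⟩
    obtain ⟨p, hp, hyp⟩ := h.exists_mem hκ hy1
    exact Set.mem_iUnion₂.2 ⟨p, hp, hyp.resolve_left fun h' => hy2 (h' ▸ hp)⟩
  rw [h.finite.closure_biUnion] at hcl
  obtain ⟨p, hp, hxp⟩ := Set.mem_iUnion₂.1 hcl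
  exact ⟨p, hp, hxp⟩

/-- Ring domains whose closures meet are bounded by the same level curve. -/
lemma IsDecomposable.eq_of_mem_closure (h : IsDecomposable F k) {p q x : OnePoint ℂ}
    (hp : F p = 0) (hq : F q = 0) (hxp : x ∈ closure (ringDomain F Set.univ p))
    (hxq : x ∈ closure (ringDomain F Set.univ q)) : k p = k q := by
  by_cases hpq : p = q
  · rw [hpq]
  have hdisj : ∀ p q : OnePoint ℂ, F p = 0 → F q = 0 → p ≠ q →
      x ∈ closure (ringDomain F Set.univ p) → x ∈ closure (ringDomain F Set.univ q) →
      ‖F x‖ = k p := by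
    intro p q hp hq hpq hxp hxq
    obtain ⟨r, -, hr⟩ := h.cylindricalEnd p hp
    obtain ⟨r', -, hr'⟩ := h.cylindricalEnd q hq
    have hnot : x ∉ insert p (ringDomain F Set.univ p) := by
      intro hx
      obtain ⟨y, hy1, hy2⟩ := mem_closure_iff.1 hxq _ hr.isOpen_insert hx
      have hy3 : y ∈ ringDomain F Set.univ p :=
        hy1.resolve_left fun h' => h.ne_zero hq hy2 (h' ▸ hp)
      exact Set.disjoint_left.1 (hr.disjoint h.meromorphic hr' (Set.mem_univ p) hp hpq) hy3 hy2
    rcases h.mem_or p hp x hxp with h1 | h1 | h1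
    · exact absurd (Or.inr h1) hnot
    · exact absurd (Or.inl h1) hnot
    · exact h1
  rw [← hdisj p q hp hq hpq hxp hxq, hdisj q p hq hp (Ne.symm hpq) hxq hxp]

/-- If the closed ring domains cover the sphere, connectedness forces their boundaries to lie on
one level curve. -/
lemma IsDecomposable.exists_level (h : IsDecomposable F k)
    (hcov : ∀ x, ∃ p, F p = 0 ∧ x ∈ closure (ringDomain F Set.univ p)) :
    ∃ κ : ℝ, ∀ x, IsDlogZero F x → ‖F x‖ = κ := by
  obtain ⟨p₀, hp₀, hx₀⟩ := hcov OnePoint.infty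
  have hclosed : ∀ s : Set (OnePoint ℂ), s ⊆ {p | F p = 0} →
      IsClosed (⋃ p ∈ s, closure (ringDomain F Set.univ p)) := fun s hs =>
    (h.finite.subset hs).isClosed_biUnion fun _ _ => isClosed_closure
  have hall : ∀ p, F p = 0 → k p = k p₀ := by
    by_contra! hex
    obtain ⟨p₁, hp₁, hne⟩ := hex
    obtain ⟨r, -, hr⟩ := h.cylindricalEnd p₁ hp₁
    obtain ⟨x, -, hx1, hx2⟩ := isPreconnected_closed_iff.1 (isPreconnected_univ (α := OnePoint ℂ))
      _ _ (hclosed {p | F p = 0 ∧ k p = k p₀} fun p hp => hp.1)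
      (hclosed {p | F p = 0 ∧ k p ≠ k p₀} fun p hp => hp.1)
      (by
        intro x _
        obtain ⟨p, hp, hx⟩ := hcov x
        by_cases hk : k p = k p₀
        · exact Or.inl (Set.mem_iUnion₂.2 ⟨p, ⟨hp, hk⟩, hx⟩)
        · exact Or.inr (Set.mem_iUnion₂.2 ⟨p, ⟨hp, hk⟩, hx⟩))
      ⟨OnePoint.infty, Set.mem_univ _, Set.mem_iUnion₂.2 ⟨p₀, ⟨hp₀, rfl⟩, hx₀⟩⟩
      ⟨p₁, Set.mem_univ _, Set.mem_iUnion₂.2 ⟨p₁, ⟨hp₁, hne⟩, hr.mem_closure⟩⟩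
    obtain ⟨p, ⟨hp, hpk⟩, hxp⟩ := Set.mem_iUnion₂.1 hx1
    obtain ⟨q, ⟨hq, hqk⟩, hxq⟩ := Set.mem_iUnion₂.1 hx2
    exact hqk ((h.eq_of_mem_closure hp hq hxp hxq).symm.trans hpk)
  refine ⟨k p₀, fun x hx => ?_⟩
  obtain ⟨hx0, hxr⟩ := (isDlogZero_iff h.meromorphic (Set.mem_univ x) (h.order_ne_top x)).1 hx
  obtain ⟨p, hp, hxp⟩ := hcov x
  obtain ⟨r, -, hr⟩ := h.cylindricalEnd p hp
  rcases h.mem_or p hp x hxp with h1 | h1 | h1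
  · exact absurd (hr.subset_regularPart h1) hxr
  · exact absurd (h1 ▸ hp) hx0
  · rw [h1, hall p hp]

lemma IsDecomposable.hasSimplePole_iff (h : IsDecomposable F k) {p : OnePoint ℂ} :
    (∃ r, HasSimplePole F p r) ↔ F p = 0 :=
  exists_hasSimplePole_iff h.meromorphic (Set.mem_univ p) (h.order_ne_top p)

theorem IsDecomposable.cover_iff (h : IsDecomposable F k) :
    (∀ x, ∃ p r, HasSimplePole F p r ∧ x ∈ closure (ringDomain F Set.univ p)) ↔
      ∃ κ : ℝ, ∀ x, IsDlogZero F x → ‖F x‖ = κ := by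
  constructor
  · intro hcov
    refine h.exists_level fun x => ?_
    obtain ⟨p, r, hp, hx⟩ := hcov x
    exact ⟨p, h.hasSimplePole_iff.1 ⟨r, hp⟩, hx⟩
  · rintro ⟨κ, hκ⟩ x
    obtain ⟨p, hp, hx⟩ := h.exists_mem_closure hκ x
    obtain ⟨r, hr⟩ := h.hasSimplePole_iff.2 hp
    exact ⟨p, r, hr, hx⟩

theorem IsDecomposable.level_iff (h : IsDecomposable F k) (hz : ∃ x, IsDlogZero F x) {κ : ℝ}
    (hκ : ∀ x, IsDlogZero F x → ‖F x‖ = κ) (x : OnePoint ℂ) :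
    ‖F x‖ = κ ↔ ¬ ∃ p r, HasSimplePole F p r ∧ x ∈ insert p (ringDomain F Set.univ p) := by
  constructor
  · rintro hx ⟨p, r, hp, hxp⟩
    have hp0 := h.hasSimplePole_iff.1 ⟨r, hp⟩
    rcases hxp with rfl | hxp
    · obtain ⟨y, hy⟩ := hz
      have hy0 := ((isDlogZero_iff h.meromorphic (Set.mem_univ y) (h.order_ne_top y)).1 hy).1
      rw [hp0, norm_zero] at hx
      rw [← hx] at hκ
      exact hy0 (norm_eq_zero.1 (hκ y hy))
    · obtain ⟨y, hy, hyk⟩ := h.exists_zero p hp0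
      exact h.norm_ne p hp0 x hxp (by rw [hx, ← hyk, hκ y hy])
  · intro hno
    by_contra hx
    obtain ⟨p, hp, hxp⟩ := h.exists_mem hκ hx
    obtain ⟨r, hr⟩ := h.hasSimplePole_iff.2 hp
    exact hno ⟨p, r, hr, hxp⟩

end Decomposition

/-! ### Wirtinger derivatives -/

section Wirtinger

/-- The real differential of `h` at `t` is `v ↦ a v + b v̄`, that is `∂h = a` and `∂̄h = b`. -/
def HasWirtinger (h : ℂ → ℂ) (a b t : ℂ) : Prop :=
  HasFDerivAt h (a • (1 : ℂ →L[ℝ] ℂ) + b • (Complex.conjCLE : ℂ →L[ℝ] ℂ)) t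

variable {h h₁ h₂ : ℂ → ℂ} {a a₁ a₂ b b₁ b₂ t : ℂ}

lemma HasWirtinger.fderiv_apply (H : HasWirtinger h a b t) (v : ℂ) :
    fderiv ℝ h t v = a * v + b * conj v := by
  rw [HasFDerivAt.fderiv H]
  simp

lemma HasWirtinger.wirtD (H : HasWirtinger h a b t) : wirtD h t = a := by
  unfold _root_.wirtD
  rw [H.fderiv_apply, H.fderiv_apply, map_one, Complex.conj_I]
  linear_combination (-a / 2 + b / 2) * Complex.I_sq

lemma HasWirtinger.wirtDbar (H : HasWirtinger h a b t) : wirtDbar h t = b := by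
  unfold _root_.wirtDbar
  rw [H.fderiv_apply, H.fderiv_apply, map_one, Complex.conj_I]
  linear_combination (a / 2 - b / 2) * Complex.I_sq

lemma HasWirtinger.congr (H : HasWirtinger h a b t) (he : h₁ =ᶠ[𝓝 t] h) :
    HasWirtinger h₁ a b t := HasFDerivAt.congr_of_eventuallyEq H he

lemma HasWirtinger.differentiableAt (H : HasWirtinger h a b t) : DifferentiableAt ℝ h t :=
  HasFDerivAt.differentiableAt H

lemma HasWirtinger.mul (H₁ : HasWirtinger h₁ a₁ b₁ t) (H₂ : HasWirtinger h₂ a₂ b₂ t) :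
    HasWirtinger (fun s => h₁ s * h₂ s) (a₁ * h₂ t + h₁ t * a₂) (b₁ * h₂ t + h₁ t * b₂) t := by
  refine (HasFDerivAt.mul H₁ H₂).congr_fderiv ?_
  ext v
  simp
  ring

lemma HasWirtinger.const_sub (H : HasWirtinger h a b t) (c : ℂ) :
    HasWirtinger (fun s => c - h s) (-a) (-b) t := by
  refine (HasFDerivAt.const_sub H c).congr_fderiv ?_
  ext v
  simp
  ring

lemma HasWirtinger.add (H₁ : HasWirtinger h₁ a₁ b₁ t) (H₂ : HasWirtinger h₂ a₂ b₂ t) :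
    HasWirtinger (fun s => h₁ s + h₂ s) (a₁ + a₂) (b₁ + b₂) t := by
  refine (HasFDerivAt.add H₁ H₂).congr_fderiv ?_
  ext v
  simp
  ring

lemma HasWirtinger.const_mul (H : HasWirtinger h a b t) (c : ℂ) :
    HasWirtinger (fun s => c * h s) (c * a) (c * b) t := by
  refine (HasFDerivAt.const_mul H c).congr_fderiv ?_
  ext v
  simp
  ring

lemma HasWirtinger.conj (H : HasWirtinger h a b t) :
    HasWirtinger (fun s => conj (h s)) (conj b) (conj a) t := by
  have h1 : HasFDerivAt (fun z : ℂ => (starRingEnd ℂ) z) (Complex.conjCLE : ℂ →L[ℝ] ℂ) (h t) :=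
    (Complex.conjCLE : ℂ →L[ℝ] ℂ).hasFDerivAt
  refine (h1.comp t H).congr_fderiv ?_
  ext v
  simp
  ring

lemma HasDerivAt.hasWirtinger (H : HasDerivAt h a t) : HasWirtinger h a 0 t := by
  refine (H.hasFDerivAt.restrictScalars ℝ).congr_fderiv ?_
  ext v
  simp
  ring

/-- The derivatives of the unimodular function `γ exp (d g - conj (d g))`. -/
lemma hasWirtinger_phase {g : ℂ → ℂ} {g' : ℂ} (hg : HasDerivAt g g' t) (γ d : ℂ) :
    HasWirtinger (fun s => γ * Complex.exp (d * g s - conj (d * g s)))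
      (γ * Complex.exp (d * g t - conj (d * g t)) * (d * g'))
      (-(γ * Complex.exp (d * g t - conj (d * g t)) * conj (d * g'))) t := by
  have h1 : HasWirtinger (fun s => d * g s) (d * g') 0 t := (hg.const_mul d).hasWirtinger
  have h2 : HasWirtinger (fun s => d * g s - conj (d * g s)) (d * g') (-conj (d * g')) t := by
    have h3 := h1.add (h1.conj.const_mul (-1))
    have e1 : d * g' + -1 * conj (0 : ℂ) = d * g' := by simp
    have e2 : 0 + -1 * conj (d * g') = -conj (d * g') := by ring
    rw [e1, e2] at h3
    exact h3.congr (Eventually.of_forall fun s => by ring)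
  have h4 := ((HasFDerivAt.cexp h2).const_mul γ)
  refine h4.congr_fderiv ?_
  ext v
  simp
  ring

end Wirtinger

/-! ### The meron-type solutions -/

section Meron

/-- `w` is the unimodular function `γ exp (d g - conj (d g))` on `V`. -/
def IsPhase (g w : ℂ → ℂ) (γ d : ℂ) (V : Set ℂ) : Prop :=
  ∀ t ∈ V, w t = γ * Complex.exp (d * g t - conj (d * g t))

variable {g w w' : ℂ → ℂ} {γ γ' d d' t : ℂ} {V : Set ℂ}

lemma norm_exp_sub_conj (z : ℂ) : ‖Complex.exp (z - conj z)‖ = 1 := by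
  rw [Complex.norm_exp]
  simp

lemma IsPhase.mul_conj (hw : IsPhase g w γ d V) (hγ : ‖γ‖ = 1) (ht : t ∈ V) :
    w t * conj (w t) = 1 := by
  rw [Complex.mul_conj, Complex.normSq_eq_norm_sq, hw t ht, norm_mul, hγ, norm_exp_sub_conj]
  simp

lemma IsPhase.hasWirtinger (hw : IsPhase g w γ d V) (hV : IsOpen V) (hg : DifferentiableOn ℂ g V)
    (ht : t ∈ V) : HasWirtinger w (w t * (d * deriv g t)) (-(w t * conj (d * deriv g t))) t := by
  rw [hw t ht]
  refine (hasWirtinger_phase (hg.differentiableAt (hV.mem_nhds ht)).hasDerivAt γ d).congr ?_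
  filter_upwards [hV.mem_nhds ht] with s hs
  exact hw s hs

lemma IsPhase.wirtD_wirtDbar (hw : IsPhase g w γ d V) (hV : IsOpen V)
    (hg : DifferentiableOn ℂ g V) (ht : t ∈ V) :
    wirtD (wirtDbar w) t = -(w t * (d * deriv g t) * conj (d * deriv g t)) := by
  have h1 : wirtDbar w =ᶠ[𝓝 t] fun s => w s * (-1 * conj (d * deriv g s)) := by
    filter_upwards [hV.mem_nhds ht] with s hs
    rw [(hw.hasWirtinger hV hg hs).wirtDbar]
    ring
  have h2 : HasDerivAt (fun s => d * deriv g s) (d * deriv (deriv g) t) t :=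
    ((hg.deriv hV).differentiableAt (hV.mem_nhds ht)).hasDerivAt.const_mul d
  have h3 := (hw.hasWirtinger hV hg ht).mul (h2.hasWirtinger.conj.const_mul (-1))
  rw [(h3.congr h1).wirtD]
  simp

lemma IsPhase.contDiffAt (hw : IsPhase g w γ d V) (hV : IsOpen V)
    (hg : DifferentiableOn ℂ g V) (ht : t ∈ V) : ContDiffAt ℝ ((⊤ : ℕ∞) : WithTop ℕ∞) w t := by
  have h1 : ContDiffAt ℝ ((⊤ : ℕ∞) : WithTop ℕ∞) g t :=
    ((hg.analyticAt (hV.mem_nhds ht)).contDiffAt).restrict_scalars ℝ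
  have h2 : ContDiffAt ℝ ((⊤ : ℕ∞) : WithTop ℕ∞) (fun s => d * g s) t := contDiffAt_const.mul h1
  have h3 : ContDiffAt ℝ ((⊤ : ℕ∞) : WithTop ℕ∞) (fun s => conj (d * g s)) t :=
    (Complex.conjCLE.contDiff).contDiffAt.comp t h2
  refine ((contDiffAt_const (c := γ)).mul (h2.sub h3).cexp).congr_of_eventuallyEq (f₁ := w) ?_
  filter_upwards [hV.mem_nhds ht] with s hs
  exact hw s hs

/-- For unimodular fields the factor `A` is `3`, and the model equation reduces to the relation
`2 Re (d d̄') = |d|²` between the exponents. -/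
lemma IsPhase.cp2Expr_eq_zero (hw : IsPhase g w γ d V) (hw' : IsPhase g w' γ' d' V) (hV : IsOpen V)
    (hg : DifferentiableOn ℂ g V) (ht : t ∈ V) (hγ : ‖γ‖ = 1) (hγ' : ‖γ'‖ = 1)
    (hd : d * conj d' + conj d * d' = d * conj d) : cp2Expr w w' t = 0 := by
  have h1 := hw.mul_conj hγ ht
  have h2 := hw'.mul_conj hγ' ht
  unfold cp2Expr
  simp only [h1, h2, hw.wirtD_wirtDbar hV hg ht, (hw.hasWirtinger hV hg ht).wirtD,
    (hw.hasWirtinger hV hg ht).wirtDbar, (hw'.hasWirtinger hV hg ht).wirtD,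
    (hw'.hasWirtinger hV hg ht).wirtDbar, map_mul]
  linear_combination (2 / 3 * w t * d * deriv g t * conj d * conj (deriv g t)) * h1 +
    (1 / 3 * w t * deriv g t * conj (deriv g t) * (d * conj d' + conj d * d')) * h2 +
    (1 / 3 * w t * deriv g t * conj (deriv g t)) * hd

/-- Near a point where `G` is analytic and non-zero, the meron-type solution is expressed by an
analytic logarithm `g` of `G`. -/
lemma exists_isPhase {G : ℂ → ℂ} {U : Set ℂ} {t₀ : ℂ} (hG : AnalyticAt ℂ G t₀) (h0 : G t₀ ≠ 0)
    (hU : ∀ᶠ t in 𝓝 t₀, t ∈ U) (c : ℂ) {ψ : ℝ} (hψ : Real.cos ψ = 1 / 2) :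
    ∃ (V : Set ℂ) (g : ℂ → ℂ), IsOpen V ∧ t₀ ∈ V ∧ V ⊆ U ∧ DifferentiableOn ℂ g V ∧
      (∀ t ∈ V, deriv g t = logDeriv G t) ∧ IsPhase g (meronW₁ G) 1 1 V ∧
      IsPhase g (meronW₂ c ψ G) (c / conj c) (Complex.exp (Complex.I * ψ)) V := by
  set α := Complex.exp (Complex.I * ψ) with hα
  have hαre : α.re = 1 / 2 := by
    rw [hα, mul_comm, Complex.exp_ofReal_mul_I_re, hψ]
  have hslit : ∀ᶠ t in 𝓝 t₀, G t / G t₀ ∈ Complex.slitPlane :=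
    (hG.continuousAt.div_const _).eventually_mem
      (Complex.isOpen_slitPlane.mem_nhds (by simp [h0]))
  obtain ⟨V, hV, hVo, hmem⟩ := eventually_nhds_iff.1
    (hU.and (hslit.and (hG.eventually_analyticAt.and (hG.continuousAt.eventually_ne h0))))
  set g : ℂ → ℂ := fun t => Complex.log (G t / G t₀) + Complex.log (G t₀) with hgdef
  have hexp : ∀ t ∈ V, Complex.exp (g t) = G t := by
    intro t ht
    rw [hgdef]
    simp only
    rw [Complex.exp_add, Complex.exp_log (div_ne_zero (hV t ht).2.2.2 h0), Complex.exp_log h0]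
    field_simp
  have hgd : ∀ t ∈ V, HasDerivAt g (logDeriv G t) t := by
    intro t ht
    have h1 := ((((hV t ht).2.2.1.differentiableAt).hasDerivAt.div_const (G t₀)).clog
      (hV t ht).2.1).add_const (Complex.log (G t₀))
    have hne := (hV t ht).2.2.2
    have h2 : deriv G t / G t₀ / (G t / G t₀) = logDeriv G t := by
      rw [logDeriv_apply]
      field_simp
    rwa [h2] at h1
  refine ⟨V, g, hVo, hmem, fun t ht => (hV t ht).1,
    fun t ht => (hgd t ht).differentiableAt.differentiableWithinAt,
    fun t ht => (hgd t ht).deriv, fun t ht => ?_, fun t ht => ?_⟩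
  · unfold meronW₁
    rw [← hexp t ht, ← Complex.exp_conj, ← Complex.exp_sub, one_mul, one_mul]
  · have hne := (hV t ht).2.2.2
    unfold meronW₂
    rw [← hα, Complex.cpow_def_of_ne_zero hne, ← Complex.exp_conj, ← Complex.exp_sub]
    -- the two logarithms of `G t` differ by `2πim`, which does not matter since `2 Re α = 1`
    obtain ⟨m, hm⟩ : ∃ m : ℤ, Complex.log (G t) = g t + m * (2 * Real.pi * Complex.I) :=
      Complex.exp_eq_exp_iff_exists_int.1 (by rw [Complex.exp_log hne, hexp t ht])
    congr 1
    rw [Complex.exp_eq_exp_iff_exists_int]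
    refine ⟨m, ?_⟩
    have h2 : α + conj α = 1 := by
      rw [Complex.add_conj, hαre]
      norm_num
    rw [hm]
    simp only [map_mul, map_add, Complex.conj_I, Complex.conj_ofReal, map_intCast, map_ofNat]
    linear_combination (m * (2 * Real.pi * Complex.I)) * h2

end Meron

/-! ### The Weierstrass immersion of a meron-type solution -/

section Weierstrass

variable {g : ℂ → ℂ} {w : Fin 3 → ℂ → ℂ} {γ β : Fin 3 → ℂ} {m t : ℂ} {V : Set ℂ}
  {P : ℂ → Matrix (Fin 3) (Fin 3) ℂ}

/-- `β₀, β₁, β₂` are the vertices of an equilateral triangle of side one with centre `m`. -/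
structure IsUnitTriangle (β : Fin 3 → ℂ) (m : ℂ) : Prop where
  injective : Function.Injective β
  sum : ∑ i, β i = 3 * m
  dist : ∀ i, (β i - m) * conj (β i - m) = 1 / 3
  sum_sq : ∑ i, (β i - m) ^ 2 = 0

/-- On `V` the matrix `P` is the projector `1 - f f† / 3` with `f = (w̄₀, w̄₁, w̄₂)`, where the
`wᵢ` are unimodular with exponents `βᵢ`. -/
structure IsPhaseProjector (P : ℂ → Matrix (Fin 3) (Fin 3) ℂ) (g : ℂ → ℂ) (w : Fin 3 → ℂ → ℂ)
    (γ β : Fin 3 → ℂ) (V : Set ℂ) : Prop where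
  isOpen : IsOpen V
  differentiableOn : DifferentiableOn ℂ g V
  norm : ∀ i, ‖γ i‖ = 1
  phase : ∀ i, IsPhase g (w i) (γ i) (β i) V
  eq : ∀ t ∈ V, ∀ i j, P t i j = (if i = j then 1 else 0) - 1 / 3 * (conj (w i t) * w j t)

lemma IsPhaseProjector.hasWirtinger_mul (h : IsPhaseProjector P g w γ β V) (ht : t ∈ V)
    (i j : Fin 3) :
    HasWirtinger (fun s => conj (w i s) * w j s)
      (conj (w i t) * w j t * ((β j - β i) * deriv g t))
      (-(conj (w i t) * w j t * conj ((β j - β i) * deriv g t))) t := by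
  have h1 := (((h.phase i).hasWirtinger h.isOpen h.differentiableOn ht).conj).mul
    ((h.phase j).hasWirtinger h.isOpen h.differentiableOn ht)
  convert h1 using 1 <;> simp only [map_mul, map_neg, map_sub, Complex.conj_conj] <;> ring

lemma IsPhaseProjector.hasWirtinger (h : IsPhaseProjector P g w γ β V) (ht : t ∈ V)
    (i j : Fin 3) :
    HasWirtinger (fun s => P s i j)
      (-(1 / 3 * (conj (w i t) * w j t * ((β j - β i) * deriv g t))))
      (1 / 3 * (conj (w i t) * w j t * conj ((β j - β i) * deriv g t))) t := by
  have h1 := (((h.hasWirtinger_mul ht i j).const_mul (1 / 3)).const_sub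
    (if i = j then 1 else 0)).congr (h₁ := fun s => P s i j)
    (by filter_upwards [h.isOpen.mem_nhds ht] with s hs; exact h.eq s hs i j)
  convert h1 using 1
  ring

lemma IsPhaseProjector.mul_conj (h : IsPhaseProjector P g w γ β V) (ht : t ∈ V) (i : Fin 3) :
    w i t * conj (w i t) = 1 := (h.phase i).mul_conj (h.norm i) ht

/-- The Weierstrass form has the entries `(i/3) w̄ᵢ wⱼ · 2 Re (σᵢⱼ dg)` with
`σᵢⱼ = (βᵢ - m) + (βⱼ - m)`. -/
lemma IsPhaseProjector.weierstrassForm_apply (h : IsPhaseProjector P g w γ β V)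
    (hβ : ∑ i, β i = 3 * m) (ht : t ∈ V) (v : ℂ) (i j : Fin 3) :
    weierstrassForm P t v i j = Complex.I * (1 / 3 * (conj (w i t) * w j t)) *
      ((β i + β j - 2 * m) * deriv g t * v + conj ((β i + β j - 2 * m) * deriv g t * v)) := by
  have hD : ∀ i j, matD P t i j =
      -(1 / 3 * (conj (w i t) * w j t * ((β j - β i) * deriv g t))) :=
    fun i j => (h.hasWirtinger ht i j).wirtD
  have hDb : ∀ i j, matDbar P t i j =
      1 / 3 * (conj (w i t) * w j t * conj ((β j - β i) * deriv g t)) :=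
    fun i j => (h.hasWirtinger ht i j).wirtDbar
  have hw : ∀ k, conj (w k t) * w k t = 1 := fun k => by rw [mul_comm]; exact h.mul_conj ht k
  -- the commutator of two matrices with entries `aᵢⱼ w̄ᵢ wⱼ`
  have key : ∀ (A : Matrix (Fin 3) (Fin 3) ℂ) (a : Fin 3 → Fin 3 → ℂ),
      (∀ i j, A i j = a i j * (conj (w i t) * w j t)) → ∀ i j, (A * P t - P t * A) i j =
        1 / 3 * (conj (w i t) * w j t) * ∑ k, (a k j - a i k) := by
    intro A a hA i j
    have h1 : (A * P t) i j = A i j - 1 / 3 * (conj (w i t) * w j t) * ∑ k, a i k := by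
      rw [Matrix.mul_apply, Finset.mul_sum]
      simp only [h.eq t ht, mul_sub, Finset.sum_sub_distrib, mul_ite, mul_one, mul_zero,
        Finset.sum_ite_eq', Finset.mem_univ, if_true]
      congr 1
      refine Finset.sum_congr rfl fun k _ => ?_
      rw [hA]
      linear_combination (1 / 3 * a i k * conj (w i t) * w j t) * hw k
    have h2 : (P t * A) i j = A i j - 1 / 3 * (conj (w i t) * w j t) * ∑ k, a k j := by
      rw [Matrix.mul_apply, Finset.mul_sum]
      simp only [h.eq t ht, sub_mul, Finset.sum_sub_distrib, ite_mul, one_mul, zero_mul,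
        Finset.sum_ite_eq, Finset.mem_univ, if_true]
      congr 1
      refine Finset.sum_congr rfl fun k _ => ?_
      rw [hA]
      linear_combination (1 / 3 * a k j * conj (w i t) * w j t) * hw k
    rw [Matrix.sub_apply, h1, h2, Finset.sum_sub_distrib]
    ring
  have k1 := key (matD P t) (fun i j => -(1 / 3 * ((β j - β i) * deriv g t)))
    (fun i j => by rw [hD]; ring) i j
  have k2 := key (matDbar P t) (fun i j => 1 / 3 * conj ((β j - β i) * deriv g t))
    (fun i j => by rw [hDb]; ring) i j
  have hβ' : conj (β 0) + conj (β 1) + conj (β 2) = 3 * conj m := by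
    rw [Fin.sum_univ_three] at hβ
    simpa only [map_add, map_mul, map_ofNat] using congrArg conj hβ
  rw [Fin.sum_univ_three] at hβ
  unfold weierstrassForm
  rw [Matrix.smul_apply, Matrix.add_apply, Matrix.neg_apply, Matrix.smul_apply, Matrix.smul_apply,
    k1, k2]
  simp only [Fin.sum_univ_three, smul_eq_mul, map_mul, map_sub, map_add, map_ofNat]
  linear_combination
    (-(2 / 9) * Complex.I * conj (w i t) * w j t * deriv g t * v) * hβ +
    (-(2 / 9) * Complex.I * conj (w i t) * w j t * conj (deriv g t) * conj v) * hβ'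

/-- The isotropy of the triangle: the sum of the squares of `2 Re (σᵢⱼ z)` depends on `|z|` alone. -/
lemma IsUnitTriangle.sum_re_sq (hβ : IsUnitTriangle β m) (z : ℂ) :
    ∑ i, ∑ j, ((β i + β j - 2 * m) * z + conj ((β i + β j - 2 * m) * z)) ^ 2 =
      12 * (z * conj z) := by
  have h1 := hβ.sum
  have h2 := hβ.sum_sq
  have h1' := congrArg conj h1
  have h2' := congrArg conj h2
  have h3 := hβ.dist 0
  have h4 := hβ.dist 1
  have h5 := hβ.dist 2
  -- `a`, `b`, `e` are the vectors from the centre to the vertices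
  obtain ⟨a, ha⟩ : ∃ a, a = β 0 - m := ⟨_, rfl⟩
  obtain ⟨b, hb⟩ : ∃ b, b = β 1 - m := ⟨_, rfl⟩
  obtain ⟨e, he⟩ : ∃ e, e = β 2 - m := ⟨_, rfl⟩
  have ea : β 0 = a + m := by rw [ha]; ring
  have eb : β 1 = b + m := by rw [hb]; ring
  have ee : β 2 = e + m := by rw [he]; ring
  simp only [Fin.sum_univ_three, map_add, map_pow, map_mul, map_sub, map_ofNat, map_zero] at *
  simp only [ea, eb, ee, map_add, add_sub_cancel_right] at *
  have s1 : a + b + e = 0 := by linear_combination h1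
  have s1' : conj a + conj b + conj e = 0 := by linear_combination h1'
  linear_combination (6 * z ^ 2) * h2 + (6 * (conj z) ^ 2) * h2' +
    (12 * z * conj z) * (h3 + h4 + h5) +
    (2 * z ^ 2 * (a + b + e) + 4 * z * conj z * (conj a + conj b + conj e)) * s1 +
    (2 * (conj z) ^ 2 * (conj a + conj b + conj e)) * s1'

/-- The metric induced by the Weierstrass form is `(2/3) |dg|²`. -/
lemma IsPhaseProjector.suInner_weierstrassForm (h : IsPhaseProjector P g w γ β V)
    (hβ : IsUnitTriangle β m) (ht : t ∈ V) (v : ℂ) :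
    suInner (weierstrassForm P t v) (weierstrassForm P t v) =
      ((2 / 3 * ‖deriv g t * v‖ ^ 2 : ℝ) : ℂ) := by
  have h1 : (weierstrassForm P t v * weierstrassForm P t v).trace =
      -(1 / 9) * ∑ i, ∑ j, ((β i + β j - 2 * m) * (deriv g t * v) +
        conj ((β i + β j - 2 * m) * (deriv g t * v))) ^ 2 := by
    rw [Matrix.trace, Finset.mul_sum]
    refine Finset.sum_congr rfl fun i _ => ?_
    rw [Matrix.diag_apply, Matrix.mul_apply, Finset.mul_sum]
    refine Finset.sum_congr rfl fun j _ => ?_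
    rw [h.weierstrassForm_apply hβ.sum ht, h.weierstrassForm_apply hβ.sum ht, add_comm (β j) (β i)]
    have hi := h.mul_conj ht i
    have hj := h.mul_conj ht j
    set S := (β i + β j - 2 * m) * deriv g t * v
    rw [show (β i + β j - 2 * m) * (deriv g t * v) = S by simp only [S]; ring]
    linear_combination (1 / 9 * (S + conj S) ^ 2) * (conj (w i t) * w i t * conj (w j t) * w j t) *
      Complex.I_sq - (1 / 9 * (S + conj S) ^ 2) * hi -
      (1 / 9 * (S + conj S) ^ 2 * conj (w i t) * w i t) * hj
  unfold suInner
  rw [h1, hβ.sum_re_sq]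
  rw [Complex.mul_conj, Complex.normSq_eq_norm_sq]
  push_cast
  ring

/-- The primitive of the Weierstrass form. The entries off the diagonal are multiples of those
of the projector; on the diagonal the junk value `x / 0 = 0` leaves the second summand alone. -/
def weierstrassMap (g : ℂ → ℂ) (w : Fin 3 → ℂ → ℂ) (β : Fin 3 → ℂ) (m t : ℂ) :
    Matrix (Fin 3) (Fin 3) ℂ :=
  Matrix.of fun i j =>
    Complex.I * ((β i + β j - 2 * m) / (β j - β i)) * (1 / 3) * (conj (w i t) * w j t) +
      if i = j then Complex.I * (1 / 3) * ((β i + β j - 2 * m) * g t +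
        conj ((β i + β j - 2 * m) * g t)) else 0

/-- `(βᵢ - m) + (βⱼ - m)` and `βⱼ - βᵢ` are perpendicular. -/
lemma IsUnitTriangle.conj_div (hβ : IsUnitTriangle β m) (i j : Fin 3) :
    conj ((β i + β j - 2 * m) / (β j - β i)) = -((β i + β j - 2 * m) / (β j - β i)) := by
  rcases eq_or_ne i j with rfl | hij
  · simp
  have h1 : β j - β i ≠ 0 := sub_ne_zero.2 fun h => hij (hβ.injective h.symm)
  have h2 : conj (β j - β i) ≠ 0 := (map_ne_zero _).2 h1
  rw [map_div₀, ← neg_div, div_eq_div_iff h2 h1]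
  have h3 := hβ.dist i
  have h4 := hβ.dist j
  simp only [map_add, map_mul, map_sub, map_ofNat] at *
  linear_combination 2 * h4 - 2 * h3

lemma IsPhaseProjector.isWeierstrassMap (h : IsPhaseProjector P g w γ β V)
    (hβ : IsUnitTriangle β m) : IsWeierstrassMap P (weierstrassMap g w β m) V := by
  have hd : ∀ t ∈ V, ∀ i j, HasWirtinger (fun s => weierstrassMap g w β m s i j)
      (Complex.I * (1 / 3 * (conj (w i t) * w j t)) * ((β i + β j - 2 * m) * deriv g t))
      (Complex.I * (1 / 3 * (conj (w i t) * w j t)) * conj ((β i + β j - 2 * m) * deriv g t))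
      t := by
    intro t ht i j
    rcases eq_or_ne i j with rfl | hij
    · have hg : HasWirtinger (fun s => (β i + β i - 2 * m) * g s)
          ((β i + β i - 2 * m) * deriv g t) 0 t :=
        (((h.differentiableOn.differentiableAt
          (h.isOpen.mem_nhds ht)).hasDerivAt).const_mul _).hasWirtinger
      have h1 := ((hg.add hg.conj).const_mul (Complex.I * (1 / 3)))
      have h2 : conj (w i t) * w i t = 1 := by rw [mul_comm]; exact h.mul_conj ht i
      have h3 : HasWirtinger (fun s => weierstrassMap g w β m s i i) _ _ t :=
        h1.congr (Eventually.of_forall fun s => by simp [weierstrassMap])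
      convert h3 using 1
      · rw [h2, map_zero]
        ring
      · rw [h2]
        ring
    · have h1 := (h.hasWirtinger_mul ht i j).const_mul
        (Complex.I * ((β i + β j - 2 * m) / (β j - β i)) * (1 / 3))
      have h2 : HasWirtinger (fun s => weierstrassMap g w β m s i j) _ _ t :=
        h1.congr (Eventually.of_forall fun s => by simp [weierstrassMap, hij])
      have h3 : β j - β i ≠ 0 := sub_ne_zero.2 fun h => hij (hβ.injective h.symm)
      have h4 := hβ.conj_div i j
      have h5 : (β i + β j - 2 * m) / (β j - β i) * (β j - β i) = β i + β j - 2 * m :=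
        div_mul_cancel₀ _ h3
      have h6 := congrArg conj h5
      rw [map_mul, h4] at h6
      convert h2 using 1
      · linear_combination (-Complex.I * (1 / 3) * (conj (w i t) * w j t) * deriv g t) * h5
      · simp only [map_mul] at *
        linear_combination (-Complex.I * (1 / 3) * (conj (w i t) * w j t) *
          conj (deriv g t)) * h6
  refine ⟨fun t ht => ?_, fun t ht => ?_, fun t ht i j => (hd t ht i j).differentiableAt,
    fun t ht v => ?_⟩
  · ext i j
    rw [Matrix.conjTranspose_apply, Matrix.neg_apply]
    have h1 := hβ.conj_div j i
    have h2 : (β j + β i - 2 * m) / (β i - β j) = -((β i + β j - 2 * m) / (β j - β i)) := by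
      rw [← neg_sub (β j), div_neg, add_comm (β j)]
    rw [h2] at h1
    simp only [weierstrassMap, Matrix.of_apply, Complex.star_def, map_add, map_mul]
    rw [h2, h1]
    rcases eq_or_ne i j with rfl | hij
    · simp [map_ofNat (starRingEnd ℂ)]
      ring
    · simp only [hij, hij.symm, if_false, map_zero, map_div₀, map_one, map_ofNat,
        Complex.conj_I, Complex.conj_conj]
      ring
  · have h1 := hβ.sum
    have h2 := congrArg conj h1
    simp only [Fin.sum_univ_three, map_add, map_mul, map_ofNat] at h1 h2
    simp only [Matrix.trace, Matrix.diag_apply, Fin.sum_univ_three, weierstrassMap,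
      Matrix.of_apply, sub_self, div_zero, if_true, map_mul, map_add, map_sub, map_ofNat]
    linear_combination (2 / 3 * Complex.I * g t) * h1 + (2 / 3 * Complex.I * conj (g t)) * h2
  · ext i j
    rw [h.weierstrassForm_apply hβ.sum ht]
    change fderiv ℝ (fun s => weierstrassMap g w β m s i j) t v = _
    rw [(hd t ht i j).fderiv_apply]
    simp only [map_mul]
    ring

end Weierstrass

/-! ### The induced metric -/

section InducedMetric

lemma cos_eq_half {ψ : ℝ}
    (hψ : ∃ m : ℤ, ψ = Real.pi / 3 + 2 * Real.pi * m ∨ ψ = -(Real.pi / 3) + 2 * Real.pi * m) :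
    Real.cos ψ = 1 / 2 := by
  obtain ⟨m, rfl | rfl⟩ := hψ
  · rw [mul_comm (2 * Real.pi), Real.cos_add_int_mul_two_pi, Real.cos_pi_div_three]
  · rw [mul_comm (2 * Real.pi), Real.cos_add_int_mul_two_pi, Real.cos_neg, Real.cos_pi_div_three]

lemma exp_mul_conj_and_add_conj {ψ : ℝ} (hψ : Real.cos ψ = 1 / 2) :
    Complex.exp (Complex.I * ψ) * conj (Complex.exp (Complex.I * ψ)) = 1 ∧
      Complex.exp (Complex.I * ψ) + conj (Complex.exp (Complex.I * ψ)) = 1 := by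
  constructor
  · rw [Complex.mul_conj, Complex.normSq_eq_norm_sq, mul_comm, Complex.norm_exp_ofReal_mul_I]
    simp
  · rw [Complex.add_conj, mul_comm Complex.I, Complex.exp_ofReal_mul_I_re, hψ]
    norm_num

lemma isUnitTriangle {ψ : ℝ} (hψ : Real.cos ψ = 1 / 2) :
    IsUnitTriangle ![0, 1, Complex.exp (Complex.I * ψ)]
      ((1 + Complex.exp (Complex.I * ψ)) / 3) := by
  obtain ⟨h1, h2⟩ := exp_mul_conj_and_add_conj hψ
  set α := Complex.exp (Complex.I * ψ)
  have h0 : α ≠ 0 := Complex.exp_ne_zero _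
  have h01 : α ≠ 1 := by
    intro h
    rw [h] at h2
    norm_num at h2
  have h3 : conj α = 1 - α := by linear_combination h2
  have h4 : α ^ 2 = α - 1 := by
    rw [h3] at h1
    linear_combination -h1
  refine ⟨?_, ?_, ?_, ?_⟩
  · intro i j hij
    fin_cases i <;> fin_cases j <;> simp_all
  · simp [Fin.sum_univ_three]
    ring
  · intro i
    fin_cases i <;> simp [h3, map_ofNat (starRingEnd ℂ)]
    · linear_combination (-1 / 9 : ℂ) * h4
    · linear_combination (-1 / 9 : ℂ) * h4
    · linear_combination (-4 / 9 : ℂ) * h4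
  · simp [Fin.sum_univ_three]
    linear_combination (2 / 3 : ℂ) * h4

lemma norm_div_conj {c : ℂ} (hc : c ≠ 0) : ‖c / conj c‖ = 1 := by
  rw [norm_div, Complex.norm_conj, div_self (norm_ne_zero_iff.2 hc)]

variable {c : ℂ} {ψ : ℝ} {G : ℂ → ℂ} {U : Set ℂ} {t₀ : ℂ}

/-- Near a point where `G` is analytic and non-zero, the projector of the meron-type solution is
of the form `1 - f f† / 3` with unimodular components, expressed by a logarithm `g` of `G`. -/
lemma exists_isPhaseProjector (hc : c ≠ 0) (hψ : Real.cos ψ = 1 / 2) (hG : AnalyticAt ℂ G t₀)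
    (h0 : G t₀ ≠ 0) (hU : ∀ᶠ t in 𝓝 t₀, t ∈ U) :
    ∃ (V : Set ℂ) (g : ℂ → ℂ), t₀ ∈ V ∧ V ⊆ U ∧ (∀ t ∈ V, deriv g t = logDeriv G t) ∧
      IsPhaseProjector (cp2Projector (meronW₁ G) (meronW₂ c ψ G)) g
        ![fun _ => 1, meronW₁ G, meronW₂ c ψ G] ![1, 1, c / conj c]
        ![0, 1, Complex.exp (Complex.I * ψ)] V := by
  obtain ⟨V, g, hV, ht, hVU, hg, hgd, hw₁, hw₂⟩ := exists_isPhase hG h0 hU c hψ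
  refine ⟨V, g, ht, hVU, hgd, hV, hg, ?_, ?_, ?_⟩
  · intro i
    fin_cases i <;> simp [hc]
  · intro i
    fin_cases i
    · intro t _
      simp
    · exact hw₁
    · exact hw₂
  · intro t ht i j
    have h1 := hw₁.mul_conj norm_one ht
    have h2 := hw₂.mul_conj (norm_div_conj hc) ht
    have h3 : (star ![1, conj (meronW₁ G t), conj (meronW₂ c ψ G t)] ⬝ᵥ
        ![1, conj (meronW₁ G t), conj (meronW₂ c ψ G t)] : ℂ) = 3 := by
      simp [dotProduct, Fin.sum_univ_three, h1, h2]
      norm_num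
    have hP : cp2Projector (meronW₁ G) (meronW₂ c ψ G) t = 1 - (3 : ℂ)⁻¹ •
        Matrix.vecMulVec ![1, conj (meronW₁ G t), conj (meronW₂ c ψ G t)]
          (star ![1, conj (meronW₁ G t), conj (meronW₂ c ψ G t)]) := by
      rw [← h3]
      rfl
    rw [hP, Matrix.sub_apply, Matrix.smul_apply, Matrix.vecMulVec_apply, Matrix.one_apply]
    congr 1
    fin_cases i <;> fin_cases j <;> simp

end InducedMetric

/-! ### The meron-type solution generated by `F` -/

section Surface

variable {c : ℂ} {ψ : ℝ} {F : OnePoint ℂ → ℂ} {Ω : Set (OnePoint ℂ)}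

/-- The meron-type solution generated by `F`, in the local parameter at `x`. -/
theorem meron_solution (hc : c ≠ 0) (hψ : Real.cos ψ = 1 / 2) (hΩ : IsOpen Ω)
    (hF : IsMeromorphicFunOn F Ω) (x : OnePoint ℂ) {G w₁ w₂ : ℂ → ℂ} {U : Set ℂ}
    (hGF : G = fun t => F (sphereParam x t)) (hw₁ : w₁ = meronW₁ G) (hw₂ : w₂ = meronW₂ c ψ G)
    (hUG : U = {t | sphereParam x t ∈ Ω ∧ G t ≠ 0}) :
    IsCP2Solution w₁ w₂ U ∧
      (∀ t ∈ U, w₁ t * conj (w₁ t) = 1 ∧ w₂ t * conj (w₂ t) = 1) ∧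
      (∀ t ∈ U, ∃ V, IsOpen V ∧ t ∈ V ∧ V ⊆ U ∧
        ∃ X, IsWeierstrassMap (cp2Projector w₁ w₂) X V) ∧
      (∀ V X, IsOpen V → V ⊆ U → IsWeierstrassMap (cp2Projector w₁ w₂) X V →
        ∀ t ∈ V, ∀ v, suInner (matDiff X t v) (matDiff X t v) =
          ((2 / 3 * ‖logDeriv G t * v‖ ^ 2 : ℝ) : ℂ)) := by
  have hA : ∀ t ∈ U, AnalyticAt ℂ G t ∧ G t ≠ 0 ∧ ∀ᶠ s in 𝓝 t, s ∈ U := by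
    intro t ht
    rw [hUG] at ht
    have hG : AnalyticAt ℂ G t := by
      rw [hGF]
      refine analyticAt_localRep hF ht.1 ?_
      have := ht.2
      rwa [hGF] at this
    refine ⟨hG, ht.2, ?_⟩
    filter_upwards [(continuous_sphereParam x).continuousAt.eventually_mem (hΩ.mem_nhds ht.1),
      hG.continuousAt.eventually_ne ht.2] with s hs hs'
    rw [hUG]
    exact ⟨hs, hs'⟩
  have hP : ∀ t ∈ U, ∃ (V : Set ℂ) (g : ℂ → ℂ), t ∈ V ∧ V ⊆ U ∧
      (∀ t ∈ V, deriv g t = logDeriv G t) ∧ IsPhaseProjector (cp2Projector w₁ w₂) g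
        ![fun _ => 1, w₁, w₂] ![1, 1, c / conj c] ![0, 1, Complex.exp (Complex.I * ψ)] V := by
    intro t ht
    rw [hw₁, hw₂]
    exact exists_isPhaseProjector hc hψ (hA t ht).1 (hA t ht).2.1 (hA t ht).2.2
  obtain ⟨e1, e2⟩ := exp_mul_conj_and_add_conj hψ
  have hβ := isUnitTriangle hψ
  refine ⟨⟨fun t ht => ?_, fun t ht => ?_, fun t ht => ?_, fun t ht => ?_⟩, fun t ht => ?_,
    fun t ht => ?_, fun V X hV hVU hX t ht v => ?_⟩
  · obtain ⟨V, g, htV, -, -, h⟩ := hP t ht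
    exact ((h.phase 1).contDiffAt h.isOpen h.differentiableOn htV).contDiffWithinAt
  · obtain ⟨V, g, htV, -, -, h⟩ := hP t ht
    exact ((h.phase 2).contDiffAt h.isOpen h.differentiableOn htV).contDiffWithinAt
  · obtain ⟨V, g, htV, -, -, h⟩ := hP t ht
    exact (h.phase 1).cp2Expr_eq_zero (h.phase 2) h.isOpen h.differentiableOn htV (h.norm 1)
      (h.norm 2) (by simpa [add_comm] using e2)
  · obtain ⟨V, g, htV, -, -, h⟩ := hP t ht
    exact (h.phase 2).cp2Expr_eq_zero (h.phase 1) h.isOpen h.differentiableOn htV (h.norm 2)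
      (h.norm 1) (by simpa using e2.trans e1.symm)
  · obtain ⟨V, g, htV, -, -, h⟩ := hP t ht
    exact ⟨h.mul_conj htV 1, h.mul_conj htV 2⟩
  · obtain ⟨V, g, htV, hVU, -, h⟩ := hP t ht
    exact ⟨V, h.isOpen, htV, hVU, _, h.isWeierstrassMap hβ⟩
  · obtain ⟨W, g, htW, -, hg, h⟩ := hP t (hVU ht)
    rw [hX.diff_eq t ht v, h.suInner_weierstrassForm hβ htW, hg t htW]

lemma meronMetric_eq (hc : c ≠ 0) (hψ : Real.cos ψ = 1 / 2)
    (hF : IsMeromorphicFunOn F Ω) {x : OnePoint ℂ} (hx : x ∈ regularPart F Ω) (v : ℂ) :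
    meronMetric c ψ F x v = Real.sqrt (2 / 3) ^ 2 * flatMetric F x v := by
  obtain ⟨hxΩ, h0, -⟩ := (mem_regularPart_iff hF).1 hx
  have hx0 : sphereParam x 0 = x := sphereParam_zero x
  have hG : AnalyticAt ℂ (localRep F x) 0 := analyticAt_localRep hF (by rwa [hx0]) (by rwa [hx0])
  obtain ⟨W, g, htW, -, hg, h⟩ := exists_isPhaseProjector (U := Set.univ) hc hψ hG
    (by rwa [localRep_zero]) Filter.univ_mem
  have h1 : meronMetric c ψ F x v = (((2 / 3 * ‖deriv g 0 * v‖ ^ 2 : ℝ) : ℂ)).re := by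
    rw [← h.suInner_weierstrassForm (isUnitTriangle hψ) htW]
    rfl
  rw [h1, Complex.ofReal_re, hg 0 htW, Real.sq_sqrt (by norm_num)]
  rfl

end Surface

/-! ### The function `ξ (ξ - 1)` -/

section Example

lemma exampleF_coe (a : ℂ) : exampleF (a : OnePoint ℂ) = a * (a - 1) := rfl

lemma localRep_exampleF_coe (a t : ℂ) :
    localRep exampleF (a : OnePoint ℂ) t = (a + t) * (a + t - 1) := by
  rw [localRep_apply, sphereParam_coe, exampleF_coe]

lemma localRep_exampleF_infty (t : ℂ) :
    localRep exampleF OnePoint.infty t = t ^ (-2 : ℤ) * (1 - t) := by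
  rw [localRep_apply, sphereParam_infty]
  by_cases ht : t = 0
  · subst ht
    simp [sphereInv, exampleF]
  · simp only [sphereInv, OnePoint.elim_some, ht, if_false, exampleF]
    field_simp

lemma isMeromorphicFunOn_exampleF : IsMeromorphicFunOn exampleF Set.univ := by
  intro x _
  change MeromorphicNFAt (localRep exampleF x) 0
  induction x using OnePoint.rec with
  | infty =>
    refine Or.inr ⟨-2, fun t => 1 - t, by fun_prop, by simp, ?_⟩
    exact Eventually.of_forall fun t => by simp [localRep_exampleF_infty]
  | coe a =>
    apply AnalyticAt.meromorphicNFAt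
    rw [funext (localRep_exampleF_coe a)]
    fun_prop

lemma exampleF_eq_zero_iff {x : OnePoint ℂ} : exampleF x = 0 ↔
    x = ((0 : ℂ) : OnePoint ℂ) ∨ x = ((1 : ℂ) : OnePoint ℂ) ∨ x = OnePoint.infty := by
  induction x using OnePoint.rec with
  | infty => simp [exampleF]
  | coe a => simp [exampleF_coe, sub_eq_zero]

lemma exampleF_order_ne_top (x : OnePoint ℂ) :
    meromorphicOrderAt (dlogCoeff exampleF x) 0 ≠ ⊤ :=
  dlogCoeff_order_ne_top isOpen_univ isPreconnected_univ isMeromorphicFunOn_exampleF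
    ⟨((0 : ℂ) : OnePoint ℂ), trivial, ((2 : ℂ) : OnePoint ℂ), trivial,
      by simp only [exampleF_coe]; norm_num⟩ x trivial

lemma hasSimplePole_exampleF {p : OnePoint ℂ} (hp : exampleF p = 0) {n : ℤ} {g : ℂ → ℂ}
    (hg : AnalyticAt ℂ g 0) (hg0 : g 0 ≠ 0) (h : ∀ t, localRep exampleF p t = t ^ n * g t) :
    HasSimplePole exampleF p n :=
  ⟨(dlogCoeff_order_eq_neg_one_iff isMeromorphicFunOn_exampleF trivial
    (exampleF_order_ne_top p)).2 hp, tendsto_mul_dlogCoeff hg hg0 (Eventually.of_forall h)⟩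

lemma hasSimplePole_exampleF_zero : HasSimplePole exampleF ((0 : ℂ) : OnePoint ℂ) 1 := by
  have := hasSimplePole_exampleF (n := 1) (exampleF_eq_zero_iff.2 (Or.inl rfl))
    (g := fun t => t - 1) (by fun_prop) (by simp) fun t => by simp [localRep_exampleF_coe]
  simpa using this

lemma hasSimplePole_exampleF_one : HasSimplePole exampleF ((1 : ℂ) : OnePoint ℂ) 1 := by
  have := hasSimplePole_exampleF (n := 1) (exampleF_eq_zero_iff.2 (Or.inr (Or.inl rfl)))
    (g := fun t => t + 1) (by fun_prop) (by simp) fun t => by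
      rw [localRep_exampleF_coe, zpow_one]; ring
  simpa using this

lemma hasSimplePole_exampleF_infty : HasSimplePole exampleF OnePoint.infty (-2) := by
  have := hasSimplePole_exampleF (n := -2) (exampleF_eq_zero_iff.2 (Or.inr (Or.inr rfl)))
    (g := fun t => 1 - t) (by fun_prop) (by simp) localRep_exampleF_infty
  simpa using this

lemma hasSimplePole_exampleF_iff (p : OnePoint ℂ) (r : ℂ) : HasSimplePole exampleF p r ↔
    (p = ((0 : ℂ) : OnePoint ℂ) ∧ r = 1) ∨ (p = ((1 : ℂ) : OnePoint ℂ) ∧ r = 1) ∨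
      (p = OnePoint.infty ∧ r = -2) := by
  constructor
  · intro h
    have hp : exampleF p = 0 := (exists_hasSimplePole_iff isMeromorphicFunOn_exampleF trivial
      (exampleF_order_ne_top p)).1 ⟨r, h⟩
    rcases exampleF_eq_zero_iff.1 hp with rfl | rfl | rfl
    · exact Or.inl ⟨rfl, h.unique hasSimplePole_exampleF_zero⟩
    · exact Or.inr (Or.inl ⟨rfl, h.unique hasSimplePole_exampleF_one⟩)
    · exact Or.inr (Or.inr ⟨rfl, h.unique hasSimplePole_exampleF_infty⟩)
  · rintro (⟨rfl, rfl⟩ | ⟨rfl, rfl⟩ | ⟨rfl, rfl⟩)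
    · exact hasSimplePole_exampleF_zero
    · exact hasSimplePole_exampleF_one
    · exact hasSimplePole_exampleF_infty

lemma isDlogZero_exampleF_iff (x : OnePoint ℂ) :
    IsDlogZero exampleF x ↔ x = ((1 / 2 : ℂ) : OnePoint ℂ) := by
  rw [isDlogZero_iff isMeromorphicFunOn_exampleF trivial (exampleF_order_ne_top x),
    mem_regularPart_iff isMeromorphicFunOn_exampleF]
  induction x using OnePoint.rec with
  | infty => simp [exampleF]
  | coe a =>
    have hd : deriv (localRep exampleF (a : OnePoint ℂ)) 0 = 2 * a - 1 := by
      rw [funext (localRep_exampleF_coe a)]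
      have h1 : HasDerivAt (fun t : ℂ => a + t) 1 0 := (hasDerivAt_id 0).const_add a
      rw [(h1.fun_mul (h1.sub_const 1)).deriv]
      ring
    rw [hd, OnePoint.coe_eq_coe]
    constructor
    · rintro ⟨h1, h2⟩
      by_contra h3
      exact h2 ⟨trivial, h1, fun h4 => h3 (by linear_combination h4 / 2)⟩
    · rintro rfl
      refine ⟨by rw [exampleF_coe]; norm_num, fun h => h.2.2 (by norm_num)⟩

theorem exampleF_cylinders : ∃ D₀ D₁ D₂ : Set (OnePoint ℂ),
    D₀ = ringDomain exampleF Set.univ ((0 : ℂ) : OnePoint ℂ) ∧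
    D₁ = ringDomain exampleF Set.univ ((1 : ℂ) : OnePoint ℂ) ∧
    D₂ = ringDomain exampleF Set.univ OnePoint.infty ∧
    IsSemiInfiniteCylinder (flatMetric exampleF) ((0 : ℂ) : OnePoint ℂ) (2 * Real.pi) D₀ ∧
    IsSemiInfiniteCylinder (flatMetric exampleF) ((1 : ℂ) : OnePoint ℂ) (2 * Real.pi) D₁ ∧
    IsSemiInfiniteCylinder (flatMetric exampleF) OnePoint.infty (4 * Real.pi) D₂ ∧
    Disjoint D₀ D₁ ∧ Disjoint D₀ D₂ ∧ Disjoint D₁ D₂ ∧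
    closure D₀ ∪ closure D₁ ∪ closure D₂ = Set.univ := by
  have hF := isMeromorphicFunOn_exampleF
  have hz : IsDlogZero exampleF ((1 / 2 : ℂ) : OnePoint ℂ) := (isDlogZero_exampleF_iff _).2 rfl
  have hend : ∀ {p r}, HasSimplePole exampleF p r → IsCylindricalEnd exampleF Set.univ p r :=
    fun h => h.isCylindricalEnd isOpen_univ isPreconnected_univ hF
      (fun x _ => exampleF_order_ne_top x) ⟨_, trivial, hz⟩ trivial
  have h0 := hend hasSimplePole_exampleF_zero
  have h1 := hend hasSimplePole_exampleF_one
  have h2 := hend hasSimplePole_exampleF_infty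
  have e0 : exampleF ((0 : ℂ) : OnePoint ℂ) = 0 := exampleF_eq_zero_iff.2 (Or.inl rfl)
  have e1 : exampleF ((1 : ℂ) : OnePoint ℂ) = 0 := exampleF_eq_zero_iff.2 (Or.inr (Or.inl rfl))
  refine ⟨_, _, _, rfl, rfl, rfl, ?_, ?_, ?_, h0.disjoint hF h1 trivial e0 (by simp),
    h0.disjoint hF h2 trivial e0 (OnePoint.coe_ne_infty _),
    h1.disjoint hF h2 trivial e1 (OnePoint.coe_ne_infty _), ?_⟩
  · simpa using h0.isSemiInfiniteCylinder (flatMetric exampleF) 1 one_pos (by simp)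
  · simpa using h1.isSemiInfiniteCylinder (flatMetric exampleF) 1 one_pos (by simp)
  · have := h2.isSemiInfiniteCylinder (flatMetric exampleF) 1 one_pos (by simp)
    rwa [norm_neg, Complex.norm_ofNat, one_mul,
      show 2 * Real.pi * 2 = 4 * Real.pi by ring] at this
  · obtain ⟨k, hk⟩ := exists_isDecomposable hF exampleF_order_ne_top ⟨_, hz⟩
    refine Set.eq_univ_of_forall fun x => ?_
    obtain ⟨p, hp, hx⟩ := hk.exists_mem_closure
      (κ := ‖exampleF ((1 / 2 : ℂ) : OnePoint ℂ)‖)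
      (fun y hy => by rw [(isDlogZero_exampleF_iff y).1 hy]) x
    rcases exampleF_eq_zero_iff.1 hp with rfl | rfl | rfl
    · exact Or.inl (Or.inl hx)
    · exact Or.inl (Or.inr hx)
    · exact Or.inr hx

end Example

end

/-! ### Metric, cylinders and decomposition -/

theorem mainTheorem7 (c : ℂ) (hc : c ≠ 0) (ψ : ℝ)
    (hψ : ∃ m : ℤ, ψ = Real.pi / 3 + 2 * Real.pi * m ∨ ψ = -(Real.pi / 3) + 2 * Real.pi * m) :
    (∀ (Ω : Set (OnePoint ℂ)) (F : OnePoint ℂ → ℂ),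
      IsOpen Ω → IsConnected Ω → IsMeromorphicFunOn F Ω →
      -- the solution, its Weierstrass surface and the induced metric, in every local parameter
      (∀ (x : OnePoint ℂ) (G w₁ w₂ : ℂ → ℂ) (U : Set ℂ),
        G = (fun t => F (sphereParam x t)) → w₁ = meronW₁ G → w₂ = meronW₂ c ψ G →
        U = {t | sphereParam x t ∈ Ω ∧ G t ≠ 0} →
          IsCP2Solution w₁ w₂ U ∧
          (∀ t ∈ U, w₁ t * conj (w₁ t) = 1 ∧ w₂ t * conj (w₂ t) = 1) ∧
          (∀ t ∈ U, ∃ V, IsOpen V ∧ t ∈ V ∧ V ⊆ U ∧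
            ∃ X, IsWeierstrassMap (cp2Projector w₁ w₂) X V) ∧
          (∀ V X, IsOpen V → V ⊆ U → IsWeierstrassMap (cp2Projector w₁ w₂) X V →
            ∀ t ∈ V, ∀ v, suInner (matDiff X t v) (matDiff X t v) =
              ((2 / 3 * ‖logDeriv G t * v‖ ^ 2 : ℝ) : ℂ))) ∧
      -- the cylinders
      ((∃ x ∈ Ω, ∃ y ∈ Ω, F x ≠ F y) → (∃ x ∈ Ω, IsDlogZero F x) →
        (∀ p ∈ Ω, ∀ r, HasSimplePole F p r →
          IsFoliatedAround F Ω p (ringDomain F Ω p) ∧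
          IsSemiInfiniteCylinder (flatMetric F) p (2 * Real.pi * ‖r‖) (ringDomain F Ω p) ∧
          IsSemiInfiniteCylinder (meronMetric c ψ F) p
            (Real.sqrt (2 / 3) * (2 * Real.pi * ‖r‖)) (ringDomain F Ω p)) ∧
        (∀ p ∈ Ω, ∀ p' ∈ Ω, ∀ r r', HasSimplePole F p r → HasSimplePole F p' r' → p ≠ p' →
          Disjoint (ringDomain F Ω p) (ringDomain F Ω p')) ∧
        -- the decomposition of the whole surface
        (Ω = Set.univ →
          ((∀ x, ∃ p r, HasSimplePole F p r ∧ x ∈ closure (ringDomain F Ω p)) ↔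
            ∃ k : ℝ, ∀ x, IsDlogZero F x → ‖F x‖ = k) ∧
          (∀ k : ℝ, (∀ x, IsDlogZero F x → ‖F x‖ = k) →
            ∀ x, ‖F x‖ = k ↔
              ¬ ∃ p r, HasSimplePole F p r ∧ x ∈ insert p (ringDomain F Ω p))))) ∧
    -- the example `F = ξ (ξ - 1)`
    (IsMeromorphicFunOn exampleF Set.univ ∧
      (∀ p r, HasSimplePole exampleF p r ↔
        (p = ((0 : ℂ) : OnePoint ℂ) ∧ r = 1) ∨ (p = ((1 : ℂ) : OnePoint ℂ) ∧ r = 1) ∨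
          (p = OnePoint.infty ∧ r = -2)) ∧
      (∀ x, IsDlogZero exampleF x ↔ x = ((1 / 2 : ℂ) : OnePoint ℂ)) ∧
      ∃ D₀ D₁ D₂ : Set (OnePoint ℂ),
        D₀ = ringDomain exampleF Set.univ ((0 : ℂ) : OnePoint ℂ) ∧
        D₁ = ringDomain exampleF Set.univ ((1 : ℂ) : OnePoint ℂ) ∧
        D₂ = ringDomain exampleF Set.univ OnePoint.infty ∧
        IsSemiInfiniteCylinder (flatMetric exampleF) ((0 : ℂ) : OnePoint ℂ) (2 * Real.pi) D₀ ∧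
        IsSemiInfiniteCylinder (flatMetric exampleF) ((1 : ℂ) : OnePoint ℂ) (2 * Real.pi) D₁ ∧
        IsSemiInfiniteCylinder (flatMetric exampleF) OnePoint.infty (4 * Real.pi) D₂ ∧
        Disjoint D₀ D₁ ∧ Disjoint D₀ D₂ ∧ Disjoint D₁ D₂ ∧
        closure D₀ ∪ closure D₁ ∪ closure D₂ = Set.univ) := by
  have hcos := cos_eq_half hψ
  refine ⟨fun Ω F hΩ hΩc hF => ⟨fun x G w₁ w₂ U hG h₁ h₂ hU =>
    meron_solution hc hcos hΩ hF x hG h₁ h₂ hU, fun hnc hz => ?_⟩,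
    isMeromorphicFunOn_exampleF, hasSimplePole_exampleF_iff, isDlogZero_exampleF_iff,
    exampleF_cylinders⟩
  have hfin := dlogCoeff_order_ne_top hΩ hΩc.isPreconnected hF hnc
  have hend : ∀ {p r}, p ∈ Ω → HasSimplePole F p r → IsCylindricalEnd F Ω p r :=
    fun hp h => h.isCylindricalEnd hΩ hΩc.isPreconnected hF hfin hz hp
  refine ⟨fun p hp r h => ⟨(hend hp h).isFoliatedAround, ?_, ?_⟩,
    fun p hp p' hp' r r' h h' hne => ?_, ?_⟩
  · simpa using (hend hp h).isSemiInfiniteCylinder (flatMetric F) 1 one_pos (by simp)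
  · exact (hend hp h).isSemiInfiniteCylinder _ _ (Real.sqrt_pos.2 (by norm_num))
      fun x hx v => meronMetric_eq hc hcos hF hx v
  · exact (hend hp h).disjoint hF (hend hp' h') hp
      ((exists_hasSimplePole_iff hF hp (hfin p hp)).1 ⟨r, h⟩) hne
  · rintro rfl
    obtain ⟨x, -, hx⟩ := hz
    obtain ⟨k, hk⟩ := exists_isDecomposable hF (fun x => hfin x trivial) ⟨x, hx⟩
    exact ⟨hk.cover_iff, fun κ hκ => hk.level_iff ⟨x, hx⟩ hκ⟩
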